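/- **Setting.** A row-sorted matrix $A$ has $m\ge 1$ rows; row $i$ ($0\le i<m$) is a non-decreasing sequence of $n_i\in\mathbb N\cup\{\infty\}$ items $A_{i,1}\le A_{i,2}\le\cdots$ of a totally ordered set, and positions beyond the end of a row are regarded as holding $+\infty$. The $n_i$ are not part of the input. Numbers $k_0,\dots,k_{m-1}$ with $k_i\le n_i$ *select $k$ smallest items* if $\sum_i k_i=k$ and no item among the first $k_i$ items of a row $i$ is larger than an item of any row $i'$ that is not among the first $k_{i'}$ items of that row. Algorithms are deterministic programs for a word RAM with $w$-bit words, $w$ at least a constant multiple of the logarithm of the numbers in the input (row number $m$, rank $k$, addresses, and row lengths where these are given). The items can be accessed only through comparisons $A_{i,j}<A_{i',j'}$; running time is the number of elementary operations, and all constants are absolute. **Subroutines.** A *Mat-Select$_1$ procedure* selects $k$ smallest items of a row-sorted matrix with $m$ rows, given implicitly by the list of those columns of $A$ that form its first $k$ columns, in $O(m+k)$ time. A *Mat-Select$_3$ procedure* selects $k$ smallest items of a row-sorted matrix with $m$ rows of given finite lengths $n_i\ge 1$, where $k\le\sum_i n_i$, in $O(m+\sum_i\log n_i)$ time. **Mat-Select$_4(A,k)$**,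 built from such procedures: Partition each row into consecutive blocks of sizes $1,2,4,\dots$; the last item of a block is its representative. For $\ell=m,2m,4m,\dots$ do the following. Use Mat-Select$_1$ to select $\ell$ smallest representatives, say $\ell_i$ from row $i$ (representatives in columns after column $k+1$ are replaced by the item in column $k+1$). Let $n'_i=\min(2^{\ell_i+1}-1,\,k+1)$. If $\sum_i n'_i<k$, go on to the next $\ell$. Otherwise use Mat-Select$_3$ to select $k$ smallest items from the matrix formed by the first $n'_i$ items of each row $i$, say $k_i$ from row $i$; let $M$ be the largest of the items $A_{i,k_i}$ with $k_i\ge1$; if $A_{i,k_i+1}\ge M$ for all $i$, return $(k_i)_i$; otherwise go on to the next $\ell$. **Theorem.** There are a Mat-Select$_1$ procedure and a Mat-Select$_3$ procedure such that, for every row-sorted matrix $A$ with $m\ge 1$ rows and at least $k$ items, where $k\ge 2m$, the algorithm Mat-Select$_4(A,k)$ built from them terminates, selects $k$ smallest items of $A$, and runs in time $$O\Bigl(m+\sum_{i=0}^{m-1}\log(k_i+1)\Bigr),$$ where $k_i$ is the number of items selected from row $i$. -/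

import Mathlib

/-!
# Selection from row-sorted matrices: machine model, problem, algorithm

Everything is indexed from `0`: the rows of a matrix are `0, …, m - 1` and the items of a row are
`A i 0, A i 1, …`.
-/

universe u

namespace MatRAM

/-! ## The machine: a comparison-based word RAM with procedures -/

/-- Expressions. `reg r` is the content of register `r` and `mem a` the content of the memory cell
with address `a`. The items of the input matrix are accessible only through `less i j i' j'`, the
comparison of the two items in positions `(i, j)` and `(i', j')`. -/
inductive Expr where
  | lit (c : ℕ)
  | reg (r : ℕ)
  | mem (a : Expr)
  | add (a b : Expr)
  | sub (a b : Expr)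
  | mul (a b : Expr)
  | div (a b : Expr)
  | lt (a b : Expr)
  | less (i j i' j' : Expr)

instance : Add Expr := ⟨Expr.add⟩
instance : Sub Expr := ⟨Expr.sub⟩
instance : Mul Expr := ⟨Expr.mul⟩
instance : Div Expr := ⟨Expr.div⟩
instance (c : ℕ) : OfNat Expr c := ⟨Expr.lit c⟩

/-- Commands. A procedure is a command. It is executed in a frame of its own: registers
`0, 1, …` hold the arguments, all other registers hold `0`; the memory is shared.
`run q args r` calls the procedure `q`, and `call args r` calls recursively the procedure whose
body is being executed; in both cases the final content of register `0` of the callee is put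
into register `r` of the caller. -/
inductive Cmd where
  | skip
  | set (r : ℕ) (e : Expr)
  | store (a e : Expr)
  | seq (c d : Cmd)
  | ite (e : Expr) (c d : Cmd)
  | while (e : Expr) (c : Cmd)
  | call (args : List Expr) (r : ℕ)
  | run (q : Cmd) (args : List Expr) (r : ℕ)

/-- The content of the registers and of the memory. -/
structure State where
  reg : ℕ → ℕ
  mem : ℕ → ℕ

/-- The number of operations needed to evaluate an expression. -/
def Expr.cost : Expr → ℕ
  | .lit _ => 1
  | .reg _ => 1
  | .mem a => a.cost + 1
  | .add a b => a.cost + b.cost + 1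
  | .sub a b => a.cost + b.cost + 1
  | .mul a b => a.cost + b.cost + 1
  | .div a b => a.cost + b.cost + 1
  | .lt a b => a.cost + b.cost + 1
  | .less i j i' j' => i.cost + j.cost + i'.cost + j'.cost + 1

section Semantics

variable {α : Type u} [LinearOrder α]

/-- The value of an expression on a machine with words of `w` bits, for the input matrix `A`.
Arithmetic is modulo `2 ^ w`, except that differences are truncated at `0`. -/
def Expr.eval (w : ℕ) (A : ℕ → ℕ → α) (σ : State) : Expr → ℕ
  | .lit c => c % 2 ^ w
  | .reg r => σ.reg r
  | .mem a => σ.mem (a.eval w A σ)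
  | .add a b => (a.eval w A σ + b.eval w A σ) % 2 ^ w
  | .sub a b => a.eval w A σ - b.eval w A σ
  | .mul a b => (a.eval w A σ * b.eval w A σ) % 2 ^ w
  | .div a b => a.eval w A σ / b.eval w A σ
  | .lt a b => if a.eval w A σ < b.eval w A σ then 1 else 0
  | .less i j i' j' =>
      if A (i.eval w A σ) (j.eval w A σ) < A (i'.eval w A σ) (j'.eval w A σ) then 1 else 0

/-- The registers at the beginning of a procedure call with the given arguments. -/
def frame (args : List ℕ) : ℕ → ℕ := fun r => args.getD r 0

/-- The state in which a procedure starts that is called in state `σ`. -/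
def State.enter (w : ℕ) (A : ℕ → ℕ → α) (σ : State) (args : List Expr) : State :=
  ⟨frame (args.map (Expr.eval w A σ)), σ.mem⟩

/-- The state of the caller (called from `σ`) after the callee has stopped in state `τ`. -/
def State.leave (σ τ : State) (r : ℕ) : State :=
  ⟨Function.update σ.reg r (τ.reg 0), τ.mem⟩

/-- `Exec w A p c σ τ t`: on a machine with words of `w` bits and for the input matrix `A`, the
command `c`, as a part of the procedure `p`, started in state `σ`, stops in state `τ` after exactly
`t` steps. A condition holds if its value is not `0`. -/
inductive Exec (w : ℕ) (A : ℕ → ℕ → α) : Cmd → Cmd → State → State → ℕ → Prop where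
  | skip {p : Cmd} {σ : State} :
      Exec w A p .skip σ σ 1
  | set {p : Cmd} {σ : State} {r : ℕ} {e : Expr} :
      Exec w A p (.set r e) σ ⟨Function.update σ.reg r (e.eval w A σ), σ.mem⟩ (e.cost + 1)
  | store {p : Cmd} {σ : State} {a e : Expr} :
      Exec w A p (.store a e) σ
        ⟨σ.reg, Function.update σ.mem (a.eval w A σ) (e.eval w A σ)⟩ (a.cost + e.cost + 1)
  | seq {p c d : Cmd} {σ τ υ : State} {s t : ℕ} :
      Exec w A p c σ τ s → Exec w A p d τ υ t → Exec w A p (.seq c d) σ υ (s + t)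
  | ite_true {p c d : Cmd} {e : Expr} {σ τ : State} {t : ℕ} :
      e.eval w A σ ≠ 0 → Exec w A p c σ τ t → Exec w A p (.ite e c d) σ τ (e.cost + 1 + t)
  | ite_false {p c d : Cmd} {e : Expr} {σ τ : State} {t : ℕ} :
      e.eval w A σ = 0 → Exec w A p d σ τ t → Exec w A p (.ite e c d) σ τ (e.cost + 1 + t)
  | while_true {p c : Cmd} {e : Expr} {σ τ υ : State} {s t : ℕ} :
      e.eval w A σ ≠ 0 → Exec w A p c σ τ s → Exec w A p (.while e c) τ υ t →
        Exec w A p (.while e c) σ υ (e.cost + 1 + s + t)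
  | while_false {p c : Cmd} {e : Expr} {σ : State} :
      e.eval w A σ = 0 → Exec w A p (.while e c) σ σ (e.cost + 1)
  | call {p : Cmd} {args : List Expr} {r : ℕ} {σ τ : State} {t : ℕ} :
      Exec w A p p (σ.enter w A args) τ t →
        Exec w A p (.call args r) σ (σ.leave τ r) ((args.map Expr.cost).sum + 1 + t)
  | run {p q : Cmd} {args : List Expr} {r : ℕ} {σ τ : State} {t : ℕ} :
      Exec w A q q (σ.enter w A args) τ t →
        Exec w A p (.run q args r) σ (σ.leave τ r) ((args.map Expr.cost).sum + 1 + t)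

/-- On a machine with words of `w` bits and for the input matrix `A`, the procedure `p` with
arguments `args`, called when the content of the memory is `μ`, stops after exactly `t` steps
and leaves the content `ν` in the memory. -/
def Runs (w : ℕ) (A : ℕ → ℕ → α) (p : Cmd) (args : List ℕ) (μ ν : ℕ → ℕ) (t : ℕ) : Prop :=
  ∃ ρ : ℕ → ℕ, Exec w A p p ⟨frame args, μ⟩ ⟨ρ, ν⟩ t

/-! ## The selection problem -/

/-- The matrix `A` with `m` rows, whose `i`-th row consists of the `n i` items `A i j` with
`j < n i`, is row-sorted. -/
def RowSorted (m : ℕ) (n : ℕ → ℕ∞) (A : ℕ → ℕ → α) : Prop :=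
  ∀ i < m, ∀ j j' : ℕ, j ≤ j' → (j' : ℕ∞) < n i → A i j ≤ A i j'

/-- The first `K i` items of the rows `i < m` together are `k` smallest items of the matrix `A` with
`m` rows of lengths `n i`: there are `k` of them, and none is larger than an item that is
left out. -/
def IsSelection (m : ℕ) (n : ℕ → ℕ∞) (A : ℕ → ℕ → α) (k : ℕ) (K : ℕ → ℕ) : Prop :=
  (∀ i < m, (K i : ℕ∞) ≤ n i) ∧
  ∑ i ∈ Finset.range m, K i = k ∧
  ∀ i < m, ∀ j < K i, ∀ i' < m, ∀ j' : ℕ, K i' ≤ j' → (j' : ℕ∞) < n i' → A i j ≤ A i' j'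

end Semantics

/-- `S` selects the `k` smallest items of a row-sorted matrix with `m` rows in `O(m + k)` time.
The matrix is given implicitly: its `j`-th column is the column of `A` whose number is in the
memory cell `g + j`. (Its first `k` columns contain `k` smallest items.)
Called with arguments `m, k, g, f`, the procedure writes the number of items selected from row `i`
into cell `f + i`, and uses the cells from `f` on as its working memory; their initial content is
arbitrary. The word length is logarithmic in the numbers involved. -/
def IsMatSelect1 (S : Cmd) : Prop :=
  ∃ c C : ℕ, ∀ (α : Type u) [LinearOrder α] (A : ℕ → ℕ → α) (m k g f w : ℕ) (μ : ℕ → ℕ),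
    0 < m → (m + k + g + f + 2) ^ c ≤ 2 ^ w →
    g + k ≤ f → (∀ j < k, μ (g + j) < 2 ^ w) →
    RowSorted m (fun _ => k) (fun i j => A i (μ (g + j))) →
    ∃ (ν : ℕ → ℕ) (t : ℕ), Runs w A S [m, k, g, f] μ ν t ∧
      (∀ a < f, ν a = μ a) ∧
      IsSelection m (fun _ => k) (fun i j => A i (μ (g + j))) k (fun i => ν (f + i)) ∧
      t ≤ C * (m + k)

/-- `S` selects the `k` smallest items of a row-sorted matrix with `m` rows of lengths
`n 0, …, n (m - 1) ≥ 1` in `O(m + ∑ log (n i))` time.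
Called with arguments `m, k, g, f`, where the length `n i` is in the memory cell `g + i`, the
procedure writes the number of items selected from row `i` into cell `f + i`, and uses the cells
from `f` on as its working memory; their initial content is arbitrary. -/
def IsMatSelect3 (S : Cmd) : Prop :=
  ∃ c C : ℕ, ∀ (α : Type u) [LinearOrder α] (A : ℕ → ℕ → α) (n : ℕ → ℕ) (m k g f w : ℕ)
    (μ : ℕ → ℕ),
    0 < m → (m + k + ∑ i ∈ Finset.range m, n i + g + f + 2) ^ c ≤ 2 ^ w →
    g + m ≤ f → (∀ i < m, μ (g + i) = n i) → (∀ i < m, 1 ≤ n i) →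
    k ≤ ∑ i ∈ Finset.range m, n i →
    RowSorted m (fun i => n i) A →
    ∃ (ν : ℕ → ℕ) (t : ℕ), Runs w A S [m, k, g, f] μ ν t ∧
      (∀ a < f, ν a = μ a) ∧
      IsSelection m (fun i => n i) A k (fun i => ν (f + i)) ∧
      (t : ℝ) ≤ C * (m + ∑ i ∈ Finset.range m, Real.logb 2 (n i))

/-! ## Mat-Select₄ -/

/-- The commands of a list, one after the other. -/
def Cmd.block (l : List Cmd) : Cmd := l.foldr Cmd.seq Cmd.skip

/-- Execute `c` for the values `0, …, e - 1` of register `i`. -/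
def Cmd.for (i : ℕ) (e : Expr) (c : Cmd) : Cmd :=
  .block [.set i 0, .while (.lt (.reg i) e) (.block [c, .set i (.reg i + 1)])]

/-- The minimum of two expressions. -/
def Expr.min (a b : Expr) : Expr := a - (a - b)

namespace MatSelect4

/-! The registers of the procedure: the arguments `m`, `k` and `f`, where the cells from `f` on are
the working memory; the guess `l` for the number of block representatives among the `k` smallest
items; a flag; a loop variable; the sum of the `n i`; the first cell of the working memory of the
subroutines; the row of the largest selected item. Register `9` receives return values. -/

abbrev m : Expr := .reg 0
abbrev k : Expr := .reg 1
abbrev f : Expr := .reg 2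
abbrev l : Expr := .reg 3
abbrev done : Expr := .reg 4
abbrev i : Expr := .reg 5
abbrev sum : Expr := .reg 6
abbrev base : Expr := .reg 7
abbrev row : Expr := .reg 8

/-- Write into the cells `f + m + j`, for `0 ≤ j ≤ l`, the column of the representative, i.e. of
the last item, of the `j`-th of the blocks of sizes `1, 2, 4, …`. This is column
`2 ^ (j + 1) - 2`, which is replaced by column `k` if it is larger than that. -/
def representatives : Cmd :=
  .block [
    .store (f + m) 0,
    .for 5 l (.store (f + m + i + 1) (.min (2 * .mem (f + m + i) + 2) k))]

/-- If `l i` representatives were selected from row `i`, then put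
`n i = min (2 ^ (l i + 1) - 1) (k + 1)` into cell `f + i`. Compute also the sum of the `n i`. -/
def lengths : Cmd :=
  .block [
    .set 6 0,
    .for 5 m (.block [
      .store (f + i) (.mem (f + m + .mem (base + i)) + 1),
      .set 6 (sum + .mem (f + i))])]

/-- The number `K e` of items selected from row `e`. -/
abbrev count (e : Expr) : Expr := .mem (base + e)

/-- Find the row of the largest selected item (`m` if no item is selected). -/
def findMax : Cmd :=
  .block [
    .set 8 m,
    .for 5 m (.ite (.lt 0 (count i))
      (.ite (.lt row m)
        (.ite (.less row (count row - 1) i (count i - 1)) (.set 8 i) .skip)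
        (.set 8 i))
      .skip)]

/-- Set the flag to `1` if in no row the first item left out is smaller than the largest selected
item, and to `0` otherwise. -/
def verify : Cmd :=
  .block [
    .set 4 1,
    .for 5 m (.ite (.less i (count i) row (count row - 1)) (.set 4 0) .skip)]

/-- Move the result to the cells `f, …, f + m - 1`. -/
def copyResult : Cmd :=
  .for 5 m (.store (f + i) (count i))

end MatSelect4

open MatSelect4 in
/-- The procedure Mat-Select₄, built from Mat-Select₁ and Mat-Select₃. Its arguments are `m`, `k`
and `f`, where the cells from `f` on are its working memory. It puts the number of items selected
from row `i` into cell `f + i`. -/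
def matSelect4 (matSelect1 matSelect3 : Cmd) : Cmd :=
  .block [
    .set 3 m,
    .set 4 0,
    .while (.lt done 1) (.block [
      representatives,
      .set 7 (f + m + l + 1),
      .run matSelect1 [m, l, f + m, base] 9,
      lengths,
      .ite (.lt sum k) .skip (.block [
        .run matSelect3 [m, k, f, base] 9,
        findMax,
        verify]),
      .ite (.lt done 1) (.set 3 (l + l)) .skip]),
    copyResult]

end MatRAM

set_option linter.unusedSectionVars false
set_option linter.unusedSimpArgs false

/-! Both subroutines are one procedure `matSel`, differing only in how columns and row lengths are
read. Its heart is `core`, which computes selections of two ranks `a ≤ b` at once by sampling. Only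
the `min b m` rows with smallest first items matter for rank `b`. From those with at least two
items, every second item forms a sample, from which selections of ranks about `(a - m) / 2` and `b /
2` are computed recursively. The smaller one forces twice its counts into the answer
(`sample_lower`), and the larger one excludes everything two items beyond twice its counts
(`sample_upper`). About `b - a + 3 * m` candidates remain, and linear-time selection by medians of
medians (`select_spec`, used through `mark_spec`) decides between them. Starting from `a = b = k`,
the gap `b - a` is halved up to an additive `m` at each level, so a level costs `O(b - a + m)`. Two
potentials pay for it: `m + 2 * b` gives the bound of Mat-Select₁, and the sum of `1 + Nat.log 2 n`
over the row lengths `n` gives that of Mat-Select₃ (`core_spec_succ`).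

For Mat-Select₄ break ties between rows by row number (`tagged`), which makes the selection `K₀` of
rank `k` unique. A row contributing `x` selected items has `reps x = Nat.log 2 (x + 1)` complete
blocks among them. As soon as `l` is at least the sum of the `reps (K₀ i)`, all representatives
among the `k` smallest items are selected (`reps_le_of_selects`). Then every row, cut off after its
first unselected representative, is long enough, the selection from the cut rows is `K₀`
(`eq_of_selects`), and the test succeeds. So a failing stage has `l` below that sum. A stage costs
`O(l)`, because the logarithms of the cut lengths sum to at most `l`; as `l` doubles, the last stage
dominates.

One subtlety remains: the test compares items without tie-breaking, so a stage may return a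
selection other than `K₀`, whereas the time bound refers to the numbers returned. In that case some
row is selected up to its cut, that is, beyond an unselected representative, and an exchange
argument shows that all `l` selected representatives lie in the returned selection
(`le_sum_reps_of_ne`). Hence `l` is bounded by the sum of logarithms of what is returned, in either
case.

The rest verifies programs: `Wp` is a weakest precondition that carries the elapsed time, and the
word-length hypotheses guarantee that no arithmetic wraps around. -/

namespace MatRAM

open Function

/-! ## Program logic -/

section Logic

variable {α : Type u} [LinearOrder α] {w : ℕ} {A : ℕ → ℕ → α}

/-- The command `c`, as a part of the procedure `p`, started at time `t` with registers `R` and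
memory `μ`, stops in a state and at a time that satisfy `Q`. -/
def Wp (w : ℕ) (A : ℕ → ℕ → α) (p c : Cmd) (R μ : ℕ → ℕ) (t : ℕ)
    (Q : (ℕ → ℕ) → (ℕ → ℕ) → ℕ → Prop) : Prop :=
  ∃ τ s, Exec w A p c ⟨R, μ⟩ τ s ∧ Q τ.reg τ.mem (t + s)

/-- The procedure `q`, called with arguments `args` and memory `μ`, returns `v` and the memory `ν`
after `t` steps. -/
def Returns (w : ℕ) (A : ℕ → ℕ → α) (q : Cmd) (args : List ℕ) (μ ν : ℕ → ℕ) (v t : ℕ) : Prop :=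
  ∃ ρ : ℕ → ℕ, Exec w A q q ⟨frame args, μ⟩ ⟨ρ, ν⟩ t ∧ ρ 0 = v

theorem Returns.runs {q : Cmd} {args : List ℕ} {μ ν : ℕ → ℕ} {v t : ℕ}
    (h : Returns w A q args μ ν v t) : Runs w A q args μ ν t :=
  let ⟨ρ, h, _⟩ := h; ⟨ρ, h⟩

theorem Runs.returns {q : Cmd} {args : List ℕ} {μ ν : ℕ → ℕ} {t : ℕ}
    (h : Runs w A q args μ ν t) : ∃ v, Returns w A q args μ ν v t :=
  let ⟨ρ, h⟩ := h; ⟨ρ 0, ρ, h, rfl⟩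

variable {p : Cmd} {R μ : ℕ → ℕ} {t : ℕ} {Q : (ℕ → ℕ) → (ℕ → ℕ) → ℕ → Prop}

theorem exists_returns {q : Cmd} {args : List ℕ} {P : (ℕ → ℕ) → ℕ → ℕ → Prop}
    (h : Wp w A q q (frame args) μ 0 (fun R ν t => P ν (R 0) t)) :
    ∃ ν v t, Returns w A q args μ ν v t ∧ P ν v t := by
  obtain ⟨⟨ρ, ν⟩, s, h, h'⟩ := h
  exact ⟨ν, ρ 0, s, ⟨ρ, h, rfl⟩, by simpa using h'⟩

/-- For recursive procedures: only the command being executed is unfolded to `c`, while the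
enclosing procedure stays folded as `q`. A `call` inside `c` then refers to `q`, and an induction
hypothesis about `q` applies. -/
theorem exists_returns_of_eq {q c : Cmd} (hq : q = c) {args : List ℕ}
    {P : (ℕ → ℕ) → ℕ → ℕ → Prop}
    (h : Wp w A q c (frame args) μ 0 (fun R ν t => P ν (R 0) t)) :
    ∃ ν v t, Returns w A q args μ ν v t ∧ P ν v t := by
  subst hq
  exact exists_returns h

@[simp] theorem wp_skip : Wp w A p .skip R μ t Q ↔ Q R μ (t + 1) := by
  constructor
  · rintro ⟨τ, s, h, h'⟩; cases h; exact h'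
  · exact fun h => ⟨_, _, .skip, h⟩

@[simp] theorem wp_set {r : ℕ} {e : Expr} : Wp w A p (.set r e) R μ t Q ↔
    Q (update R r (e.eval w A ⟨R, μ⟩)) μ (t + (e.cost + 1)) := by
  constructor
  · rintro ⟨τ, s, h, h'⟩; cases h; exact h'
  · exact fun h => ⟨_, _, .set, h⟩

@[simp] theorem wp_store {a e : Expr} : Wp w A p (.store a e) R μ t Q ↔
    Q R (update μ (a.eval w A ⟨R, μ⟩) (e.eval w A ⟨R, μ⟩)) (t + (a.cost + e.cost + 1)) := by
  constructor
  · rintro ⟨τ, s, h, h'⟩; cases h; exact h'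
  · exact fun h => ⟨_, _, .store, h⟩

theorem wp_seq {c d : Cmd} : Wp w A p (.seq c d) R μ t Q ↔
    Wp w A p c R μ t (fun R μ t => Wp w A p d R μ t Q) := by
  constructor
  · rintro ⟨τ, s, h, h'⟩
    cases h with
    | seq h₁ h₂ => exact ⟨_, _, h₁, _, _, h₂, by rwa [add_assoc]⟩
  · rintro ⟨τ, s, h₁, υ, s', h₂, h⟩
    exact ⟨_, _, .seq h₁ h₂, by rwa [← add_assoc]⟩

@[simp] theorem wp_ite {e : Expr} {c d : Cmd} : Wp w A p (.ite e c d) R μ t Q ↔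
    (e.eval w A ⟨R, μ⟩ ≠ 0 → Wp w A p c R μ (t + (e.cost + 1)) Q) ∧
    (e.eval w A ⟨R, μ⟩ = 0 → Wp w A p d R μ (t + (e.cost + 1)) Q) := by
  constructor
  · rintro ⟨τ, s, h, h'⟩
    cases h with
    | ite_true he h => exact ⟨fun _ => ⟨_, _, h, by rwa [add_assoc]⟩, fun h => (he h).elim⟩
    | ite_false he h => exact ⟨fun h => (h he).elim, fun _ => ⟨_, _, h, by rwa [add_assoc]⟩⟩
  · rintro ⟨h₁, h₂⟩
    by_cases he : e.eval w A ⟨R, μ⟩ = 0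
    · obtain ⟨τ, s, h, h'⟩ := h₂ he
      exact ⟨_, _, .ite_false he h, by rwa [← add_assoc]⟩
    · obtain ⟨τ, s, h, h'⟩ := h₁ he
      exact ⟨_, _, .ite_true he h, by rwa [← add_assoc]⟩

@[simp] theorem wp_block_nil : Wp w A p (.block []) R μ t Q ↔ Q R μ (t + 1) := wp_skip

@[simp] theorem wp_block_cons {c : Cmd} {l : List Cmd} : Wp w A p (.block (c :: l)) R μ t Q ↔
    Wp w A p c R μ t (fun R μ t => Wp w A p (.block l) R μ t Q) := wp_seq

/-- The argument values are a separate parameter `vals`, so that specifications stated for plain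
numbers can be supplied once the modular arithmetic has been discharged in `hv`. -/
theorem wp_run {q : Cmd} {args : List Expr} {r : ℕ} (vals : List ℕ)
    (hv : args.map (Expr.eval w A ⟨R, μ⟩) = vals)
    (h : ∃ ν v s, Returns w A q vals μ ν v s ∧
      Q (update R r v) ν (t + ((args.map Expr.cost).sum + 1 + s))) :
    Wp w A p (.run q args r) R μ t Q := by
  obtain ⟨ν, v, s, ⟨ρ, h, rfl⟩, hQ⟩ := h
  subst hv
  exact ⟨_, _, .run h, hQ⟩

theorem wp_call {args : List Expr} {r : ℕ} (vals : List ℕ)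
    (hv : args.map (Expr.eval w A ⟨R, μ⟩) = vals)
    (h : ∃ ν v s, Returns w A p vals μ ν v s ∧
      Q (update R r v) ν (t + ((args.map Expr.cost).sum + 1 + s))) :
    Wp w A p (.call args r) R μ t Q := by
  obtain ⟨ν, v, s, ⟨ρ, h, rfl⟩, hQ⟩ := h
  subst hv
  exact ⟨_, _, .call h, hQ⟩

/-- Total correctness of a while loop by means of a variant `V`. -/
theorem wp_while {e : Expr} {c : Cmd} (I : (ℕ → ℕ) → (ℕ → ℕ) → ℕ → Prop)
    (V : (ℕ → ℕ) → (ℕ → ℕ) → ℕ) (h0 : I R μ t)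
    (hstep : ∀ R μ t, I R μ t → e.eval w A ⟨R, μ⟩ ≠ 0 →
      Wp w A p c R μ (t + (e.cost + 1)) (fun R' μ' t' => I R' μ' t' ∧ V R' μ' < V R μ))
    (hend : ∀ R μ t, I R μ t → e.eval w A ⟨R, μ⟩ = 0 → Q R μ (t + (e.cost + 1))) :
    Wp w A p (.while e c) R μ t Q := by
  induction hn : V R μ using Nat.strong_induction_on generalizing R μ t with
  | _ n ih =>
    by_cases he : e.eval w A ⟨R, μ⟩ = 0
    · exact ⟨_, _, .while_false he, hend _ _ _ h0 he⟩
    · obtain ⟨τ, s, h, hI, hV⟩ := hstep _ _ _ h0 he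
      obtain ⟨υ, s', h', hQ⟩ := ih _ (hn ▸ hV) hI rfl
      refine ⟨_, _, .while_true he h h', ?_⟩
      have : t + (e.cost + 1 + s + s') = t + (e.cost + 1) + s + s' := by omega
      rwa [this]

@[simp] theorem eval_ofNat {σ : State} {c : ℕ} :
    (no_index (@OfNat.ofNat Expr c (instOfNatExpr c))).eval w A σ = (@OfNat.ofNat ℕ c _) % 2 ^ w := rfl

@[simp] theorem eval_reg {r : ℕ} : (Expr.reg r).eval w A ⟨R, μ⟩ = R r := rfl

@[simp] theorem eval_mem {a : Expr} :
    (Expr.mem a).eval w A ⟨R, μ⟩ = μ (a.eval w A ⟨R, μ⟩) := rfl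

@[simp] theorem eval_add {σ : State} {a b : Expr} :
    (a + b).eval w A σ = (a.eval w A σ + b.eval w A σ) % 2 ^ w := rfl

@[simp] theorem eval_sub {σ : State} {a b : Expr} :
    (a - b).eval w A σ = a.eval w A σ - b.eval w A σ := rfl

@[simp] theorem eval_mul {σ : State} {a b : Expr} :
    (a * b).eval w A σ = (a.eval w A σ * b.eval w A σ) % 2 ^ w := rfl

@[simp] theorem eval_div {σ : State} {a b : Expr} :
    (a / b).eval w A σ = a.eval w A σ / b.eval w A σ := rfl

@[simp] theorem eval_min {σ : State} {a b : Expr} :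
    (a.min b).eval w A σ = min (a.eval w A σ) (b.eval w A σ) := by
  change a.eval w A σ - (a.eval w A σ - b.eval w A σ) = _
  omega

@[simp] theorem eval_lt {σ : State} {a b : Expr} :
    (Expr.lt a b).eval w A σ = if a.eval w A σ < b.eval w A σ then 1 else 0 := rfl

@[simp] theorem eval_less {σ : State} {i j i' j' : Expr} : (Expr.less i j i' j').eval w A σ =
    if A (i.eval w A σ) (j.eval w A σ) < A (i'.eval w A σ) (j'.eval w A σ) then 1 else 0 := rfl

@[simp] theorem cost_ofNat {c : ℕ} : (no_index (@OfNat.ofNat Expr c (instOfNatExpr c))).cost = 1 := rfl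
@[simp] theorem cost_reg {r : ℕ} : (Expr.reg r).cost = 1 := rfl
@[simp] theorem cost_mem {a : Expr} : (Expr.mem a).cost = a.cost + 1 := rfl
@[simp] theorem cost_add {a b : Expr} : (a + b).cost = a.cost + b.cost + 1 := rfl
@[simp] theorem cost_sub {a b : Expr} : (a - b).cost = a.cost + b.cost + 1 := rfl
@[simp] theorem cost_mul {a b : Expr} : (a * b).cost = a.cost + b.cost + 1 := rfl
@[simp] theorem cost_div {a b : Expr} : (a / b).cost = a.cost + b.cost + 1 := rfl
@[simp] theorem cost_min {a b : Expr} : (a.min b).cost = a.cost + (a.cost + b.cost + 1) + 1 := rfl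
@[simp] theorem cost_lt {a b : Expr} : (Expr.lt a b).cost = a.cost + b.cost + 1 := rfl
@[simp] theorem cost_less {i j i' j' : Expr} : (Expr.less i j i' j').cost =
    i.cost + j.cost + i'.cost + j'.cost + 1 := rfl

/-- A for loop with invariant `I`. -/
theorem wp_for {i : ℕ} {e : Expr} {c : Cmd} (N : ℕ)
    (I : ℕ → (ℕ → ℕ) → (ℕ → ℕ) → ℕ → Prop) (hN : N < 2 ^ w) (hw : 1 < 2 ^ w)
    (h0 : I 0 (update R i 0) μ (t + 2))
    (hI : ∀ x R μ t, x ≤ N → I x R μ t → R i = x ∧ e.eval w A ⟨R, μ⟩ = N)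
    (hstep : ∀ x R μ t, x < N → I x R μ t →
      Wp w A p c R μ t (fun R' μ' t' => R' i = x ∧
        I (x + 1) (update R' i (x + 1)) μ' (t' + (e.cost + 8))))
    (hend : ∀ R μ t, I N R μ t → Q R μ (t + (e.cost + 4))) :
    Wp w A p (.for i e c) R μ t Q := by
  simp only [Cmd.for, wp_block_cons, wp_block_nil, wp_set, eval_ofNat, cost_ofNat, Nat.zero_mod]
  refine wp_while (fun R μ t => ∃ x ≤ N, I x R μ t) (fun R _ => N - R i)
    ⟨0, Nat.zero_le _, h0⟩ ?_ ?_
  · rintro R μ t ⟨x, hx, h⟩ he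
    obtain ⟨h₁, h₂⟩ := hI x R μ t hx h
    simp only [eval_lt, eval_reg, h₁, h₂] at he
    have hx' : x < N := by by_contra h; simp [h] at he
    simp only [wp_block_cons, wp_block_nil, wp_set, cost_lt, cost_reg, cost_add, cost_ofNat]
    obtain ⟨τ, s, hc, hr, hI'⟩ := hstep x R μ t hx' h
    refine ⟨τ, s, hc, ⟨x + 1, hx', ?_⟩, ?_⟩
    · have : t + (1 + e.cost + 1 + 1) + s + (1 + 1 + 1 + 1) + 1 = t + s + (e.cost + 8) := by omega
      rw [this, eval_add, eval_reg, hr, eval_ofNat, Nat.mod_eq_of_lt hw, Nat.mod_eq_of_lt (by omega)]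
      exact hI'
    · simp only [update_self, eval_add, eval_reg, eval_ofNat, hr, Nat.mod_eq_of_lt hw, h₁]
      rw [Nat.mod_eq_of_lt (by omega)]; omega
  · rintro R μ t ⟨x, hx, h⟩ he
    obtain ⟨h₁, h₂⟩ := hI x R μ t hx h
    simp only [eval_lt, eval_reg, h₁, h₂] at he
    have hx' : x = N := by by_contra h; simp [lt_of_le_of_ne hx h] at he
    subst hx'
    have := hend _ _ _ h
    simp only [cost_lt, cost_reg]
    have e' : t + (1 + e.cost + 1 + 1) + 1 = t + (e.cost + 4) := by omega
    rwa [e']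

end Logic

end MatRAM

namespace MatRAM

open Function

/-! ## Ranks in lists -/

section Rank

variable {Y : Type*} [LinearOrder Y]

/-- The number of members of `l` with smaller key than `v`. -/
def rank (κ : ℕ → Y) (l : List ℕ) (v : ℕ) : ℕ := l.countP (fun x => κ x < κ v)

theorem rank_eq_card {κ : ℕ → Y} {l : List ℕ} (hl : l.Nodup) (v : ℕ) :
    rank κ l v = (l.toFinset.filter (fun x => κ x < κ v)).card := by
  rw [rank, List.countP_eq_length_filter, ← List.toFinset_card_of_nodup (hl.filter _)]
  congr 1
  ext x; simp

theorem rank_lt_length {κ : ℕ → Y} {l : List ℕ} {v : ℕ} (hv : v ∈ l) : rank κ l v < l.length := by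
  rw [rank]
  refine lt_of_le_of_ne List.countP_le_length fun h => ?_
  have := List.countP_eq_length.1 h v hv
  simp at this

theorem rank_lt_rank {κ : ℕ → Y} {l : List ℕ} {u v : ℕ} (hu : u ∈ l) (hl : l.Nodup)
    (h : κ u < κ v) : rank κ l u < rank κ l v := by
  rw [rank_eq_card hl, rank_eq_card hl]
  refine Finset.card_lt_card (Finset.ssubset_iff_of_subset ?_ |>.2 ⟨u, ?_, ?_⟩)
  · intro x; simp only [Finset.mem_filter]; exact fun hx => ⟨hx.1, hx.2.trans h⟩
  · simp [hu, h]
  · simp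

/-- Pigeonhole: with injective keys the rank is an injective map from the members of the list to the
numbers below its length, hence onto. -/
theorem exists_rank_eq {κ : ℕ → Y} (hκ : Injective κ) {l : List ℕ} (hl : l.Nodup) {K : ℕ}
    (hK : K < l.length) : ∃ v ∈ l, rank κ l v = K := by
  have himg : (l.toFinset.image (rank κ l)) = Finset.range l.length := by
    refine Finset.eq_of_subset_of_card_le ?_ ?_
    · intro x hx
      obtain ⟨v, hv, rfl⟩ := Finset.mem_image.1 hx
      exact Finset.mem_range.2 (rank_lt_length (List.mem_toFinset.1 hv))
    · rw [Finset.card_image_of_injOn, List.toFinset_card_of_nodup hl, Finset.card_range]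
      intro u hu v hv h
      by_contra hne
      simp only [List.coe_toFinset, Set.mem_ofPred_eq] at hu hv
      rcases lt_or_gt_of_ne (hκ.ne hne) with h' | h'
      · exact (rank_lt_rank hu hl h').ne h
      · exact (rank_lt_rank hv hl h').ne' h
  have : K ∈ l.toFinset.image (rank κ l) := by rw [himg]; simpa using hK
  simpa using this

end Rank

/-! ## Selection from a list in linear time -/

section Select

variable {α : Type u} [LinearOrder α] {w : ℕ} {A : ℕ → ℕ → α}

/-- The items of a list are given by a table in the memory from address `T` on: row and column of
item `x` are in the cells `T + 2 * x` and `T + 2 * x + 1`. -/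
def item (A : ℕ → ℕ → α) (μ : ℕ → ℕ) (T x : ℕ) : α := A (μ (T + 2 * x)) (μ (T + 2 * x + 1))

/-- The key of an item: ties are broken by the number of the item. -/
def key (A : ℕ → ℕ → α) (μ : ℕ → ℕ) (T x : ℕ) : α ×ₗ ℕ := toLex (item A μ T x, x)

theorem key_injective (μ : ℕ → ℕ) (T : ℕ) : Injective (key A μ T) := by
  intro x y h
  exact (Prod.ext_iff.1 (toLex_inj.1 h)).2

theorem key_congr {μ ν : ℕ → ℕ} {T x : ℕ} (h : ∀ a ≤ T + 2 * x + 1, ν a = μ a) :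
    key A ν T x = key A μ T x := by
  rw [key, key, item, item, h _ (by omega), h _ (by omega)]

theorem rank_congr {Y : Type*} [LinearOrder Y] {κ κ' : ℕ → Y} {l : List ℕ} {v : ℕ}
    (h : ∀ x ∈ l, κ' x = κ x) (hv : κ' v = κ v) : rank κ' l v = rank κ l v := by
  rw [rank, rank]
  refine List.countP_congr fun x hx => ?_
  rw [h x hx, hv]

/-- Compare the keys of two items. -/
def cmp (T x y : Expr) : Expr :=
  .lt x y * (1 - .less (.mem (T + 2 * y)) (.mem (T + 2 * y + 1))
      (.mem (T + 2 * x)) (.mem (T + 2 * x + 1))) +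
    (1 - .lt x y) * .less (.mem (T + 2 * x)) (.mem (T + 2 * x + 1))
      (.mem (T + 2 * y)) (.mem (T + 2 * y + 1))

/-- Only strict comparison of items is available. For `x < y` the lexicographic test amounts to
"item `y` is not smaller than item `x`", otherwise to "item `x` is smaller than item `y`"; products
with 0-1 values choose between the two. -/
theorem eval_cmp {R μ : ℕ → ℕ} {T x y : Expr} {T' x' y' : ℕ} (hT : T.eval w A ⟨R, μ⟩ = T')
    (hx : x.eval w A ⟨R, μ⟩ = x') (hy : y.eval w A ⟨R, μ⟩ = y')
    (hx' : T' + 2 * x' + 2 < 2 ^ w) (hy' : T' + 2 * y' + 2 < 2 ^ w) :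
    (cmp T x y).eval w A ⟨R, μ⟩ = if key A μ T' x' < key A μ T' y' then 1 else 0 := by
  have h1 : 1 % 2 ^ w = 1 := Nat.mod_eq_of_lt (by omega)
  have h2 : 2 % 2 ^ w = 2 := Nat.mod_eq_of_lt (by omega)
  simp only [cmp, eval_add, eval_mul, eval_lt, eval_sub, eval_ofNat, eval_less, eval_mem, hT, hx, hy,
    h1, h2, key, Prod.Lex.toLex_lt_toLex, item]
  have e1 : 2 * x' % 2 ^ w = 2 * x' := Nat.mod_eq_of_lt (by omega)
  have e2 : 2 * y' % 2 ^ w = 2 * y' := Nat.mod_eq_of_lt (by omega)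
  have e3 : (T' + 2 * x') % 2 ^ w = T' + 2 * x' := Nat.mod_eq_of_lt (by omega)
  have e4 : (T' + 2 * y') % 2 ^ w = T' + 2 * y' := Nat.mod_eq_of_lt (by omega)
  have e5 : (T' + 2 * x' + 1) % 2 ^ w = T' + 2 * x' + 1 := Nat.mod_eq_of_lt (by omega)
  have e6 : (T' + 2 * y' + 1) % 2 ^ w = T' + 2 * y' + 1 := Nat.mod_eq_of_lt (by omega)
  simp only [e1, e2, e3, e4, e5, e6]
  generalize A (μ (T' + 2 * x')) (μ (T' + 2 * x' + 1)) = a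
  generalize A (μ (T' + 2 * y')) (μ (T' + 2 * y' + 1)) = b
  by_cases h : x' < y' <;> rcases lt_trichotomy a b with h' | rfl | h'
  all_goals first
    | simp [h, h1]; done
    | simp [h, h', h1, h'.not_gt, h'.ne, h'.ne']

theorem cost_cmp {T x y : Expr} : (cmp T x y).cost =
    8 * T.cost + 6 * x.cost + 6 * y.cost + 51 := by
  simp only [cmp, cost_add, cost_mul, cost_sub, cost_lt, cost_less, cost_mem, cost_ofNat]
  omega

/-- The cells from `p` on contain the members of the list `l`. -/
def Seg (μ : ℕ → ℕ) (p : ℕ) (l : List ℕ) : Prop := ∀ i (h : i < l.length), μ (p + i) = l[i]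

/-- Find the member of rank `K` of the list of `n` items in the cells from `p` on. The arguments are
`p`, `n`, `K` and the address of the table of items. -/
def brute : Cmd :=
  .block [
    .for 4 (.reg 1) (.block [
      .set 6 0,
      .for 5 (.reg 1) (.set 6 (.reg 6 +
        cmp (.reg 3) (.mem (.reg 0 + .reg 5)) (.mem (.reg 0 + .reg 4)))),
      .ite (.lt (.reg 6) (.reg 2)) .skip (.ite (.lt (.reg 2) (.reg 6)) .skip
        (.set 7 (.mem (.reg 0 + .reg 4))))]),
    .set 0 (.reg 7)]

theorem brute_spec {μ : ℕ → ℕ} {p K T : ℕ} {l : List ℕ} (hl : l.Nodup) (hK : K < l.length)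
    (hp : Seg μ p l) (hpw : p + l.length < 2 ^ w) (hT : ∀ x ∈ l, T + 2 * x + 2 < 2 ^ w) :
    ∃ v t, Returns w A brute [p, l.length, K, T] μ μ v t ∧ v ∈ l ∧
      rank (key A μ T) l v = K ∧ t ≤ 200 * l.length * (l.length + 1) + 20 := by
  have hw : 1 < 2 ^ w := by omega
  suffices h : ∃ ν v t, Returns w A brute [p, l.length, K, T] μ ν v t ∧ ν = μ ∧ v ∈ l ∧
      rank (key A μ T) l v = K ∧ t ≤ 200 * l.length * (l.length + 1) + 20 by
    obtain ⟨ν, v, t, h, rfl, h'⟩ := h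
    exact ⟨v, t, h, h'⟩
  apply exists_returns
  simp only [brute, wp_block_cons, wp_block_nil, wp_set]
  set D := 200 * (l.length + 1) with hD
  refine wp_for l.length (fun x R ν t => R 0 = p ∧ R 1 = l.length ∧ R 2 = K ∧ R 3 = T ∧ R 4 = x ∧
    ν = μ ∧ t ≤ 2 + x * D ∧ ∀ y (hy : y < l.length), y < x → rank (key A μ T) l l[y] = K →
      R 7 = l[y])
    (by omega) hw ?_ ?_ ?_ ?_
  · simp [frame]
  · rintro x R ν t - ⟨h0, h1, h2, h3, h4, -⟩
    exact ⟨h4, h1⟩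
  · rintro x R ν t hx ⟨h0, h1, h2, h3, h4, rfl, ht, h7⟩
    simp only [wp_block_cons, wp_set]
    refine wp_for l.length (fun y R' ν' t' => R' 0 = p ∧ R' 1 = l.length ∧ R' 2 = K ∧ R' 3 = T ∧
      R' 4 = x ∧ R' 5 = y ∧ ν' = ν ∧ R' 6 = rank (key A ν T) (l.take y) l[x] ∧ R' 7 = R 7 ∧
      t' ≤ 4 + t + y * 140)
      (by omega) hw ?_ ?_ ?_ ?_
    · simp [h0, h1, h2, h3, h4, rank]; omega
    · rintro y R ν t - ⟨h0, h1, h2, h3, h4, h5, -⟩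
      exact ⟨h5, h1⟩
    · rintro y R' ν' t' hy ⟨h0', h1', h2', h3', h4', h5', rfl, h6', h7', ht'⟩
      have ea : ((Expr.mem (.reg 0 + .reg 4)).eval w A ⟨R', ν'⟩) = l[x] := by
        simp only [eval_mem, eval_add, eval_reg, h0', h4']
        rw [Nat.mod_eq_of_lt (by omega), hp x hx]
      have eb : ((Expr.mem (.reg 0 + .reg 5)).eval w A ⟨R', ν'⟩) = l[y] := by
        simp only [eval_mem, eval_add, eval_reg, h0', h5']
        rw [Nat.mod_eq_of_lt (by omega), hp y hy]
      have hr : rank (key A ν' T) (l.take (y + 1)) l[x] = rank (key A ν' T) (l.take y) l[x] +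
          if key A ν' T l[y] < key A ν' T l[x] then 1 else 0 := by
        rw [rank, List.take_add_one, List.countP_append, List.getElem?_eq_getElem hy]
        simp [rank, List.countP_cons]
      have hle : rank (key A ν' T) (l.take (y + 1)) l[x] ≤ l.length :=
        List.countP_le_length.trans (by simp)
      rw [wp_set, eval_add, eval_reg, eval_cmp (eval_reg.trans h3') eb ea (hT _ (by simp))
        (hT _ (by simp)), h6', ← hr, Nat.mod_eq_of_lt (by omega)]
      simp [h0', h1', h2', h3', h4', h5', h7', cost_cmp]
      omega
    · rintro R' ν' t' ⟨h0', h1', h2', h3', h4', h5', rfl, h6', h7', ht'⟩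
      rw [List.take_length] at h6'
      have hDx : (x + 1) * D = x * D + D := by ring
      simp only [wp_ite, eval_lt, eval_reg, wp_block_nil, wp_skip, wp_set, eval_mem, eval_add, h0',
        h4', h2', h6', cost_lt, cost_reg, cost_add, cost_mem, update_self, ne_eq,
        Nat.mod_eq_of_lt (show p + x < 2 ^ w by omega), hp x hx]
      -- Different members have different ranks, so once register 7 holds the member of rank `K` no
      -- later iteration overwrites it.
      have key7 : ∀ y (hy : y < l.length), y < x + 1 → rank (key A ν' T) l l[y] = K →
          (if rank (key A ν' T) l l[x] = K then l[x] else R 7) = l[y] := by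
        intro y hy hyx hr
        rcases Nat.lt_succ_iff_lt_or_eq.1 hyx with h | rfl
        · rw [if_neg, h7 y hy h hr]
          intro hr'
          have hne : l[y] ≠ l[x] := fun h' => h.ne ((hl.getElem_inj_iff).1 h')
          rcases lt_or_gt_of_ne ((key_injective (A := A) ν' T).ne hne) with h'' | h''
          · have := rank_lt_rank (by simp) hl h''; omega
          · have := rank_lt_rank (by simp) hl h''; omega
        · rw [if_pos hr]
      by_cases c1 : rank (key A ν' T) l l[x] < K
      · rw [if_neg c1.ne] at key7
        simp [c1, h0', h1', h2', h3', h4', h7']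
        exact ⟨by omega, fun y hy hyx => key7 y hy (by omega)⟩
      · by_cases c2 : K < rank (key A ν' T) l l[x]
        · rw [if_neg c2.ne'] at key7
          simp [c1, c2, h0', h1', h2', h3', h4', h7']
          exact ⟨by omega, fun y hy hyx => key7 y hy (by omega)⟩
        · rw [if_pos (by omega)] at key7
          simp [c1, c2, h0', h1', h2', h3', h4', h7']
          exact ⟨by omega, fun y hy hyx => key7 y hy (by omega)⟩
  · rintro R ν t ⟨h0, h1, h2, h3, h4, rfl, ht, h7⟩
    obtain ⟨v, hv, hr⟩ := exists_rank_eq (key_injective (A := A) ν T) hl hK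
    obtain ⟨y, hy, rfl⟩ := List.getElem_of_mem hv
    have hDx : 200 * l.length * (l.length + 1) = l.length * D := by rw [hD]; ring
    simp [h7 y hy hy hr, hr]
    rw [hDx]; omega

end Select

end MatRAM

/-! ### Filtering a list, and medians of groups of five -/

namespace MatRAM

open Function

section Select

variable {α : Type u} [LinearOrder α] {w : ℕ} {A : ℕ → ℕ → α}

theorem Seg.congr {μ ν : ℕ → ℕ} {p : ℕ} {l : List ℕ} (h : Seg μ p l)
    (hν : ∀ i < l.length, ν (p + i) = μ (p + i)) : Seg ν p l :=
  fun i hi => (hν i hi).trans (h i hi)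

theorem filter_take_succ (P : ℕ → Bool) {l : List ℕ} {i : ℕ} (hi : i < l.length) :
    (l.take (i + 1)).filter P = (l.take i).filter P ++ if P l[i] then [l[i]] else [] := by
  rw [List.take_add_one, List.getElem?_eq_getElem hi, List.filter_append]
  by_cases h : P l[i] <;> simp [h]

/-- Extract the members of a list that are smaller (or larger, if `lo` is false) than a given item.
The arguments are the address and the length of the list, the item, the table, and the address of
the result. -/
def filter (lo : Bool) : Cmd :=
  .block [
    .for 5 (.reg 1) (.ite (if lo then cmp (.reg 3) (.mem (.reg 0 + .reg 5)) (.reg 2)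
        else cmp (.reg 3) (.reg 2) (.mem (.reg 0 + .reg 5)))
      (.block [.store (.reg 4 + .reg 6) (.mem (.reg 0 + .reg 5)), .set 6 (.reg 6 + 1)]) .skip),
    .set 0 (.reg 6)]

/-- The predicate decided by the procedure `filter`. -/
def filterPred {Y : Type*} [LinearOrder Y] (κ : ℕ → Y) (lo : Bool) (x y : ℕ) : Bool :=
  if lo then κ y < κ x else κ x < κ y

theorem filter_spec (lo : Bool) {μ : ℕ → ℕ} {p x T f : ℕ} {l : List ℕ}
    (hp : Seg μ p l) (hpf : p + l.length ≤ f) (hfw : f + l.length + 2 < 2 ^ w)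
    (hT : ∀ y ∈ l, T + 2 * y + 2 ≤ f) (hx : T + 2 * x + 2 ≤ f) :
    ∃ ν v t, Returns w A (filter lo) [p, l.length, x, T, f] μ ν v t ∧
      v = (l.filter (filterPred (key A μ T) lo x)).length ∧
      Seg ν f (l.filter (filterPred (key A μ T) lo x)) ∧
      (∀ a < f, ν a = μ a) ∧ t ≤ 200 * l.length + 20 := by
  have hw : 1 < 2 ^ w := by omega
  apply exists_returns
  simp only [filter, wp_block_cons, wp_block_nil, wp_set]
  set P := filterPred (key A μ T) lo x with hP
  refine wp_for l.length (fun i R ν t => R 0 = p ∧ R 1 = l.length ∧ R 2 = x ∧ R 3 = T ∧ R 4 = f ∧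
    R 5 = i ∧ R 6 = ((l.take i).filter P).length ∧ Seg ν f ((l.take i).filter P) ∧
    (∀ a < f, ν a = μ a) ∧ t ≤ 2 + i * 150) (by omega) hw ?_ ?_ ?_ ?_
  · simp [frame, Seg]
  · rintro i R ν t - ⟨h0, h1, h2, h3, h4, h5, -⟩
    exact ⟨h5, h1⟩
  · rintro i R ν t hi ⟨h0, h1, h2, h3, h4, h5, h6, hs, hν, ht⟩
    have ey : ((Expr.mem (.reg 0 + .reg 5)).eval w A ⟨R, ν⟩) = l[i] := by
      simp only [eval_mem, eval_add, eval_reg, h0, h5]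
      rw [Nat.mod_eq_of_lt (by omega), hν _ (by omega), hp i hi]
    have hk1 : key A ν T l[i] = key A μ T l[i] :=
      key_congr fun a ha => hν a (by have := hT l[i] (by simp); omega)
    have hk2 : key A ν T x = key A μ T x := key_congr fun a ha => hν a (by omega)
    have hTi := hT l[i] (by simp)
    have ec : (if lo = true then cmp (.reg 3) (.mem (.reg 0 + .reg 5)) (.reg 2)
        else cmp (.reg 3) (.reg 2) (.mem (.reg 0 + .reg 5))).eval w A ⟨R, ν⟩ =
        if P l[i] then 1 else 0 := by
      cases lo
      · simp only [Bool.false_eq_true, if_false]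
        rw [eval_cmp (eval_reg.trans h3) (eval_reg.trans h2) ey (by omega) (by omega), hk1, hk2]
        simp [hP, filterPred]
      · simp only [if_true]
        rw [eval_cmp (eval_reg.trans h3) ey (eval_reg.trans h2) (by omega) (by omega), hk1, hk2]
        simp [hP, filterPred]
    have ecost : (if lo = true then cmp (.reg 3) (.mem (.reg 0 + .reg 5)) (.reg 2)
        else cmp (.reg 3) (.reg 2) (.mem (.reg 0 + .reg 5))).cost = 89 := by
      cases lo <;> simp [cost_cmp]
    have htake := filter_take_succ P hi
    have hlen : ((l.take i).filter P).length ≤ i :=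
      (List.length_filter_le _ _).trans (by simp)
    rw [wp_ite, ec, ecost]
    simp only [htake]
    by_cases hPi : P l[i]
    · simp only [hPi, if_true]
      refine ⟨fun _ => ?_, fun h => absurd h one_ne_zero⟩
      simp only [wp_block_cons, wp_block_nil, wp_set, wp_store, ey, eval_add, eval_reg, h4, h6,
        Nat.mod_eq_of_lt (show f + ((l.take i).filter P).length < 2 ^ w by omega), eval_ofNat,
        Nat.mod_eq_of_lt hw,
        Nat.mod_eq_of_lt (show ((l.take i).filter P).length + 1 < 2 ^ w by omega)]
      simp [h0, h1, h2, h3, h4, h5]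
      refine ⟨?_, fun a ha => ?_, by omega⟩
      · intro j hj
        rw [List.length_append, List.length_singleton] at hj
        by_cases hj' : j < ((l.take i).filter P).length
        · rw [update_of_ne (by omega), hs j hj', List.getElem_append_left hj']
        · have : j = ((l.take i).filter P).length := by omega
          subst this
          simp
      · rw [update_of_ne (by omega), hν a ha]
    · simp only [hPi]
      simp [h0, h1, h2, h3, h4, h5, h6]
      exact ⟨hs, hν, by omega⟩
  · rintro R ν t ⟨h0, h1, h2, h3, h4, h5, h6, hs, hν, ht⟩
    rw [List.take_length] at h6 hs
    simp [h6]
    exact ⟨hs, hν, by omega⟩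

/-- Write the medians of the groups of five consecutive members of a list. The arguments are the
address of the list, the number of groups, the table, and the address of the result. -/
def groups : Cmd :=
  .for 4 (.reg 1) (.block [
    .run brute [.reg 0 + 5 * .reg 4, 5, 2, .reg 2] 5,
    .store (.reg 3 + .reg 4) (.reg 5)])

/-- The quadratic `brute` is applied to groups of constant size, so the total time is linear. Rank 2
is the median of five; up to four trailing members of the list may belong to no group. -/
theorem groups_spec {μ : ℕ → ℕ} {p g T f : ℕ} {l : List ℕ} (hl : l.Nodup)
    (hp : Seg μ p l) (hg : 5 * g ≤ l.length) (hpf : p + l.length ≤ f)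
    (hfw : f + l.length + 6 < 2 ^ w) (hT : ∀ y ∈ l, T + 2 * y + 2 ≤ f) :
    ∃ ν v t, Returns w A groups [p, g, T, f] μ ν v t ∧
      (∃ ms : List ℕ, ms.length = g ∧ Seg ν f ms ∧ ∀ q (hq : q < ms.length),
        ms[q] ∈ (l.drop (5 * q)).take 5 ∧
        rank (key A μ T) ((l.drop (5 * q)).take 5) ms[q] = 2) ∧
      (∀ a < f, ν a = μ a) ∧ t ≤ 6200 * g + 20 := by
  have hw : 5 < 2 ^ w := by omega
  apply exists_returns (P := fun ν v t => (∃ ms : List ℕ, ms.length = g ∧ Seg ν f ms ∧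
    ∀ q (hq : q < ms.length), ms[q] ∈ (l.drop (5 * q)).take 5 ∧
        rank (key A μ T) ((l.drop (5 * q)).take 5) ms[q] = 2) ∧
      (∀ a < f, ν a = μ a) ∧ t ≤ 6200 * g + 20)
  refine wp_for g (fun i R ν t => R 0 = p ∧ R 1 = g ∧ R 2 = T ∧ R 3 = f ∧ R 4 = i ∧
    (∃ ms : List ℕ, ms.length = i ∧ Seg ν f ms ∧
    ∀ q (hq : q < ms.length), ms[q] ∈ (l.drop (5 * q)).take 5 ∧
        rank (key A μ T) ((l.drop (5 * q)).take 5) ms[q] = 2) ∧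
      (∀ a < f, ν a = μ a) ∧ t ≤ 2 + i * 6200) (by omega) (by omega) ?_ ?_ ?_ ?_
  · simp [frame, Seg]
  · rintro i R ν t - ⟨h0, h1, h2, h3, h4, -⟩
    exact ⟨h4, h1⟩
  · rintro i R ν t hi ⟨h0, h1, h2, h3, h4, ⟨ms, hms, hs, hr⟩, hν, ht⟩
    rw [wp_block_cons]
    have hlen : ((l.drop (5 * i)).take 5).length = 5 := by simp; omega
    have hmem : ∀ x ∈ (l.drop (5 * i)).take 5, x ∈ l := fun x hx =>
      List.mem_of_mem_drop (List.mem_of_mem_take hx)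
    have hseg : Seg ν (p + 5 * i) ((l.drop (5 * i)).take 5) := by
      intro j hj
      rw [hlen] at hj
      rw [add_assoc, hν _ (by omega), hp _ (by omega)]
      simp
    obtain ⟨v, s, hret, hv, hrk, hs'⟩ := brute_spec (w := w) (A := A) (T := T) (K := 2)
      ((hl.sublist (List.drop_sublist _ _)).sublist (List.take_sublist _ _))
      (by rw [hlen]; omega) hseg
      (by rw [hlen]; omega) (fun x hx => by have := hT x (hmem x hx); omega)
    rw [hlen] at hret hs'
    refine wp_run _ ?_ ⟨ν, v, s, hret, ?_⟩
    · simp only [List.map_cons, List.map_nil, eval_add, eval_reg, eval_mul, eval_ofNat, h0, h4, h2,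
        Nat.mod_eq_of_lt hw, Nat.mod_eq_of_lt (show 2 < 2 ^ w by omega),
        Nat.mod_eq_of_lt (show 5 * i < 2 ^ w by omega),
        Nat.mod_eq_of_lt (show p + 5 * i < 2 ^ w by omega)]
    · simp [h0, h1, h2, h3, h4, Nat.mod_eq_of_lt (show f + i < 2 ^ w by omega)]
      refine ⟨⟨ms ++ [v], by simp [hms], ?_, ?_⟩, fun a ha => ?_, by omega⟩
      · intro j hj
        rw [List.length_append, List.length_singleton] at hj
        by_cases hj' : j < ms.length
        · rw [update_of_ne (by omega), hs j hj', List.getElem_append_left hj']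
        · have : j = ms.length := by omega
          subst this
          simp [hms]
      · intro q hq
        rw [List.length_append, List.length_singleton] at hq
        by_cases hq' : q < ms.length
        · rw [List.getElem_append_left hq']
          exact hr q hq'
        · have : q = i := by omega
          subst this
          subst hms
          have hkk : ∀ x ∈ (l.drop (5 * ms.length)).take 5, key A μ T x = key A ν T x := by
            intro x hx
            refine key_congr fun a ha => (hν a ?_).symm
            have := hT x (hmem x hx); omega
          simpa using ⟨hv, (rank_congr hkk (hkk v hv)).trans hrk⟩
      · rw [update_of_ne (by omega), hν a ha]
  · rintro R ν t ⟨h0, h1, h2, h3, h4, h5, hν, ht⟩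
    refine ⟨h5, hν, ?_⟩
    simp
    omega

/-- The groups are disjoint segments, so a median with property `P` whose group has three such
members can be charged to those three. -/
theorem three_mul_countP_le {P : ℕ → Bool} : ∀ (ms l : List ℕ),
    (∀ q (hq : q < ms.length), P ms[q] → 3 ≤ ((l.drop (5 * q)).take 5).countP P) →
    3 * ms.countP P ≤ l.countP P
  | [], l, _ => by simp
  | a :: ms, l, h => by
    have ih := three_mul_countP_le ms (l.drop 5) fun q hq hP => by
      have := h (q + 1) (by simpa using hq) (by simpa using hP)
      rwa [List.drop_drop, add_comm, ← Nat.mul_succ]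
    have h0 := h 0 (by simp)
    simp only [mul_zero, List.drop_zero, List.getElem_cons_zero] at h0
    conv_rhs => rw [← List.take_append_drop 5 l, List.countP_append]
    rw [List.countP_cons]
    split_ifs with hP
    · have := h0 hP; omega
    · omega

variable {Y : Type*} [LinearOrder Y]

/-- The members below `v` and `v` itself all have keys at most that of `x`. -/
theorem rank_lt_countP_le (κ : ℕ → Y) {l : List ℕ} {v x : ℕ} (hv : v ∈ l) (h : κ v ≤ κ x) :
    rank κ l v + 1 ≤ l.countP (fun y => κ y ≤ κ x) := by
  induction l with
  | nil => simp at hv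
  | cons a l ih =>
    rw [rank, List.countP_cons, List.countP_cons]
    rcases List.mem_cons.1 hv with rfl | hv
    · have : l.countP (fun y => κ y < κ v) ≤ l.countP (fun y => κ y ≤ κ x) :=
        List.countP_mono_left fun y _ hy => by
          simp only [decide_eq_true_eq] at hy ⊢; exact hy.le.trans h
      simp [h, this]
    · have := ih hv
      rw [rank] at this
      have h2 : (if decide (κ a < κ v) = true then 1 else 0) ≤
          (if decide (κ a ≤ κ x) = true then 1 else 0) := by
        split_ifs with h1 h2 <;> simp_all
        exact absurd ((h1.le).trans h) h2.not_ge
      omega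

theorem countP_ge_eq (κ : ℕ → Y) (l : List ℕ) (v : ℕ) :
    l.countP (fun y => κ v ≤ κ y) + rank κ l v = l.length := by
  rw [rank, List.length_eq_countP_add_countP (fun y => κ v ≤ κ y)]
  congr 2
  ext; simp

/-- The medians come from disjoint index ranges of a list without repetitions. Distinctness is
needed for the recursive selection among them. -/
theorem nodup_of_mem_groups {l ms : List ℕ} (hl : l.Nodup)
    (h : ∀ q (hq : q < ms.length), ms[q] ∈ (l.drop (5 * q)).take 5) : ms.Nodup := by
  rw [List.nodup_iff_injective_getElem]
  rintro ⟨q, hq⟩ ⟨q', hq'⟩ he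
  simp only at he
  obtain ⟨i, hi, hi'⟩ := List.getElem_of_mem (h q hq)
  obtain ⟨j, hj, hj'⟩ := List.getElem_of_mem (h q' hq')
  simp only [List.getElem_take, List.getElem_drop] at hi' hj'
  rw [← hi', ← hj', hl.getElem_inj_iff] at he
  simp at hi hj
  ext
  simp only
  omega

end Select

end MatRAM

/-! ### The pivot rank and linear-time selection -/

namespace MatRAM

open Function

section Select

variable {α : Type u} [LinearOrder α] {w : ℕ} {A : ℕ → ℕ → α}

section Rank

variable {Y : Type*} [LinearOrder Y]

theorem rank_filter_lt (κ : ℕ → Y) {l : List ℕ} {v x : ℕ} (h : κ v < κ x) :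
    rank κ (l.filter (filterPred κ true x)) v = rank κ l v := by
  rw [rank, rank, List.countP_filter]
  refine List.countP_congr fun y _ => ?_
  simp only [filterPred, if_true, Bool.and_eq_true, decide_eq_true_eq, and_iff_left_iff_imp]
  exact fun h' => h'.trans h

/-- Every member not above `x` lies below `v`, so discarding these members shifts the rank of `v` by
exactly their number. -/
theorem rank_filter_gt (κ : ℕ → Y) {l : List ℕ} {v x : ℕ} (h : κ x < κ v) :
    rank κ l v = rank κ (l.filter (filterPred κ false x)) v +
      l.countP (fun y => κ y ≤ κ x) := by
  induction l with
  | nil => simp [rank]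
  | cons a l ih =>
    simp only [rank, filterPred, List.countP_cons, List.countP_filter] at ih ⊢
    rw [ih]
    rcases le_or_gt (κ a) (κ x) with h' | h'
    · simp [h', h'.trans_lt h, h'.not_gt]; omega
    · by_cases h'' : κ a < κ v <;> simp [h', h'.not_ge, h'']; omega

theorem countP_le_eq (κ : ℕ → Y) (hκ : Injective κ) {l : List ℕ} (hl : l.Nodup) {x : ℕ}
    (hx : x ∈ l) : l.countP (fun y => κ y ≤ κ x) = rank κ l x + 1 := by
  induction l with
  | nil => simp at hx
  | cons a l ih =>
    rw [rank, List.countP_cons, List.countP_cons]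
    obtain ⟨ha, hl⟩ := List.nodup_cons.1 hl
    rcases List.mem_cons.1 hx with rfl | hx
    · have : l.countP (fun y => κ y ≤ κ x) = l.countP (fun y => κ y < κ x) :=
        List.countP_congr fun y hy => by
          have : κ y ≠ κ x := hκ.ne fun h => ha (h ▸ hy)
          simp [le_iff_lt_or_eq, this]
      simp [this]
    · rw [ih hl hx, rank]
      have : κ a ≠ κ x := hκ.ne fun h => ha (h ▸ hx)
      simp [le_iff_lt_or_eq, this]
      omega

theorem length_filter_lt (κ : ℕ → Y) (l : List ℕ) (x : ℕ) :
    (l.filter (filterPred κ true x)).length = rank κ l x := by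
  rw [rank, List.countP_eq_length_filter]; rfl

theorem length_filter_gt (κ : ℕ → Y) (l : List ℕ) (x : ℕ) :
    (l.filter (filterPred κ false x)).length + l.countP (fun y => κ y ≤ κ x) = l.length := by
  rw [← List.countP_eq_length_filter, List.length_eq_countP_add_countP (filterPred κ false x) (l := l)]
  congr 2
  ext; simp [filterPred]

/-- The median of the medians of groups of five has a middle rank. -/
theorem rank_median (κ : ℕ → Y) {l ms : List ℕ} {x : ℕ} (hlen : 5 * ms.length ≤ l.length)
    (hr : ∀ q (hq : q < ms.length), ms[q] ∈ (l.drop (5 * q)).take 5 ∧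
        rank κ ((l.drop (5 * q)).take 5) ms[q] = 2)
    (hx : x ∈ ms) (hxr : rank κ ms x = ms.length / 2) :
    3 * (ms.length / 2 + 1) ≤ l.countP (fun y => κ y ≤ κ x) ∧
      rank κ l x + 3 * (ms.length - ms.length / 2) ≤ l.length := by
  constructor
  · have h1 := three_mul_countP_le (P := fun y => κ y ≤ κ x) ms l fun q hq hP => by
      have := rank_lt_countP_le κ (hr q hq).1 (by simpa using hP : κ ms[q] ≤ κ x)
      rwa [(hr q hq).2] at this
    have h2 := rank_lt_countP_le κ hx le_rfl
    omega
  · have h1 := three_mul_countP_le (P := fun y => κ x ≤ κ y) ms l fun q hq hP => by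
      -- Two of the five members of a group are below its median, so three are not.
      have h := countP_ge_eq κ ((l.drop (5 * q)).take 5) ms[q]
      have hl5 : ((l.drop (5 * q)).take 5).length = 5 := by simp; omega
      rw [(hr q hq).2, hl5] at h
      have h' : ((l.drop (5 * q)).take 5).countP (fun y => κ ms[q] ≤ κ y) ≤
          ((l.drop (5 * q)).take 5).countP (fun y => κ x ≤ κ y) :=
        List.countP_mono_left fun y _ hy => by
          simp only [decide_eq_true_eq] at hy hP ⊢; exact hP.trans hy
      omega
    have h2 := countP_ge_eq κ ms x
    have h3 := countP_ge_eq κ l x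
    omega

end Rank

/-- Find the member of rank `K` of a list. The arguments are the address and the length of the list,
the rank, the table of items, and the address of the working memory. -/
def select : Cmd :=
  .ite (.lt (.reg 1) 40) (.run brute [.reg 0, .reg 1, .reg 2, .reg 3] 0) (.block [
    .run groups [.reg 0, .reg 1 / 5, .reg 3, .reg 4] 5,
    .call [.reg 4, .reg 1 / 5, .reg 1 / 5 / 2, .reg 3, .reg 4 + .reg 1 / 5] 5,
    .run (filter true) [.reg 0, .reg 1, .reg 5, .reg 3, .reg 4] 6,
    .ite (.lt (.reg 2) (.reg 6))
      (.call [.reg 4, .reg 6, .reg 2, .reg 3, .reg 4 + .reg 6] 0)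
      (.ite (.lt (.reg 6) (.reg 2))
        (.block [
          .run (filter false) [.reg 0, .reg 1, .reg 5, .reg 3, .reg 4] 7,
          .call [.reg 4, .reg 7, .reg 2 - (.reg 6 + 1), .reg 3, .reg 4 + .reg 7] 0])
        (.set 0 (.reg 5)))])

/-- Blum-Floyd-Pratt-Rivest-Tarjan. The recursive calls have sizes about `n / 5` and at most about
`7 * n / 10`, which together leave a tenth of `40000 * n` for the linear work. The cutoff 40 makes
this slack absorb the rounding, and below it the quadratic search is cheap enough. -/
theorem select_spec {p K T f : ℕ} {l : List ℕ} {μ : ℕ → ℕ} (hl : l.Nodup) (hK : K < l.length)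
    (hp : Seg μ p l) (hpf : p + l.length ≤ f) (hT : ∀ x ∈ l, T + 2 * x + 2 ≤ f)
    (hfw : f + 10 * l.length + 60 < 2 ^ w) :
    ∃ ν v t, Returns w A select [p, l.length, K, T, f] μ ν v t ∧ v ∈ l ∧
      rank (key A μ T) l v = K ∧ (∀ a < f, ν a = μ a) ∧ t ≤ 40000 * l.length := by
  induction hn : l.length using Nat.strong_induction_on generalizing p K f l μ with
  | _ n ih =>
    subst hn
    have hw : 60 < 2 ^ w := by omega
    refine exists_returns_of_eq select.eq_1 (P := fun ν v t => v ∈ l ∧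
      rank (key A μ T) l v = K ∧ (∀ a < f, ν a = μ a) ∧ t ≤ 40000 * l.length) ?_
    simp only [wp_ite, eval_lt, eval_reg, eval_ofNat, Nat.mod_eq_of_lt (show 40 < 2 ^ w by omega),
      cost_lt, cost_reg, cost_ofNat]
    have f0 : ∀ l : List ℕ, frame l = fun r => l.getD r 0 := fun l => rfl
    simp only [f0, List.getD_cons_succ, List.getD_cons_zero]
    refine ⟨fun h => ?_, fun h => ?_⟩
    · have hn : l.length < 40 := by by_contra h'; simp [h'] at h
      obtain ⟨v, t, hr, hv, hrk, ht⟩ := brute_spec (A := A) (w := w) (T := T) hl hK hp (by omega)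
        (fun x hx => by have := hT x hx; omega)
      refine wp_run _ ?_ ⟨μ, v, t, hr, ?_⟩
      · simp
      · have : 200 * l.length * (l.length + 1) ≤ 200 * l.length * 40 :=
          Nat.mul_le_mul_left _ (by omega)
        simp [hv, hrk]
        omega
    · have hn : 40 ≤ l.length := by by_contra h'; simp [not_le.1 h'] at h
      clear h
      have m5 : 5 % 2 ^ w = 5 := Nat.mod_eq_of_lt (by omega)
      have m2 : 2 % 2 ^ w = 2 := Nat.mod_eq_of_lt (by omega)
      have m1 : 1 % 2 ^ w = 1 := Nat.mod_eq_of_lt (by omega)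
      rw [wp_block_cons]
      obtain ⟨ν₁, v₁, t₁, hr₁, ⟨ms, hms, hs₁, hmed⟩, hν₁, ht₁⟩ := groups_spec (A := A) (w := w)
        (g := l.length / 5) (T := T) (f := f) hl hp (by omega) hpf (by omega) hT
      refine wp_run _ ?_ ⟨ν₁, v₁, t₁, hr₁, ?_⟩
      · simp [m5]
      rw [wp_block_cons]
      have hmsl : ∀ x ∈ ms, x ∈ l := by
        intro x hx
        obtain ⟨q, hq, rfl⟩ := List.getElem_of_mem hx
        exact List.mem_of_mem_drop (List.mem_of_mem_take (hmed q hq).1)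
      have hk₁ : ∀ x ∈ l, key A ν₁ T x = key A μ T x := fun x hx =>
        key_congr fun a ha => hν₁ a (by have := hT x hx; omega)
      obtain ⟨ν₂, x, t₂, hr₂, hx, hxr, hν₂, ht₂⟩ := ih ms.length (by omega) (p := f)
        (K := ms.length / 2) (f := f + ms.length) (l := ms) (μ := ν₁)
        (nodup_of_mem_groups hl fun q hq => (hmed q hq).1) (by omega) hs₁ le_rfl
        (fun x hx => by have := hT x (hmsl x hx); omega) (by omega) rfl
      have hxl := hmsl x hx
      rw [rank_congr (fun y hy => hk₁ y (hmsl y hy)) (hk₁ x hxl)] at hxr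
      -- This bounds both sides of the pivot, hence the size of whichever sublist is searched next.
      have hmed' := rank_median (key A μ T) (by omega) hmed hx hxr
      have hν₂' : ∀ a < f, ν₂ a = μ a := fun a ha => (hν₂ a (by omega)).trans (hν₁ a ha)
      refine wp_call _ ?_ ⟨ν₂, x, t₂, hr₂, ?_⟩
      · simp [m5, m2, hms]
        exact Nat.mod_eq_of_lt (by omega)
      rw [wp_block_cons]
      have hk₂ : ∀ x ∈ l, key A ν₂ T x = key A μ T x := fun x hx =>
        key_congr fun a ha => hν₂' a (by have := hT x hx; omega)
      obtain ⟨ν₃, c, t₃, hr₃, hc, hs₃, hν₃, ht₃⟩ := filter_spec (A := A) (w := w) true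
        (f := f) (T := T) (x := x) (hp.congr fun i hi => hν₂' _ (by omega)) hpf (by omega) hT (hT x hxl)
      have hfil : ∀ lo, l.filter (filterPred (key A ν₂ T) lo x) =
          l.filter (filterPred (key A μ T) lo x) := by
        intro lo
        refine List.filter_congr fun y hy => ?_
        simp only [filterPred, hk₂ y hy, hk₂ x hxl]
      rw [hfil] at hc hs₃
      have hν₃' : ∀ a < f, ν₃ a = μ a := fun a ha => (hν₃ a (by omega)).trans (hν₂' a ha)
      have hk₃ : ∀ x ∈ l, key A ν₃ T x = key A μ T x := fun x hx =>
        key_congr fun a ha => hν₃' a (by have := hT x hx; omega)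
      have hcr := length_filter_lt (key A μ T) l x
      refine wp_run _ ?_ ⟨ν₃, c, t₃, hr₃, ?_⟩
      · simp
      rw [wp_block_cons, wp_ite]
      simp only [eval_lt, eval_reg]
      simp only [update_self, ne_eq, Nat.reduceEqDiff, not_false_eq_true, update_of_ne,
        List.getD_cons_succ, List.getD_cons_zero]
      refine ⟨fun h => ?_, fun h => ?_⟩
      · have hKc : K < c := by by_contra h'; simp [h'] at h
        obtain ⟨ν₄, v, t₄, hr₄, hv, hvr, hν₄, ht₄⟩ := ih c (by omega) (p := f)
          (K := K) (f := f + c) (l := l.filter (filterPred (key A μ T) true x)) (μ := ν₃)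
          (hl.filter _) (by omega) hs₃ (by omega)
          (fun y hy => by have := hT y (List.mem_of_mem_filter hy); omega) (by omega) hc.symm
        have hvl := List.mem_of_mem_filter hv
        rw [rank_congr (fun y hy => hk₃ y (List.mem_of_mem_filter hy)) (hk₃ v hvl),
          rank_filter_lt _ (by simpa [filterPred] using (List.mem_filter.1 hv).2)] at hvr
        refine wp_call _ ?_ ⟨ν₄, v, t₄, hr₄, ?_⟩
        · simp
          exact Nat.mod_eq_of_lt (by omega)
        · simp [hvl, hvr]
          exact ⟨fun a ha => (hν₄ a (by omega)).trans (hν₃' a ha), by omega⟩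
      · have hKc : c ≤ K := by by_contra h'; simp [not_le.1 h'] at h
        rw [wp_ite]
        simp only [eval_lt, eval_reg]
        simp only [update_self, ne_eq, Nat.reduceEqDiff, not_false_eq_true, update_of_ne,
          List.getD_cons_succ, List.getD_cons_zero]
        refine ⟨fun h => ?_, fun h => ?_⟩
        · have hKc' : c < K := by by_contra h'; simp [h'] at h
          obtain ⟨ν₄, d, t₄, hr₄, hd, hs₄, hν₄, ht₄⟩ := filter_spec (A := A) (w := w) false
            (f := f) (T := T) (x := x) (hp.congr fun i hi => hν₃' _ (by omega)) hpf (by omega) hT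
            (hT x hxl)
          have hfil : l.filter (filterPred (key A ν₃ T) false x) =
              l.filter (filterPred (key A μ T) false x) := by
            refine List.filter_congr fun y hy => ?_
            simp only [filterPred, hk₃ y hy, hk₃ x hxl]
          rw [hfil] at hd hs₄
          have hν₄' : ∀ a < f, ν₄ a = μ a := fun a ha => (hν₄ a (by omega)).trans (hν₃' a ha)
          have hk₄ : ∀ x ∈ l, key A ν₄ T x = key A μ T x := fun x hx =>
            key_congr fun a ha => hν₄' a (by have := hT x hx; omega)
          have hdr := length_filter_gt (key A μ T) l x
          have hle := countP_le_eq (key A μ T) (key_injective μ T) hl hxl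
          rw [wp_block_cons]
          refine wp_run _ ?_ ⟨ν₄, d, t₄, hr₄, ?_⟩
          · simp
          rw [wp_block_cons]
          obtain ⟨ν₅, v, t₅, hr₅, hv, hvr, hν₅, ht₅⟩ := ih d (by omega) (p := f)
            (K := K - (c + 1)) (f := f + d) (l := l.filter (filterPred (key A μ T) false x))
            (μ := ν₄) (hl.filter _) (by omega) hs₄ (by omega)
            (fun y hy => by have := hT y (List.mem_of_mem_filter hy); omega) (by omega) hd.symm
          have hvl := List.mem_of_mem_filter hv
          rw [rank_congr (fun y hy => hk₄ y (List.mem_of_mem_filter hy)) (hk₄ v hvl)] at hvr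
          have hvr' := rank_filter_gt (key A μ T) (l := l) (v := v) (x := x)
            (by simpa [filterPred] using (List.mem_filter.1 hv).2)
          refine wp_call _ ?_ ⟨ν₅, v, t₅, hr₅, ?_⟩
          · simp [m1, Nat.mod_eq_of_lt (show c + 1 < 2 ^ w by omega)]
            exact Nat.mod_eq_of_lt (by omega)
          · simp [hvl]
            exact ⟨by omega, fun a ha => (hν₅ a (by omega)).trans (hν₄' a ha), by omega⟩
        · have hKc' : K ≤ c := by by_contra h'; simp [not_le.1 h'] at h
          simp [hxl]
          exact ⟨by omega, hν₃', by omega⟩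

end Select

end MatRAM

/-! ### Marking the smallest items of a table -/

namespace MatRAM

open Function

section Mark

variable {α : Type u} [LinearOrder α] {w : ℕ} {A : ℕ → ℕ → α}

/-- A loop that fills the cells from `b` on with the values `val 0, …, val (N - 1)`. -/
theorem wp_for_store {p : Cmd} {R μ : ℕ → ℕ} {t : ℕ} {Q : (ℕ → ℕ) → (ℕ → ℕ) → ℕ → Prop}
    {i : ℕ} {e ae ve : Expr} (N b : ℕ) (val : ℕ → ℕ) (hN : N < 2 ^ w) (hw : 1 < 2 ^ w)
    (he : ∀ x ν, e.eval w A ⟨update R i x, ν⟩ = N)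
    (hs : ∀ x < N, ∀ ν : ℕ → ℕ, (∀ a, a < b ∨ b + N ≤ a → ν a = μ a) →
      ae.eval w A ⟨update R i x, ν⟩ = b + x ∧ ve.eval w A ⟨update R i x, ν⟩ = val x)
    (hQ : ∀ ν : ℕ → ℕ, (∀ x < N, ν (b + x) = val x) → (∀ a, a < b ∨ b + N ≤ a → ν a = μ a) →
      Q (update R i N) ν (t + 2 + N * (ae.cost + ve.cost + e.cost + 9) + (e.cost + 4))) :
    Wp w A p (.for i e (.store ae ve)) R μ t Q := by
  refine wp_for N (fun x R' ν t' => R' = update R i x ∧ (∀ y < x, ν (b + y) = val y) ∧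
    (∀ a, a < b ∨ b + N ≤ a → ν a = μ a) ∧ t' = t + 2 + x * (ae.cost + ve.cost + e.cost + 9))
    hN hw ?_ ?_ ?_ ?_
  · simp
  · rintro x _ ν t' - ⟨rfl, -⟩
    exact ⟨update_self .., he _ _⟩
  · rintro x _ ν t' hx ⟨rfl, hv, hν, rfl⟩
    obtain ⟨h1, h2⟩ := hs x hx ν hν
    rw [wp_store, h1, h2]
    refine ⟨update_self .., update_idem .., fun y hy => ?_, fun a ha => ?_, by ring⟩
    · rcases Nat.lt_succ_iff_lt_or_eq.1 hy with h | rfl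
      · rw [update_of_ne (by omega), hv y h]
      · rw [update_self]
    · rw [update_of_ne (by omega), hν a ha]
  · rintro _ ν t' ⟨rfl, hv, hν, rfl⟩
    exact hQ ν hv hν

/-- Mark `K` smallest items of a table by `1` and the others by `0`. The arguments are the address
of the table, the number of its items, `K`, and the address of the result. -/
def mark : Cmd :=
  .ite (.lt 0 (.reg 2)) (.block [
    .for 4 (.reg 1) (.store (.reg 3 + .reg 4) (.reg 4)),
    .run select [.reg 3, .reg 1, .reg 2 - 1, .reg 0, .reg 3 + .reg 1] 5,
    .for 4 (.reg 1) (.store (.reg 3 + .reg 4) (1 - cmp (.reg 0) (.reg 5) (.reg 4)))])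
  (.for 4 (.reg 1) (.store (.reg 3 + .reg 4) 0))

/-- The flags `F 0, …, F (n - 1)` mark `K` items with smallest keys. -/
def Marks {Y : Type*} [LinearOrder Y] (κ : ℕ → Y) (n K : ℕ) (F : ℕ → ℕ) : Prop :=
  (∀ y < n, F y ≤ 1) ∧ ∑ y ∈ Finset.range n, F y = K ∧
    ∀ y < n, ∀ z < n, F y = 1 → F z = 0 → κ y < κ z

/-- Keys are distinct, so exactly `K` of them are at most the key of rank `K - 1`. The case `K = 0`
has no such pivot and is treated separately. -/
theorem mark_spec {T n K f : ℕ} {μ : ℕ → ℕ} (hK : K ≤ n) (hT : T + 2 * n ≤ f)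
    (hfw : f + 11 * n + 60 < 2 ^ w) :
    ∃ ν v t, Returns w A mark [T, n, K, f] μ ν v t ∧
      Marks (key A μ T) n K (fun y => ν (f + y)) ∧ (∀ a < f, ν a = μ a) ∧
      t ≤ 41000 * n + 60 := by
  have hw : 60 < 2 ^ w := by omega
  have m1 : 1 % 2 ^ w = 1 := Nat.mod_eq_of_lt (by omega)
  apply exists_returns (P := fun ν v t => Marks (key A μ T) n K (fun y => ν (f + y)) ∧
    (∀ a < f, ν a = μ a) ∧ t ≤ 41000 * n + 60)
  have f0 : ∀ l : List ℕ, frame l = fun r => l.getD r 0 := fun l => rfl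
  unfold mark
  rw [wp_ite]
  simp only [f0, eval_lt, eval_reg, eval_ofNat, Nat.zero_mod, List.getD_cons_succ,
    List.getD_cons_zero]
  refine ⟨fun h => ?_, fun h => ?_⟩
  · have hK0 : 0 < K := by by_contra h'; simp [h'] at h
    clear h
    rw [wp_block_cons]
    refine wp_for_store n f (fun x => x) (by omega) (by omega) (fun x ν => by simp) ?_ ?_
    · intro x hx ν hν
      simp
      exact Nat.mod_eq_of_lt (by omega)
    intro ν₁ hv₁ hν₁
    rw [wp_block_cons]
    have hk₁ : ∀ x < n, key A ν₁ T x = key A μ T x := fun x hx =>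
      key_congr fun a ha => hν₁ a (by omega)
    obtain ⟨ν₂, v, t₂, hr₂, hv, hvr, hν₂, ht₂⟩ := select_spec (A := A) (w := w) (p := f) (T := T)
      (K := K - 1) (f := f + n) (l := List.range n) (μ := ν₁) List.nodup_range
      (by simp; omega) (fun i hi => by rw [List.length_range] at hi; simpa using hv₁ i hi)
      (by simp) (fun x hx => by have := List.mem_range.1 hx; omega) (by simp; omega)
    rw [List.length_range] at hr₂ ht₂
    have hvn := List.mem_range.1 hv
    have hκ := key_injective (A := A) μ T
    rw [rank_congr (fun y hy => hk₁ y (List.mem_range.1 hy)) (hk₁ v hvn)] at hvr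
    refine wp_run _ ?_ ⟨ν₂, v, t₂, hr₂, ?_⟩
    · simp [m1]
      exact Nat.mod_eq_of_lt (by omega)
    rw [wp_block_cons]
    refine wp_for_store n f (fun x => if key A μ T v < key A μ T x then 0 else 1)
      (by omega) (by omega) (fun x ν => by simp) ?_ ?_
    · intro x hx ν hν
      have hμ : ∀ a < f, ν a = μ a := fun a ha =>
        ((hν a (Or.inl ha)).trans (hν₂ a (by omega))).trans (hν₁ a (Or.inl ha))
      have hk₂ : ∀ x < n, key A ν T x = key A μ T x := fun x hx =>
        key_congr fun a ha => hμ a (by omega)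
      rw [eval_sub, eval_cmp (T' := T) (x' := v) (y' := x) (by simp) (by simp) (by simp)
        (by omega) (by omega), hk₂ v hvn, hk₂ x hx]
      refine ⟨?_, ?_⟩
      · simp
        exact Nat.mod_eq_of_lt (by omega)
      · rw [eval_ofNat, m1]
        split_ifs <;> rfl
    · intro ν₃ hv₃ hν₃
      rw [wp_block_nil]
      have hF : ∀ y < n, ν₃ (f + y) = if key A μ T y ≤ key A μ T v then 1 else 0 := by
        intro y hy
        rw [hv₃ y hy]
        by_cases h : key A μ T v < key A μ T y
        · simp [h, h.not_ge]
        · simp [h, not_lt.1 h]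
      refine ⟨⟨fun y hy => ?_, ?_, fun y hy z hz h1 h2 => ?_⟩, fun a ha => ?_, ?_⟩
      · simp only [hF y hy]; split_ifs <;> simp
      · rw [Finset.sum_congr rfl fun y hy => hF y (Finset.mem_range.1 hy)]
        have := countP_le_eq (key A μ T) hκ List.nodup_range hv
        rw [hvr, List.countP_eq_length_filter,
          ← List.toFinset_card_of_nodup (List.nodup_range.filter _)] at this
        rw [← Finset.sum_filter, ← Finset.card_eq_sum_ones,
          show K = K - 1 + 1 by omega, ← this]
        congr 1
        ext; simp
      · simp only [hF y hy] at h1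
        simp only [hF z hz] at h2
        by_cases hz' : key A μ T z ≤ key A μ T v
        · simp [hz'] at h2
        · by_cases hy' : key A μ T y ≤ key A μ T v
          · exact hy'.trans_lt (not_le.1 hz')
          · simp [hy'] at h1
      · rw [hν₃ a (Or.inl ha), hν₂ a (by omega), hν₁ a (Or.inl ha)]
      · simp [cost_cmp]
        omega
  · have hK0 : K = 0 := by by_contra h'; simp [Nat.pos_of_ne_zero h'] at h
    refine wp_for_store n f (fun x => 0) (by omega) (by omega) (fun x ν => by simp) ?_ ?_
    · intro x hx ν hν
      simp
      exact Nat.mod_eq_of_lt (by omega)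
    intro ν₁ hv₁ hν₁
    refine ⟨⟨fun y hy => by simp [hv₁ y hy], ?_, fun y hy z hz h1 h2 => ?_⟩,
      fun a ha => hν₁ a (Or.inl ha), ?_⟩
    · rw [Finset.sum_congr rfl fun y hy => hv₁ y (Finset.mem_range.1 hy), hK0]; simp
    · simp [hv₁ y hy] at h1
    · simp
      omega

end Mark

end MatRAM

namespace MatRAM

open Function Finset

/-! ## Selection by sampling -/

section Combinatorics

variable {X : Type*} [LinearOrder X]

/-- `IsSelection` for rows of finite lengths. -/
def Selects (m : ℕ) (n : ℕ → ℕ) (B : ℕ → ℕ → X) (k : ℕ) (K : ℕ → ℕ) : Prop :=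
  (∀ i < m, K i ≤ n i) ∧ ∑ i ∈ range m, K i = k ∧
  ∀ i < m, ∀ j < K i, ∀ i' < m, ∀ j', K i' ≤ j' → j' < n i' → B i j ≤ B i' j'

theorem selects_iff {m : ℕ} {n : ℕ → ℕ} {B : ℕ → ℕ → X} {k : ℕ} {K : ℕ → ℕ} :
    Selects m n B k K ↔ IsSelection m (fun i => n i) B k K := by
  simp [Selects, IsSelection]

/-- Selections from rows without common items are nested. -/
theorem Selects.mono {m : ℕ} {n : ℕ → ℕ} {B : ℕ → ℕ → X} {a b : ℕ} {K L : ℕ → ℕ}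
    (hB : ∀ i < m, ∀ i' < m, ∀ j j', B i j = B i' j' → i = i')
    (hK : Selects m n B a K) (hL : Selects m n B b L) (hab : a ≤ b) :
    ∀ i < m, K i ≤ L i := by
  intro i hi
  by_contra! h
  -- Since the total of `K` does not exceed that of `L`, an excess in row `i` forces a deficit in
  -- another row. Exchanging the two boundary items gives equal items in different rows.
  obtain ⟨i', hi', h'⟩ : ∃ i' ∈ range m, K i' < L i' := by
    by_contra! h'
    have := sum_lt_sum h' ⟨i, mem_range.2 hi, h⟩
    rw [hK.2.1, hL.2.1] at this
    omega
  have hi' := mem_range.1 hi'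
  have h1 := hK.2.2 i hi _ h i' hi' (K i') le_rfl (h'.trans_le (hL.1 i' hi'))
  have h2 := hL.2.2 i' hi' _ h' i hi (L i) le_rfl (h.trans_le (hK.1 i hi))
  obtain rfl := hB _ hi _ hi' _ _ (le_antisymm h1 h2)
  omega

/-- The selection from a matrix of which some items are known to be selected (the first `lo i` items
of the rows) and some not to be selected (those after the first `hi i`). -/
theorem selects_of_window {m a : ℕ} {n lo hi K : ℕ → ℕ} {B : ℕ → ℕ → X}
    (hhi : ∀ i < m, K i ≤ hi i) (hn : ∀ i < m, hi i ≤ n i)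
    (hK : ∑ i ∈ range m, K i = a)
    (hmid : ∀ i < m, ∀ j < K i, lo i ≤ j → ∀ i' < m, ∀ j', K i' ≤ j' → j' < hi i' →
      B i j ≤ B i' j')
    (hlow : ∀ i < m, ∀ j < lo i, ∀ i' < m, ∀ j', K i' ≤ j' → j' < hi i' → B i j ≤ B i' j')
    (hupp : ∀ i < m, ∀ j, hi i ≤ j → j < n i → ∃ c : ℕ → ℕ, a ≤ ∑ i ∈ range m, c i ∧
      ∀ i' < m, c i' ≤ hi i' ∧ ∀ j' < c i', B i' j' ≤ B i j) :
    Selects m n B a K := by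
  have hin : ∀ i < m, ∀ j < K i, ∀ i' < m, ∀ j', K i' ≤ j' → j' < hi i' → B i j ≤ B i' j' := by
    intro i hi' j hj
    rcases lt_or_ge j (lo i) with h | h
    · exact hlow i hi' j h
    · exact hmid i hi' j hj h
  refine ⟨fun i hi' => (hhi i hi').trans (hn i hi'), hK, fun i hm j hj i' hm' j' hj' hj'' => ?_⟩
  rcases lt_or_ge j' (hi i') with h | h
  · exact hin i hm j hj i' hm' j' hj' h
  obtain ⟨c, hc, hc'⟩ := hupp i' hm' j' h hj''
  -- If the `c r` witnesses include an unselected item of the window, it separates the selected item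
  -- from the excluded one. Otherwise `c ≤ K` with totals forcing `c = K`, and the selected item is
  -- itself a witness.
  by_cases hex : ∃ r < m, K r < c r
  · obtain ⟨r, hr, hrc⟩ := hex
    exact (hin i hm j hj r hr _ le_rfl (hrc.trans_le (hc' r hr).1)).trans ((hc' r hr).2 _ hrc)
  · push Not at hex
    have hle : ∀ r ∈ range m, c r ≤ K r := fun r hr => hex r (mem_range.1 hr)
    have heq := (sum_eq_sum_iff_of_le hle).1 (le_antisymm (sum_le_sum hle) (hK ▸ hc)) i
      (mem_range.2 hm)
    exact (hc' i hm).2 j (heq ▸ hj)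

/-- Items forced by a sample: `L` is a selection from the sample that consists of every second item
of the rows in `S`. -/
theorem sample_lower {m a : ℕ} {n hi K L : ℕ → ℕ} {B : ℕ → ℕ → X} {S : ℕ → Prop}
    (hB : ∀ i < m, ∀ j j', j ≤ j' → j' < n i → B i j ≤ B i j')
    (hlo : ∀ i < m, 2 * L i ≤ K i) (hhi : ∀ i < m, K i ≤ hi i) (hn : ∀ i < m, hi i ≤ n i)
    (hS : ∀ i < m, ¬ S i → hi i = 0) (hK : ∑ i ∈ range m, K i = a)
    (hL : (∀ i < m, L i = 0) ∨ 2 * ∑ i ∈ range m, L i + m ≤ a)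
    (hopt : ∀ i < m, ∀ i' < m, 0 < L i → S i' → 2 * L i' + 1 < n i' →
      B i (2 * L i - 1) ≤ B i' (2 * L i' + 1))
    (hmid : ∀ i < m, ∀ j < K i, 2 * L i ≤ j → ∀ i' < m, ∀ j', K i' ≤ j' → j' < hi i' →
      B i j ≤ B i' j') :
    ∀ i < m, ∀ j < 2 * L i, ∀ i' < m, ∀ j', K i' ≤ j' → j' < hi i' → B i j ≤ B i' j' := by
  intro r hr j hj r' hr' j' hj' hj''
  have hLr : 0 < L r := by omega
  replace hL : 2 * ∑ i ∈ range m, L i + m ≤ a := hL.resolve_left fun h => hLr.ne' (h r hr)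
  by_contra! hlt
  have hy : B r' j' < B r (2 * L r - 1) :=
    hlt.trans_le (hB r hr _ _ (by omega) (by have := hlo r hr; have := hhi r hr; have := hn r hr; omega))
  have hS' : ∀ i < m, 0 < hi i → S i := fun i hi' h => by
    by_contra h'; exact h.ne' (hS i hi' h')
  -- Suppose an unselected candidate `y` is below a forced item. Items at `2 * L i + 1` are the
  -- first unselected sample items, hence above `y`, so no row selects that far.
  have h1 : ∀ i ∈ range m, K i ≤ 2 * L i + 1 := by
    intro i hi'
    have hi' := mem_range.1 hi'
    by_contra! h
    have hh := hhi i hi'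
    have hh' := hn i hi'
    have h1 := hmid i hi' (2 * L i + 1) (by omega) (by omega) r' hr' j' hj' hj''
    have h2 := hopt r hr i hi' hLr (hS' i hi' (by omega)) (by omega)
    exact absurd (h2.trans h1) hy.not_ge
  -- In the row of `y` the inequality is strict, as `y` itself lies before position `2 * L r' + 1`.
  -- Summing gives `a < 2 * ∑ L + m`, contrary to `hL`.
  have h2 : K r' < 2 * L r' + 1 := by
    by_contra! h
    have hh' := hn r' hr'
    have h1 := hB r' hr' (2 * L r' + 1) j' (by omega) (by omega)
    have h2 := hopt r hr r' hr' hLr (hS' r' hr' (by omega)) (by omega)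
    exact absurd (h2.trans h1) hy.not_ge
  have := sum_lt_sum h1 ⟨r', mem_range.2 hr', h2⟩
  rw [sum_add_distrib, ← mul_sum, hK] at this
  simp at this
  omega

/-- Items excluded by a sample: `L` is a selection from the sample that consists of every second item
of the rows in `S`, and these are the rows with the smallest first items. -/
theorem sample_upper {m b : ℕ} {n hi L : ℕ → ℕ} {B : ℕ → ℕ → X} {S : ℕ → Prop} [DecidablePred S]
    (hB : ∀ i < m, ∀ j j', j ≤ j' → j' < n i → B i j ≤ B i j') (hn : ∀ i < m, 1 ≤ n i)
    (hhi : ∀ i < m, hi i = if S i then min (n i) (2 * L i + 2) else 0)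
    (hS : ∑ i ∈ range m, (if S i then 1 else 0) = min b m)
    (hS' : ∀ i < m, ∀ i' < m, S i → ¬ S i' → B i 0 ≤ B i' 0)
    (hLn : ∀ i < m, L i ≤ if S i then n i / 2 else 0)
    (hL : ∑ i ∈ range m, L i = min (b / 2) (∑ i ∈ range m, if S i then n i / 2 else 0))
    (hopt : ∀ i < m, ∀ i' < m, 0 < L i → S i' → 2 * L i' + 1 < n i' →
      B i (2 * L i - 1) ≤ B i' (2 * L i' + 1)) :
    ∀ i < m, ∀ j, hi i ≤ j → j < n i → ∃ c : ℕ → ℕ, b ≤ ∑ i ∈ range m, c i ∧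
      ∀ i' < m, c i' ≤ hi i' ∧ ∀ j' < c i', B i' j' ≤ B i j := by
  intro r hr j hj hj'
  by_cases hSr : S r
  · rw [hhi r hr, if_pos hSr] at hj
    have hLr : L r < if S r then n r / 2 else 0 := by rw [if_pos hSr]; omega
    -- The sample of row `r` is not exhausted, so the minimum in `hL` is `b / 2`.
    have hlt := sum_lt_sum (fun i hi => hLn i (mem_range.1 hi)) ⟨r, mem_range.2 hr, hLr⟩
    have hz := hB r hr (2 * L r + 1) j (by omega) hj'
    -- All items up to the last selected sample item of each row lie below the first unselected
    -- sample item of row `r`. The two extra items of row `r` make up for the rounding in `b / 2`.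
    refine ⟨fun i => 2 * L i + if r = i then 2 else 0, ?_, fun i hi => ?_⟩
    · rw [sum_add_distrib, ← mul_sum, sum_ite_eq, if_pos (mem_range.2 hr)]
      omega
    · have hh := hhi i hi
      have hhL := hLn i hi
      by_cases hir : r = i
      · subst hir
        rw [if_pos hSr] at hh
        simp only [if_true]
        exact ⟨by omega, fun j' hj' => hB r hr _ _ (by omega) (by omega)⟩
      · simp only [hir, if_false, add_zero]
        by_cases hSi : S i
        · rw [if_pos hSi] at hh hhL
          refine ⟨by omega, fun j' hj' => ?_⟩
          exact (hB i hi _ _ (by omega) (by omega)).trans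
            ((hopt i hi r hr (by omega) hSr (by omega)).trans hz)
        · rw [if_neg hSi] at hhL
          exact ⟨by omega, fun j' hj' => by omega⟩
  -- An unmarked row exists, so fewer than `m` rows are marked, hence exactly `b`; their first items
  -- are the witnesses.
  · refine ⟨fun i => if S i then 1 else 0, ?_, fun i hi => ?_⟩
    · have : ∑ i ∈ range m, (if S i then 1 else 0) < ∑ i ∈ range m, 1 :=
        sum_lt_sum (fun i _ => by split_ifs <;> simp) ⟨r, mem_range.2 hr, by simp [hSr]⟩
      simp at this hS
      simp
      omega
    · have hh := hhi i hi
      have hni := hn i hi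
      by_cases hSi : S i
      · rw [if_pos hSi] at hh
        simp only [hSi, if_true]
        refine ⟨by omega, fun j' hj' => ?_⟩
        obtain rfl : j' = 0 := by omega
        exact (hS' i hi r hr hSi hSr).trans (hB r hr _ _ (by omega) (by omega))
      · simp [hSi]

/-- The number of candidates in rows before row `r`. -/
def offset (lo hi : ℕ → ℕ) (r : ℕ) : ℕ := ∑ i ∈ range r, (hi i - lo i)

theorem offset_succ (lo hi : ℕ → ℕ) (r : ℕ) :
    offset lo hi (r + 1) = offset lo hi r + (hi r - lo r) := sum_range_succ ..

theorem offset_mono (lo hi : ℕ → ℕ) {r r' : ℕ} (h : r ≤ r') :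
    offset lo hi r ≤ offset lo hi r' :=
  sum_le_sum_of_subset (range_mono h)

theorem offset_add_lt {lo hi : ℕ → ℕ} {r m x : ℕ} (hr : r < m) (hx : x < hi r - lo r) :
    offset lo hi r + x < offset lo hi m := by
  have := offset_mono lo hi (show r + 1 ≤ m from hr)
  rw [offset_succ] at this
  omega

theorem sum_offset (lo hi F : ℕ → ℕ) (m : ℕ) :
    ∑ r ∈ range m, ∑ x ∈ range (hi r - lo r), F (offset lo hi r + x) =
      ∑ y ∈ range (offset lo hi m), F y := by
  induction m with
  | zero => simp [offset]
  | succ m ih => rw [sum_range_succ, ih, offset_succ, sum_range_add]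

/-- The selection described by flags of the candidates. -/
theorem selection_of_marks {Y : Type*} [LinearOrder Y] {m k : ℕ} {n lo hi F : ℕ → ℕ}
    {B : ℕ → ℕ → X} {κ : ℕ → Y}
    (hB : ∀ i < m, ∀ j j', j ≤ j' → j' < n i → B i j ≤ B i j') (hn : ∀ i < m, hi i ≤ n i)
    (hlh : ∀ i < m, lo i ≤ hi i)
    (hF : Marks κ (offset lo hi m) k F)
    (hκ : ∀ i < m, ∀ x < hi i - lo i, ∀ i' < m, ∀ x' < hi i' - lo i',
      κ (offset lo hi i + x) < κ (offset lo hi i' + x') → B i (lo i + x) ≤ B i' (lo i' + x'))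
    {K : ℕ → ℕ} (hK : ∀ i < m, K i = lo i + ∑ x ∈ range (hi i - lo i), F (offset lo hi i + x)) :
    (∀ i < m, lo i ≤ K i) ∧ (∀ i < m, K i ≤ hi i) ∧
    ∑ i ∈ range m, K i = ∑ i ∈ range m, lo i + k ∧
    ∀ i < m, ∀ j < K i, lo i ≤ j → ∀ i' < m, ∀ j', K i' ≤ j' → j' < hi i' → B i j ≤ B i' j' := by
  obtain ⟨hF1, hF2, hF3⟩ := hF
  have hle : ∀ i < m, ∀ x < hi i - lo i, F (offset lo hi i + x) ≤ 1 := fun i hi' x hx =>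
    hF1 _ (offset_add_lt hi' hx)
  refine ⟨fun i hi' => by rw [hK i hi']; omega, fun i hi' => ?_, ?_, ?_⟩
  · have := sum_le_sum fun x hx => hle i hi' x (mem_range.1 hx)
    rw [hK i hi']
    have := hlh i hi'
    simp at *
    omega
  · rw [sum_congr rfl fun i hi => hK i (mem_range.1 hi), sum_add_distrib, sum_offset, hF2]
  · intro i hi' j hj hjlo i' hi'' j' hj' hj''
    have hlo' : lo i' ≤ j' := by rw [hK i' hi''] at hj'; omega
    -- The marks in a row need not be known to form an initial segment. Row `i` has more than `j -
    -- lo i` marks, so one of them is at or after `j`; dually, some candidate at or before `j'` is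
    -- unmarked. Sortedness of the rows does the rest.
    obtain ⟨x, hx, hx', hFx⟩ : ∃ x, j - lo i ≤ x ∧ x < hi i - lo i ∧
        F (offset lo hi i + x) = 1 := by
      by_contra! h
      have : ∑ x ∈ range (hi i - lo i), F (offset lo hi i + x) ≤
          ∑ x ∈ range (hi i - lo i), if x < j - lo i then 1 else 0 := by
        refine sum_le_sum fun x hx => ?_
        have hx := mem_range.1 hx
        have := hle i hi' x hx
        split_ifs with hxj
        · exact this
        · have := h x (by omega) hx
          omega
      rw [← sum_filter, ← card_eq_sum_ones] at this
      have h2 : (Finset.filter (fun x => x < j - lo i) (range (hi i - lo i))).card ≤ (range (j - lo i)).card :=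
        card_le_card fun x => by simp
      rw [card_range] at h2
      rw [hK i hi'] at hj
      omega
    obtain ⟨x', hxx', hFx'⟩ : ∃ x', x' ≤ j' - lo i' ∧ F (offset lo hi i' + x') = 0 := by
      by_contra! h
      have : ∑ x ∈ range (j' - lo i' + 1), 1 ≤
          ∑ x ∈ range (hi i' - lo i'), F (offset lo hi i' + x) := by
        refine (sum_le_sum fun x hx => ?_).trans
          (sum_le_sum_of_subset (range_mono (by omega : j' - lo i' + 1 ≤ hi i' - lo i')))
        have := h x (by have := mem_range.1 hx; omega)
        omega
      rw [hK i' hi''] at hj'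
      simp at this
      omega
    have hb := hκ i hi' x hx' i' hi'' x' (by omega)
      (hF3 _ (offset_add_lt hi' hx') _ (offset_add_lt hi'' (by omega)) hFx hFx')
    have hni := hn i hi'
    have hni' := hn i' hi''
    exact (hB i hi' _ _ (by omega) (by omega)).trans (hb.trans (hB i' hi'' _ _ (by omega) (by omega)))

/-- `Nat.count p` numbers the rows with property `p` consecutively. This recovers the original row
from its number in the compressed table. -/
theorem exists_count_eq (p : ℕ → Prop) [DecidablePred p] {m x : ℕ} (hx : x < Nat.count p m) :
    ∃ r < m, p r ∧ Nat.count p r = x := by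
  induction m with
  | zero => simp at hx
  | succ m ih =>
    rw [Nat.count_succ] at hx
    by_cases h : x < Nat.count p m
    · obtain ⟨r, hr, h⟩ := ih h
      exact ⟨r, by omega, h⟩
    · by_cases hm : p m
      · rw [if_pos hm] at hx
        exact ⟨m, by omega, hm, by omega⟩
      · rw [if_neg hm] at hx; omega

theorem sum_count (p : ℕ → Prop) [DecidablePred p] (f : ℕ → ℕ) (m : ℕ) :
    ∑ x ∈ range (Nat.count p m), f x =
      ∑ r ∈ range m, if p r then f (Nat.count p r) else 0 := by
  induction m with
  | zero => simp
  | succ m ih =>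
    rw [sum_range_succ, Nat.count_succ, ← ih]
    split_ifs
    · rw [sum_range_succ]
    · simp

end Combinatorics

end MatRAM

/-! ### Programs that build the sample -/

namespace MatRAM

open Function

section Core

variable {α : Type u} [LinearOrder α] {w : ℕ} {A : ℕ → ℕ → α}

/-- The number of a column that is given directly or, if `col` is true, by a list in the memory from
address `g` on. -/
def colExpr (col : Bool) (g x : Expr) : Expr := if col then .mem (g + x) else x

/-- The value of `colExpr`. -/
def column (col : Bool) (μ : ℕ → ℕ) (g x : ℕ) : ℕ := if col then μ (g + x) else x

theorem eval_colExpr {col : Bool} {R μ : ℕ → ℕ} {g x : Expr} {g' x' : ℕ}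
    (hg : g.eval w A ⟨R, μ⟩ = g') (hx : x.eval w A ⟨R, μ⟩ = x') (h : g' + x' < 2 ^ w) :
    (colExpr col g x).eval w A ⟨R, μ⟩ = column col μ g' x' := by
  cases col
  · simpa [colExpr, column] using hx
  · simp [colExpr, column, hg, hx, Nat.mod_eq_of_lt h]

theorem cost_colExpr_le {col : Bool} {g x : Expr} :
    (colExpr col g x).cost ≤ g.cost + x.cost + 2 := by
  cases col <;> simp [colExpr]; omega

theorem column_congr {col : Bool} {μ ν : ℕ → ℕ} {g x : ℕ} (h : col → ν (g + x) = μ (g + x)) :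
    column col ν g x = column col μ g x := by
  cases col <;> simp_all [column]

/-- Write the table of the first items of the rows. The arguments are the number of rows, the stride,
the table of rows, the list of columns, and the address of the result. -/
def firsts (col : Bool) : Cmd :=
  .for 5 (.reg 0) (.block [
    .store (.reg 4 + 2 * .reg 5) (.mem (.reg 2 + 2 * .reg 5)),
    .store (.reg 4 + 2 * .reg 5 + 1) (colExpr col (.reg 3) (.reg 1 - 1))])

theorem firsts_spec (col : Bool) {m s P g T : ℕ} {μ : ℕ → ℕ} (hP : P + 2 * m ≤ T)
    (hT : T + 2 * m + 2 < 2 ^ w) (hg : col → g + s ≤ T) (hs : 1 ≤ s) (hgs : g + s < 2 ^ w) :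
    ∃ ν v t, Returns w A (firsts col) [m, s, P, g, T] μ ν v t ∧
      (∀ r < m, ν (T + 2 * r) = μ (P + 2 * r) ∧
        ν (T + 2 * r + 1) = column col μ g (s - 1)) ∧
      (∀ a < T, ν a = μ a) ∧ t ≤ 60 * m + 20 := by
  have hw : 2 < 2 ^ w := by omega
  have m1 : 1 % 2 ^ w = 1 := Nat.mod_eq_of_lt (by omega)
  have m2 : 2 % 2 ^ w = 2 := Nat.mod_eq_of_lt (by omega)
  apply exists_returns (P := fun ν v t => (∀ r < m, ν (T + 2 * r) = μ (P + 2 * r) ∧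
        ν (T + 2 * r + 1) = column col μ g (s - 1)) ∧
      (∀ a < T, ν a = μ a) ∧ t ≤ 60 * m + 20)
  refine wp_for m (fun x R ν t => R 0 = m ∧ R 1 = s ∧ R 2 = P ∧ R 3 = g ∧ R 4 = T ∧ R 5 = x ∧
    (∀ r < x, ν (T + 2 * r) = μ (P + 2 * r) ∧ ν (T + 2 * r + 1) = column col μ g (s - 1)) ∧
    (∀ a < T, ν a = μ a) ∧ t ≤ 2 + x * 60) (by omega) (by omega) ?_ ?_ ?_ ?_
  · simp [frame]
  · rintro i R ν t - ⟨h0, h1, h2, h3, h4, h5, -⟩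
    exact ⟨h5, h0⟩
  · rintro x R ν t hx ⟨h0, h1, h2, h3, h4, h5, hv, hν, ht⟩
    have hc : ∀ ν' : ℕ → ℕ, (∀ a < T, ν' a = μ a) →
        (colExpr col (.reg 3) (.reg 1 - 1)).eval w A ⟨R, ν'⟩ = column col μ g (s - 1) := by
      intro ν' hν'
      rw [eval_colExpr (g' := g) (x' := s - 1) (eval_reg.trans h3) (by simp [h1, m1]) (by omega)]
      exact column_congr fun h => hν' _ (by have := hg h; omega)
    have hcost : (colExpr col (.reg 3) (.reg 1 - 1)).cost ≤ 6 := cost_colExpr_le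
    simp (disch := omega) only [wp_block_cons, wp_block_nil, wp_store, eval_add, eval_mul, eval_reg,
      eval_ofNat, eval_mem, h0, h2, h4, h5, Nat.mod_eq_of_lt, hν]
    rw [hc _ fun a ha => by rw [update_of_ne (by omega), hν a ha]]
    refine ⟨trivial, ?_⟩
    simp [h0, h1, h2, h3, h4]
    refine ⟨fun r hr => ?_, fun a ha => ?_, by omega⟩
    · rcases Nat.lt_succ_iff_lt_or_eq.1 (Nat.lt_succ_of_le hr) with h | rfl
      · rw [update_of_ne (by omega), update_of_ne (by omega), update_of_ne (by omega),
          update_of_ne (by omega)]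
        exact hv r h
      · rw [update_of_ne (by omega), update_self, update_self]
        exact ⟨rfl, rfl⟩
    · rw [update_of_ne (by omega), update_of_ne (by omega), hν a ha]
  · rintro R ν t ⟨h0, h1, h2, h3, h4, h5, hv, hν, ht⟩
    refine ⟨hv, hν, ?_⟩
    simp; omega

/-- Row `r` of a table of rows at address `P` is marked in the list at address `F` and has at least
two items. -/
def Kept (μ : ℕ → ℕ) (P F r : ℕ) : Prop := 0 < μ (F + r) ∧ 1 < μ (P + 2 * r + 1)

instance (μ : ℕ → ℕ) (P F : ℕ) : DecidablePred (Kept μ P F) := fun r => by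
  unfold Kept; infer_instance

/-- Write the table of the marked rows with at least two items, where every second item is kept, and
after the space reserved for this table the number of the items. The arguments are the number of
rows, the table of rows, the list of marks, and the address of the result. The number of rows kept is
returned. -/
def keep : Cmd :=
  .block [
    .for 4 (.reg 0) (.ite (.lt 0 (.mem (.reg 2 + .reg 4)) * .lt 1 (.mem (.reg 1 + 2 * .reg 4 + 1)))
      (.block [
        .store (.reg 3 + 2 * .reg 5) (.mem (.reg 1 + 2 * .reg 4)),
        .store (.reg 3 + 2 * .reg 5 + 1) (.mem (.reg 1 + 2 * .reg 4 + 1) / 2),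
        .set 6 (.reg 6 + .mem (.reg 3 + 2 * .reg 5 + 1)),
        .set 5 (.reg 5 + 1)]) .skip),
    .store (.reg 3 + 2 * .reg 0) (.reg 6),
    .set 0 (.reg 5)]

/-- The output position of a kept row is the number of kept rows before it. The space reserved is
always `2 * m` cells, so the sample size can be stored at the fixed address `G + 2 * m`. -/
theorem keep_spec {m P F G : ℕ} {μ : ℕ → ℕ} (hP : P + 2 * m ≤ G) (hF : F + m ≤ G)
    (hG : G + 2 * m + 4 < 2 ^ w) (hn : ∑ r ∈ Finset.range m, μ (P + 2 * r + 1) < 2 ^ w) :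
    ∃ ν v t, Returns w A keep [m, P, F, G] μ ν v t ∧
      (v = Nat.count (Kept μ P F) m ∧ (∀ r < m, Kept μ P F r →
        ν (G + 2 * Nat.count (Kept μ P F) r) = μ (P + 2 * r) ∧
        ν (G + 2 * Nat.count (Kept μ P F) r + 1) = μ (P + 2 * r + 1) / 2) ∧
      ν (G + 2 * m) = ∑ r ∈ Finset.range m, (if Kept μ P F r then μ (P + 2 * r + 1) / 2 else 0) ∧
      (∀ a < G, ν a = μ a) ∧ t ≤ 100 * m + 40) := by
  have hw : 4 < 2 ^ w := by omega
  have m1 : 1 % 2 ^ w = 1 := Nat.mod_eq_of_lt (by omega)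
  have m2 : 2 % 2 ^ w = 2 := Nat.mod_eq_of_lt (by omega)
  apply exists_returns
  simp only [keep, wp_block_cons, wp_block_nil]
  set c := Nat.count (Kept μ P F) with hc
  set N : ℕ → ℕ := fun x =>
    ∑ r ∈ Finset.range x, (if Kept μ P F r then μ (P + 2 * r + 1) / 2 else 0) with hN
  have hcm : ∀ x, c x ≤ x := fun x => Nat.count_le _
  have hNm : ∀ x ≤ m, N x < 2 ^ w := fun x hx =>
    ((Finset.sum_le_sum_of_subset (Finset.range_mono hx)).trans
      (Finset.sum_le_sum fun r _ => by split_ifs <;> omega)).trans_lt hn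
  refine wp_for m (fun x R ν t => R 0 = m ∧ R 1 = P ∧ R 2 = F ∧ R 3 = G ∧ R 4 = x ∧ R 5 = c x ∧
    R 6 = N x ∧ (∀ r < x, Kept μ P F r → ν (G + 2 * c r) = μ (P + 2 * r) ∧
      ν (G + 2 * c r + 1) = μ (P + 2 * r + 1) / 2) ∧
    (∀ a < G, ν a = μ a) ∧ t ≤ 2 + x * 100) (by omega) (by omega) ?_ ?_ ?_ ?_
  · simp [frame, hc, hN]
  · rintro i R ν t - ⟨h0, h1, h2, h3, h4, -⟩
    exact ⟨h4, h0⟩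
  · rintro x R ν t hx ⟨h0, h1, h2, h3, h4, h5, h6, hv, hν, ht⟩
    have hcx := hcm x
    have hc1 : c (x + 1) = c x + if Kept μ P F x then 1 else 0 := Nat.count_succ ..
    have hN1 : N (x + 1) = N x + if Kept μ P F x then μ (P + 2 * x + 1) / 2 else 0 :=
      Finset.sum_range_succ ..
    have hNx := hNm (x + 1) hx
    have econd : (Expr.lt 0 (.mem (.reg 2 + .reg 4)) *
        Expr.lt 1 (.mem (.reg 1 + 2 * .reg 4 + 1))).eval w A ⟨R, ν⟩ =
        if Kept μ P F x then 1 else 0 := by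
      simp (disch := omega) only [eval_add, eval_mul, eval_reg, eval_lt,
        eval_ofNat, eval_mem, h0, h1, h2, h4, h5, Nat.mod_eq_of_lt, hν, Kept, Nat.zero_mod]
      by_cases h1 : 0 < μ (F + x) <;> by_cases h2 : 1 < μ (P + 2 * x + 1) <;> simp [h1, h2, m1]
    rw [wp_ite, econd]
    by_cases hk : Kept μ P F x
    · simp only [hk, if_true] at hc1 hN1 ⊢
      refine ⟨fun _ => ?_, fun h => absurd h one_ne_zero⟩
      simp (disch := omega) only [wp_block_cons, wp_block_nil, wp_store, wp_set, eval_add, eval_mul,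
        eval_reg, eval_ofNat, eval_mem, eval_div, h0, h1, h2, h3, h4, h5, h6, Nat.mod_eq_of_lt, hν,
        update_of_ne, update_self]
      simp [h0, h1, h2, h3, h4, h5]
      rw [← hN1]
      refine ⟨hc1.symm, rfl, fun r hr hkr => ?_, fun a ha => ?_, by omega⟩
      · rcases Nat.lt_succ_iff_lt_or_eq.1 (Nat.lt_succ_of_le hr) with h | rfl
        · have : c r < c x := Nat.count_strict_mono hkr h
          simp (disch := omega) only [update_of_ne]
          exact hv r h hkr
        · simp (disch := omega) only [update_of_ne, update_self, and_self]
      · rw [update_of_ne (by omega), update_of_ne (by omega), hν a ha]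
    · simp only [hk, if_false, add_zero] at hc1 hN1 ⊢
      refine ⟨fun h => absurd rfl h, fun _ => ?_⟩
      rw [wp_skip]
      simp [h0, h1, h2, h3, h4, h5, h6, hc1, hN1]
      refine ⟨fun r hr hkr => hv r (lt_of_le_of_ne hr ?_) hkr, hν, by omega⟩
      rintro rfl; exact hk hkr
  · rintro R ν t ⟨h0, h1, h2, h3, h4, h5, h6, hv, hν, ht⟩
    simp (disch := omega) only [wp_store, wp_set, eval_add, eval_mul, eval_reg, eval_ofNat, h0, h3,
      h6, h5, Nat.mod_eq_of_lt, update_self]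
    refine ⟨trivial, fun r hr hkr => ?_, rfl, fun a ha => ?_, by simp; omega⟩
    · have : c r < c m := Nat.count_strict_mono hkr hr
      have := hcm m
      rw [update_of_ne (by omega), update_of_ne (by omega)]
      exact hv r hr hkr
    · rw [update_of_ne (by omega), hν a ha]

end Core

end MatRAM

/-! ### Programs for the window of a row and its candidates -/

namespace MatRAM

open Function

section Core

variable {α : Type u} [LinearOrder α] {w : ℕ} {A : ℕ → ℕ → α}

/-- The number of items of row `r` known to be selected. -/
def candLo (μ : ℕ → ℕ) (P F G r : ℕ) : ℕ :=
  if Kept μ P F r then 2 * μ (G + 2 * Nat.count (Kept μ P F) r) else 0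

/-- The number of items of row `r` not known to be left out. -/
def candHi (μ : ℕ → ℕ) (P F G r : ℕ) : ℕ :=
  if 0 < μ (F + r) then min (μ (P + 2 * r + 1))
    ((if Kept μ P F r then 2 * μ (G + 2 * Nat.count (Kept μ P F) r + 1) else 0) + 2) else 0

/-- Compute `candLo` and `candHi` for the row in register `8`. -/
def window : Cmd :=
  .ite (.lt 0 (.mem (.reg 5 + .reg 8)))
    (.block [
      .ite (.lt 1 (.mem (.reg 2 + 2 * .reg 8 + 1)))
        (.block [
          .set 12 (2 * .mem (.reg 6 + 2 * .reg 9)),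
          .set 13 (2 * .mem (.reg 6 + 2 * .reg 9 + 1) + 2),
          .set 9 (.reg 9 + 1)])
        (.block [.set 12 0, .set 13 2]),
      .set 13 (.min (.mem (.reg 2 + 2 * .reg 8 + 1)) (.reg 13))])
    (.block [.set 12 0, .set 13 0])

/-- Register 9 advances only over kept rows, so it always points to the recursive result for the
next kept row. The current memory `ν` need agree with `μ` only on the three regions read, since the
tables being written change meanwhile. -/
theorem wp_window {p : Cmd} {R μ ν : ℕ → ℕ} {t m P F G r : ℕ}
    {Q : (ℕ → ℕ) → (ℕ → ℕ) → ℕ → Prop} (hr : r < m) (h2 : R 2 = P) (h5 : R 5 = F) (h6 : R 6 = G)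
    (h8 : R 8 = r) (h9 : R 9 = Nat.count (Kept μ P F) r)
    (hP : P + 2 * m + 4 < 2 ^ w) (hF : F + m < 2 ^ w) (hG : G + 2 * m + 4 < 2 ^ w)
    (hνP : ∀ a, P ≤ a → a < P + 2 * m → ν a = μ a)
    (hνF : ∀ a, F ≤ a → a < F + m → ν a = μ a)
    (hνG : ∀ a, G ≤ a → a < G + 2 * m → ν a = μ a)
    (hL : Kept μ P F r → 2 * μ (G + 2 * Nat.count (Kept μ P F) r) + 2 < 2 ^ w ∧
      2 * μ (G + 2 * Nat.count (Kept μ P F) r + 1) + 2 < 2 ^ w)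
    (hQ : ∀ R' t', R' 9 = Nat.count (Kept μ P F) (r + 1) → R' 12 = candLo μ P F G r →
      R' 13 = candHi μ P F G r → (∀ q, q ≠ 9 → q ≠ 12 → q ≠ 13 → R' q = R q) → t' ≤ t + 80 →
      Q R' ν t') :
    Wp w A p window R ν t Q := by
  have m1 : 1 % 2 ^ w = 1 := Nat.mod_eq_of_lt (by omega)
  have m2 : 2 % 2 ^ w = 2 := Nat.mod_eq_of_lt (by omega)
  have hc1 : Nat.count (Kept μ P F) (r + 1) = Nat.count (Kept μ P F) r +
    if Kept μ P F r then 1 else 0 := Nat.count_succ ..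
  have hcr := Nat.count_le (Kept μ P F) (n := r)
  set c := Nat.count (Kept μ P F) with hc
  have e1 : (Expr.lt 0 (.mem (.reg 5 + .reg 8))).eval w A ⟨R, ν⟩ =
      if 0 < μ (F + r) then 1 else 0 := by
    simp (disch := omega) only [eval_add, eval_reg, eval_lt, eval_ofNat, eval_mem, h5, h8,
      Nat.mod_eq_of_lt, hνF, Nat.zero_mod]
  have e2 : (Expr.lt 1 (.mem (.reg 2 + 2 * .reg 8 + 1))).eval w A ⟨R, ν⟩ =
      if 1 < μ (P + 2 * r + 1) then 1 else 0 := by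
    simp (disch := omega) only [eval_add, eval_mul, eval_reg, eval_lt, eval_ofNat, eval_mem, h2, h8,
      Nat.mod_eq_of_lt, hνP]
  rw [window, wp_ite, e1]
  by_cases hS : 0 < μ (F + r)
  · simp only [hS, if_true, one_ne_zero, ne_eq, not_false_eq_true, forall_const, false_imp_iff,
      and_true]
    rw [wp_block_cons, wp_ite, e2]
    by_cases hn : 1 < μ (P + 2 * r + 1)
    · have hk : Kept μ P F r := ⟨hS, hn⟩
      have hL' := hL hk
      rw [if_pos hk] at hc1
      simp only [hn, if_true, one_ne_zero, ne_eq, not_false_eq_true, forall_const, false_imp_iff,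
        and_true]
      simp (disch := omega) only [wp_block_cons, wp_block_nil, wp_set, eval_add, eval_mul,
        eval_reg, eval_ofNat, eval_mem, eval_min, h2, h5, h6, h8, h9, Nat.mod_eq_of_lt, hνG, hνP,
        update_of_ne, update_self]
      refine hQ _ _ ?_ ?_ ?_ (fun q hq1 hq2 hq3 => ?_) ?_
      · simp [hc1]
      · simp [candLo, hk, ← hc]
      · simp [candHi, hk, ← hc, hS]
      · simp [hq1, hq2, hq3]
      · simp
    -- A marked row with at most one item has no sample; its upper bound 2 is cut down to its
    -- length.
    · have hk : ¬ Kept μ P F r := fun h => hn h.2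
      rw [if_neg hk] at hc1
      simp only [hn, if_false, one_ne_zero, ne_eq, not_true_eq_false, forall_const, false_imp_iff,
        true_and]
      simp (disch := omega) only [wp_block_cons, wp_block_nil, wp_set, eval_add, eval_mul,
        eval_reg, eval_ofNat, eval_mem, eval_min, h2, h5, h6, h8, h9, Nat.mod_eq_of_lt, hνG, hνP,
        update_of_ne, update_self]
      refine hQ _ _ ?_ ?_ ?_ (fun q hq1 hq2 hq3 => ?_) ?_
      · simp [hc1, h9]
      · simp [candLo, hk]
      · simp [candHi, hk, hS]
      · simp [hq1, hq2, hq3]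
      · simp
  · have hk : ¬ Kept μ P F r := fun h => hS h.1
    rw [if_neg hk] at hc1
    simp only [hS, if_false, one_ne_zero, ne_eq, not_true_eq_false, forall_const, false_imp_iff,
      true_and]
    simp only [wp_block_cons, wp_block_nil, wp_set, eval_ofNat, Nat.zero_mod]
    refine hQ _ _ ?_ ?_ ?_ (fun q hq1 hq2 hq3 => ?_) ?_
    · simp [hc1, h9]
    · simp [candLo, hk]
    · simp [candHi, hS]
    · simp [hq1, hq2, hq3]
    · simp

/-- Append the candidates of the row in register `8` to the table of candidates. -/
def push (col : Bool) : Cmd :=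
  .for 11 (.reg 13 - .reg 12) (.block [
    .store (.reg 7 + 2 * .reg 10) (.mem (.reg 2 + 2 * .reg 8)),
    .store (.reg 7 + 2 * .reg 10 + 1)
      (colExpr col (.reg 3) ((.reg 12 + .reg 11 + 1) * .reg 1 - 1)),
    .set 10 (.reg 10 + 1)])

/-- With stride `s`, item `j` sits in column `(j + 1) * s - 1` of the original matrix. `Z` bounds
these products, which keeps them within a word and inside the column list. -/
theorem wp_push {col : Bool} {p : Cmd} {R μ : ℕ → ℕ} {t s P g T r lo hi c Z : ℕ}
    {Q : (ℕ → ℕ) → (ℕ → ℕ) → ℕ → Prop} (h1 : R 1 = s) (h2 : R 2 = P) (h3 : R 3 = g) (h7 : R 7 = T)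
    (h8 : R 8 = r) (h10 : R 10 = c) (h12 : R 12 = lo) (h13 : R 13 = hi)
    (hP : P + 2 * r < T) (hT : T + 2 * (c + (hi - lo)) + 4 < 2 ^ w) (hhi : hi < 2 ^ w)
    (hZ : hi * s ≤ Z) (hs : 1 ≤ s) (hg : col → g + Z ≤ T) (hgZ : g + Z < 2 ^ w)
    (hQ : ∀ R' ν t', R' 10 = c + (hi - lo) → (∀ q, q ≠ 10 → q ≠ 11 → R' q = R q) →
      (∀ x < hi - lo, ν (T + 2 * (c + x)) = μ (P + 2 * r) ∧
        ν (T + 2 * (c + x) + 1) = column col μ g ((lo + x + 1) * s - 1)) →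
      (∀ a < T + 2 * c, ν a = μ a) → t' ≤ t + 100 * (hi - lo) + 20 → Q R' ν t') :
    Wp w A p (push col) R μ t Q := by
  have m1 : 1 % 2 ^ w = 1 := Nat.mod_eq_of_lt (by omega)
  have m2 : 2 % 2 ^ w = 2 := Nat.mod_eq_of_lt (by omega)
  refine wp_for (hi - lo) (fun x R' ν t' => R' 11 = x ∧ R' 10 = c + x ∧
      (∀ q, q ≠ 10 → q ≠ 11 → R' q = R q) ∧
      (∀ y < x, ν (T + 2 * (c + y)) = μ (P + 2 * r) ∧
        ν (T + 2 * (c + y) + 1) = column col μ g ((lo + y + 1) * s - 1)) ∧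
      (∀ a < T + 2 * c, ν a = μ a) ∧ t' ≤ t + 2 + 100 * x) (by omega) (by omega) ?_ ?_ ?_ ?_
  · simp [h10]
    intro q _ hq; simp [hq]
  · rintro x R' ν t' - ⟨h11, h10', hR, -⟩
    refine ⟨h11, ?_⟩
    simp [hR, h12, h13]
  · rintro x R' ν t' hx ⟨h11, h10', hR, hv, hν, ht⟩
    have r1 : R' 1 = s := by rw [hR, h1] <;> decide
    have r2 : R' 2 = P := by rw [hR, h2] <;> decide
    have r3 : R' 3 = g := by rw [hR, h3] <;> decide
    have r7 : R' 7 = T := by rw [hR, h7] <;> decide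
    have r8 : R' 8 = r := by rw [hR, h8] <;> decide
    have r12 : R' 12 = lo := by rw [hR, h12] <;> decide
    have hpos : (lo + x + 1) * s ≤ Z :=
      (Nat.mul_le_mul_right s (by omega : lo + x + 1 ≤ hi)).trans hZ
    have hpos' : 1 ≤ (lo + x + 1) * s := Nat.mul_pos (by omega) hs
    have hc : ∀ ν' : ℕ → ℕ, (∀ a < T, ν' a = μ a) →
        (colExpr col (.reg 3) ((.reg 12 + .reg 11 + 1) * .reg 1 - 1)).eval w A ⟨R', ν'⟩ =
          column col μ g ((lo + x + 1) * s - 1) := by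
      intro ν' hν'
      rw [eval_colExpr (g' := g) (x' := (lo + x + 1) * s - 1) (eval_reg.trans r3) ?_ (by omega)]
      · exact column_congr fun h => hν' _ (by have := hg h; omega)
      · simp (disch := omega) only [eval_add, eval_mul, eval_reg, eval_ofNat, eval_sub, r12, h11, r1,
          Nat.mod_eq_of_lt]
    have hcost : (colExpr col (.reg 3) ((.reg 12 + .reg 11 + 1) * .reg 1 - 1)).cost ≤ 12 :=
      cost_colExpr_le
    simp (disch := omega) only [wp_block_cons, wp_block_nil, wp_store, wp_set, eval_add, eval_mul,
      eval_reg, eval_ofNat, eval_mem, r2, r7, r8, h10', Nat.mod_eq_of_lt, hν]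
    rw [hc _ fun a ha => by rw [update_of_ne (by omega), hν a (by omega)]]
    refine ⟨by simp [h11], by simp, ?_, fun q hq hq' => ?_, fun y hy => ?_,
      fun a ha => ?_, ?_⟩
    · simp [add_assoc]
    · simp [hq, hq', hR]
    · rcases Nat.lt_succ_iff_lt_or_eq.1 hy with h | rfl
      · simp (disch := omega) only [update_of_ne]
        exact hv y h
      · simp (disch := omega) only [update_of_ne, update_self, and_self]
    · simp (disch := omega) only [update_of_ne]
      exact hν a ha
    · simp; omega
  · rintro R' ν t' ⟨h11, h10', hR, hv, hν, ht⟩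
    exact hQ _ _ _ h10' hR hv hν (by simp; omega)

end Core

end MatRAM

/-! ### Programs that collect the candidates and count the marks -/

namespace MatRAM

open Function

section Core

variable {α : Type u} [LinearOrder α] {w : ℕ} {A : ℕ → ℕ → α}

/-- Write the table of candidates and the numbers `candLo` and `candHi`. The arguments are the number
of rows, the stride, the table of rows, the list of columns, the address of the result, the list of
marks, the result for the rows kept, and the address of the table of candidates. -/
def candidates (col : Bool) : Cmd :=
  .block [
    .for 8 (.reg 0) (.block [
      window,
      .store (.reg 4 + 2 * .reg 8) (.reg 12),
      .store (.reg 4 + 2 * .reg 8 + 1) (.reg 13),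
      push col]),
    .set 0 (.reg 10)]

theorem candidates_spec (col : Bool) {m s P g f F G T Z : ℕ} {μ : ℕ → ℕ}
    {lo hi o : ℕ → ℕ} (hlo : lo = candLo μ P F G) (hhi : hi = candHi μ P F G)
    (ho : o = offset lo hi)
    (hPf : P + 2 * m ≤ f) (hfF : f + 2 * m ≤ F) (hfG : f + 2 * m ≤ G) (hFT : F + m ≤ T)
    (hGT : G + 2 * m ≤ T) (hT : T + 2 * o m + 4 < 2 ^ w)
    (hL : ∀ r < m, Kept μ P F r →
      2 * μ (G + 2 * Nat.count (Kept μ P F) r) + 2 < 2 ^ w ∧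
      2 * μ (G + 2 * Nat.count (Kept μ P F) r + 1) + 2 < 2 ^ w)
    (hZ : ∀ r < m, hi r * s ≤ Z) (hs : 1 ≤ s) (hg : col → g + Z ≤ f) (hgZ : g + Z < 2 ^ w) :
    ∃ ν v t, Returns w A (candidates col) [m, s, P, g, f, F, G, T] μ ν v t ∧
      (v = o m ∧ (∀ r < m, ν (f + 2 * r) = lo r ∧ ν (f + 2 * r + 1) = hi r) ∧
      (∀ r < m, ∀ x < hi r - lo r, ν (T + 2 * (o r + x)) = μ (P + 2 * r) ∧
        ν (T + 2 * (o r + x) + 1) = column col μ g ((lo r + x + 1) * s - 1)) ∧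
      (∀ a < f, ν a = μ a) ∧ t ≤ 200 * m + 100 * o m + 40) := by
  have hw : 4 < 2 ^ w := by omega
  have m1 : 1 % 2 ^ w = 1 := Nat.mod_eq_of_lt (by omega)
  have m2 : 2 % 2 ^ w = 2 := Nat.mod_eq_of_lt (by omega)
  apply exists_returns
  simp only [candidates, wp_block_cons, wp_block_nil]
  have hosucc : ∀ r, o (r + 1) = o r + (hi r - lo r) := fun r => by rw [ho, offset_succ]
  have homono : ∀ r r', r ≤ r' → o r ≤ o r' := fun r r' h => by rw [ho]; exact offset_mono _ _ h
  have hhin : ∀ r < m, hi r < 2 ^ w := fun r hr => by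
    have h1 := hZ r hr
    have h2 := Nat.le_mul_of_pos_right (hi r) hs
    omega
  refine wp_for m (fun x R ν t => R 0 = m ∧ R 1 = s ∧ R 2 = P ∧ R 3 = g ∧ R 4 = f ∧ R 5 = F ∧
    R 6 = G ∧ R 7 = T ∧ R 8 = x ∧ R 9 = Nat.count (Kept μ P F) x ∧ R 10 = o x ∧
    (∀ r < x, ν (f + 2 * r) = lo r ∧ ν (f + 2 * r + 1) = hi r) ∧
    (∀ r < x, ∀ y < hi r - lo r, ν (T + 2 * (o r + y)) = μ (P + 2 * r) ∧
        ν (T + 2 * (o r + y) + 1) = column col μ g ((lo r + y + 1) * s - 1)) ∧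
    (∀ a < f, ν a = μ a) ∧ (∀ a, f + 2 * m ≤ a → a < T → ν a = μ a) ∧
    t ≤ 2 + x * 200 + 100 * o x) (by omega) (by omega) ?_ ?_ ?_ ?_
  · simp [frame, ho, offset]
  · rintro x R ν t - ⟨h0, h1, h2, h3, h4, h5, h6, h7, h8, -⟩
    exact ⟨h8, h0⟩
  · rintro x R ν t hx ⟨h0, h1, h2, h3, h4, h5, h6, h7, h8, h9, h10, hv, hT', hν, hν', ht⟩
    have hox := hosucc x
    have hom := homono (x + 1) m hx
    rw [wp_block_cons]
    refine wp_window hx h2 h5 h6 h8 h9 (by omega) (by omega) (by omega)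
      (fun a _ _ => hν a (by omega)) (fun a _ _ => hν' a (by omega) (by omega))
      (fun a _ _ => hν' a (by omega) (by omega)) (hL x hx) ?_
    intro R' t' h9' h12 h13 hR ht'
    rw [← hlo] at h12
    rw [← hhi] at h13
    have r0 : R' 0 = m := by rw [hR, h0] <;> decide
    have r1 : R' 1 = s := by rw [hR, h1] <;> decide
    have r2 : R' 2 = P := by rw [hR, h2] <;> decide
    have r3 : R' 3 = g := by rw [hR, h3] <;> decide
    have r4 : R' 4 = f := by rw [hR, h4] <;> decide
    have r5 : R' 5 = F := by rw [hR, h5] <;> decide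
    have r6 : R' 6 = G := by rw [hR, h6] <;> decide
    have r7 : R' 7 = T := by rw [hR, h7] <;> decide
    have r8 : R' 8 = x := by rw [hR, h8] <;> decide
    have r10 : R' 10 = o x := by rw [hR, h10] <;> decide
    simp (disch := omega) only [wp_block_cons, wp_store, eval_add, eval_mul, eval_reg, eval_ofNat,
      r4, r8, h12, h13, Nat.mod_eq_of_lt]
    refine wp_push (lo := lo x) (hi := hi x) (c := o x) (Z := Z) r1 r2 r3 r7 r8 r10 h12 h13
      (by omega) (by omega) (hhin x hx) (hZ x hx) hs (fun h => (hg h).trans (by omega)) hgZ ?_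
    intro R'' ν' t'' h10'' hR'' hv' hν'' ht''
    have s0 : R'' 0 = m := by rw [hR'', r0] <;> decide
    have s1 : R'' 1 = s := by rw [hR'', r1] <;> decide
    have s2 : R'' 2 = P := by rw [hR'', r2] <;> decide
    have s3 : R'' 3 = g := by rw [hR'', r3] <;> decide
    have s4 : R'' 4 = f := by rw [hR'', r4] <;> decide
    have s5 : R'' 5 = F := by rw [hR'', r5] <;> decide
    have s6 : R'' 6 = G := by rw [hR'', r6] <;> decide
    have s7 : R'' 7 = T := by rw [hR'', r7] <;> decide
    have s8 : R'' 8 = x := by rw [hR'', r8] <;> decide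
    have s9 : R'' 9 = Nat.count (Kept μ P F) (x + 1) := by rw [hR'', h9'] <;> decide
    rw [wp_block_nil]
    refine ⟨s8, by simp [s0], by simp [s1], by simp [s2], by simp [s3], by simp [s4], by simp [s5],
      by simp [s6], by simp [s7], by simp, by simp [s9], by simp [h10'', hox], ?_, ?_, ?_, ?_, ?_⟩
    · intro r hr
      rw [hν'' _ (by omega), hν'' _ (by omega)]
      rcases Nat.lt_succ_iff_lt_or_eq.1 hr with h | rfl
      · simp (disch := omega) only [update_of_ne]
        exact hv r h
      · simp (disch := omega) only [update_of_ne, update_self, and_self]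
    · intro r hr y hy
      rcases Nat.lt_succ_iff_lt_or_eq.1 hr with h | rfl
      · have h1 := hosucc r
        have h2 := homono (r + 1) x h
        rw [hν'' _ (by omega), hν'' _ (by omega)]
        simp (disch := omega) only [update_of_ne]
        exact hT' r h y hy
      · obtain ⟨h1, h2⟩ := hv' y hy
        rw [h1, h2]
        simp (disch := omega) only [update_of_ne]
        refine ⟨hν _ (by omega), column_congr fun h => ?_⟩
        have := hg h
        have := (Nat.mul_le_mul_right s (by omega : lo r + y + 1 ≤ hi r)).trans (hZ r hx)
        have : 1 ≤ (lo r + y + 1) * s := Nat.mul_pos (by omega) hs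
        simp (disch := omega) only [update_of_ne]
        exact hν _ (by omega)
    · intro a ha
      rw [hν'' _ (by omega)]
      simp (disch := omega) only [update_of_ne]
      exact hν a ha
    · intro a ha ha'
      rw [hν'' _ (by omega)]
      simp (disch := omega) only [update_of_ne]
      exact hν' a ha ha'
    · simp at ht'' ⊢
      omega
  · rintro R ν t ⟨h0, h1, h2, h3, h4, h5, h6, h7, h8, h9, h10, hv, hT', hν, hν', ht⟩
    simp [h10]
    exact ⟨hv, hT', hν, by omega⟩

/-- Count the marked candidates of each row for two lists of marks. The arguments are the number of
rows, the address of the numbers `candLo` and `candHi`, which are replaced by the results, and the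
two lists. -/
def counts : Cmd :=
  .for 4 (.reg 0) (.block [
    .set 7 (.mem (.reg 1 + 2 * .reg 4)),
    .set 8 (.reg 7),
    .set 9 (.mem (.reg 1 + 2 * .reg 4 + 1) - .reg 7),
    .for 6 (.reg 9) (.block [
      .set 7 (.reg 7 + .mem (.reg 2 + .reg 5)),
      .set 8 (.reg 8 + .mem (.reg 3 + .reg 5)),
      .set 5 (.reg 5 + 1)]),
    .store (.reg 1 + 2 * .reg 4) (.reg 7),
    .store (.reg 1 + 2 * .reg 4 + 1) (.reg 8)])

theorem counts_spec {m f F G : ℕ} {μ lo hi o : ℕ → ℕ} (ho : o = offset lo hi)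
    (hμ : ∀ r < m, μ (f + 2 * r) = lo r ∧ μ (f + 2 * r + 1) = hi r)
    (hhi : ∀ r < m, lo r ≤ hi r) (hhw : ∀ r < m, hi r + 4 < 2 ^ w)
    (hfF : f + 2 * m ≤ F) (hfG : f + 2 * m ≤ G) (hF : F + o m + 4 < 2 ^ w) (hG : G + o m + 4 < 2 ^ w)
    (hF1 : ∀ y < o m, μ (F + y) ≤ 1) (hG1 : ∀ y < o m, μ (G + y) ≤ 1) :
    ∃ ν v t, Returns w A counts [m, f, F, G] μ ν v t ∧
      ((∀ r < m, ν (f + 2 * r) = lo r + ∑ x ∈ Finset.range (hi r - lo r), μ (F + (o r + x)) ∧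
        ν (f + 2 * r + 1) = lo r + ∑ x ∈ Finset.range (hi r - lo r), μ (G + (o r + x))) ∧
      (∀ a < f, ν a = μ a) ∧ t ≤ 100 * m + 50 * o m + 40) := by
  have hw : 4 < 2 ^ w := by omega
  have m1 : 1 % 2 ^ w = 1 := Nat.mod_eq_of_lt (by omega)
  have m2 : 2 % 2 ^ w = 2 := Nat.mod_eq_of_lt (by omega)
  have hosucc : ∀ r, o (r + 1) = o r + (hi r - lo r) := fun r => by rw [ho, offset_succ]
  have homono : ∀ r r', r ≤ r' → o r ≤ o r' := fun r r' h => by rw [ho]; exact offset_mono _ _ h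
  apply exists_returns (P := fun ν v t => (∀ r < m,
        ν (f + 2 * r) = lo r + ∑ x ∈ Finset.range (hi r - lo r), μ (F + (o r + x)) ∧
        ν (f + 2 * r + 1) = lo r + ∑ x ∈ Finset.range (hi r - lo r), μ (G + (o r + x))) ∧
      (∀ a < f, ν a = μ a) ∧ t ≤ 100 * m + 50 * o m + 40)
  -- The results replace the bounds in place; cells from `f + 2 * x` on are still untouched when row
  -- `x` is read.
  refine wp_for m (fun x R ν t => R 0 = m ∧ R 1 = f ∧ R 2 = F ∧ R 3 = G ∧ R 4 = x ∧ R 5 = o x ∧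
    (∀ r < x, ν (f + 2 * r) = lo r + ∑ x ∈ Finset.range (hi r - lo r), μ (F + (o r + x)) ∧
        ν (f + 2 * r + 1) = lo r + ∑ x ∈ Finset.range (hi r - lo r), μ (G + (o r + x))) ∧
    (∀ a, a < f ∨ f + 2 * x ≤ a → ν a = μ a) ∧ t ≤ 2 + x * 100 + 50 * o x)
    (by omega) (by omega) ?_ ?_ ?_ ?_
  · simp [frame, ho, offset]
  · rintro x R ν t - ⟨h0, h1, h2, h3, h4, -⟩
    exact ⟨h4, h0⟩
  · rintro x R ν t hx ⟨h0, h1, h2, h3, h4, h5, hv, hν, ht⟩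
    have hox := hosucc x
    have hom := homono (x + 1) m hx
    have hhx := hhi x hx
    have hhwx := hhw x hx
    obtain ⟨hμ1, hμ2⟩ := hμ x hx
    have hle : ∀ (H : ℕ), (∀ y < o m, μ (H + y) ≤ 1) → ∀ y ≤ hi x - lo x,
        ∑ z ∈ Finset.range y, μ (H + (o x + z)) ≤ y := by
      intro H hH y hy
      refine (Finset.sum_le_sum fun z hz => hH (o x + z) ?_).trans (by simp)
      have := Finset.mem_range.1 hz; omega
    simp (disch := omega) only [wp_block_cons, wp_block_nil, wp_set, eval_add, eval_mul, eval_reg,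
      eval_ofNat, eval_mem, eval_sub, h1, h4, Nat.mod_eq_of_lt, hν, hμ1, hμ2, update_of_ne,
      update_self]
    refine wp_for (hi x - lo x) (fun y R ν' t' => R 0 = m ∧ R 1 = f ∧ R 2 = F ∧ R 3 = G ∧
      R 4 = x ∧ R 5 = o x + y ∧ R 6 = y ∧
      R 7 = lo x + ∑ z ∈ Finset.range y, μ (F + (o x + z)) ∧
      R 8 = lo x + ∑ z ∈ Finset.range y, μ (G + (o x + z)) ∧ R 9 = hi x - lo x ∧ ν' = ν ∧
      t' ≤ t + 40 + 50 * y)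
      (by omega) (by omega) ?_ ?_ ?_ ?_
    · simp [h0, h1, h2, h3, h4, h5]
    · rintro y R ν t - ⟨h0, h1, h2, h3, h4, h5, h6, h7, h8, h9, -⟩
      exact ⟨h6, h9⟩
    · rintro y R' ν' t' hy ⟨h0, h1, h2, h3, h4, h5, h6, h7, h8, h9, rfl, ht'⟩
      have hle1 := hle F hF1 (y + 1) hy
      have hle2 := hle G hG1 (y + 1) hy
      rw [Finset.sum_range_succ] at hle1 hle2
      simp (disch := omega) only [wp_block_cons, wp_block_nil, wp_set, eval_add, eval_mul, eval_reg,
        eval_ofNat, eval_mem, eval_sub, h2, h3, h5, h7, h8, Nat.mod_eq_of_lt, hν, update_of_ne,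
        update_self]
      simp [h0, h1, h2, h3, h4, h6, h9, Finset.sum_range_succ, add_assoc]
      omega
    · rintro R' ν' t' ⟨h0, h1, h2, h3, h4, h5, h6, h7, h8, h9, rfl, ht'⟩
      simp (disch := omega) only [wp_store, eval_add, eval_mul, eval_reg,
        eval_ofNat, h1, h4, h7, h8, Nat.mod_eq_of_lt]
      refine ⟨trivial, by simp [h0], by simp [h1], by simp [h2], by simp [h3], by simp,
        by simp [h5, hox], fun r hr => ?_, fun a ha => ?_, by simp; omega⟩
      · rcases Nat.lt_succ_iff_lt_or_eq.1 hr with h | rfl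
        · simp (disch := omega) only [update_of_ne]
          exact hv r h
        · simp (disch := omega) only [update_of_ne, update_self, and_self]
      · simp (disch := omega) only [update_of_ne]
        exact hν a (by omega)
  · rintro R ν t ⟨h0, h1, h2, h3, h4, h5, hv, hν, ht⟩
    refine ⟨hv, fun a ha => hν a (Or.inl ha), ?_⟩
    simp; omega

end Core

end MatRAM

/-! ### Transferring a selection from the sample to the matrix -/

namespace MatRAM

open Function Finset

section Combinatorics

variable {X : Type*} [LinearOrder X]

/-- The selection `L'` from the rows with property `p`, as numbers for all rows. -/
def spread (p : ℕ → Prop) [DecidablePred p] (L' : ℕ → ℕ) (r : ℕ) : ℕ :=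
  if p r then L' (Nat.count p r) else 0

theorem sum_spread (p : ℕ → Prop) [DecidablePred p] (L' : ℕ → ℕ) (m : ℕ) :
    ∑ r ∈ range m, spread p L' r = ∑ x ∈ range (Nat.count p m), L' x :=
  (sum_count p L' m).symm

theorem count_lt_count {p : ℕ → Prop} [DecidablePred p] {r m : ℕ} (hr : r < m) (h : p r) :
    Nat.count p r < Nat.count p m := Nat.count_strict_mono h hr

variable {m : ℕ} {n n' : ℕ → ℕ} {B B' : ℕ → ℕ → X} {p S : ℕ → Prop} [DecidablePred p]
  [DecidablePred S]

/-- Sample item `j` is item `2 * j + 1` of the row, so the last selected sample item has position `2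
* L - 1` and the first unselected one position `2 * L + 1`. -/
theorem spread_opt {l : ℕ} {L' : ℕ → ℕ} (hp : ∀ r, p r ↔ S r ∧ 1 < n r)
    (hL : Selects (Nat.count p m) n' B' l L')
    (hn' : ∀ r < m, p r → n' (Nat.count p r) = n r / 2)
    (hB' : ∀ r < m, p r → ∀ j, 2 * j + 1 < n r → B' (Nat.count p r) j = B r (2 * j + 1)) :
    ∀ i < m, ∀ i' < m, 0 < spread p L' i → S i' → 2 * spread p L' i' + 1 < n i' →
      B i (2 * spread p L' i - 1) ≤ B i' (2 * spread p L' i' + 1) := by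
  intro i hi i' hi' h0 hS hn
  have hpi' : p i' := (hp i').2 ⟨hS, by omega⟩
  have hpi : p i := by by_contra h; simp [spread, h] at h0
  simp only [spread, if_pos hpi, if_pos hpi'] at h0 hn ⊢
  have h := hL.2.2 _ (count_lt_count hi hpi) (L' (Nat.count p i) - 1) (by omega) _
    (count_lt_count hi' hpi') _ le_rfl (by rw [hn' i' hi' hpi']; omega)
  have hle := hL.1 _ (count_lt_count hi hpi)
  rw [hn' i hi hpi] at hle
  rw [hB' i hi hpi _ (by omega), hB' i' hi' hpi' _ hn] at h
  rwa [show 2 * L' (Nat.count p i) - 1 = 2 * (L' (Nat.count p i) - 1) + 1 by omega]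

theorem spread_le {l : ℕ} {L' : ℕ → ℕ} (hp : ∀ r, p r ↔ S r ∧ 1 < n r)
    (hL : Selects (Nat.count p m) n' B' l L')
    (hn' : ∀ r < m, p r → n' (Nat.count p r) = n r / 2) :
    ∀ i < m, spread p L' i ≤ if S i then n i / 2 else 0 := by
  intro i hi
  by_cases hpi : p i
  · have := hL.1 _ (count_lt_count hi hpi)
    rw [hn' i hi hpi] at this
    simpa [spread, hpi, ((hp i).1 hpi).1] using this
  · simp [spread, hpi]

theorem sum_half_eq (hp : ∀ r, p r ↔ S r ∧ 1 < n r) :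
    ∑ r ∈ range m, (if S r then n r / 2 else 0) = ∑ r ∈ range m, if p r then n r / 2 else 0 := by
  refine sum_congr rfl fun r _ => ?_
  by_cases hS : S r
  · by_cases h : 1 < n r
    · simp [hp, hS, h]
    · simp [hp, hS, h]; omega
  · simp [hp, hS]

/-- The bounds obtained from a sample. -/
theorem sample_bounds {a b a' b' : ℕ} {lo hi L₁ L₂ : ℕ → ℕ}
    (hB : ∀ i < m, ∀ j j', j ≤ j' → j' < n i → B i j ≤ B i j') (hn : ∀ i < m, 1 ≤ n i)
    (hbn : b ≤ ∑ i ∈ range m, n i)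
    (hS : ∑ i ∈ range m, (if S i then 1 else 0) = min b m)
    (hS' : ∀ i < m, ∀ i' < m, S i → ¬ S i' → B i 0 ≤ B i' 0)
    (hp : ∀ r, p r ↔ S r ∧ 1 < n r)
    (hn' : ∀ r < m, p r → n' (Nat.count p r) = n r / 2)
    (hB' : ∀ r < m, p r → ∀ j, 2 * j + 1 < n r → B' (Nat.count p r) j = B r (2 * j + 1))
    (ha' : a' = (a - m) / 2)
    (hb' : b' = min (b / 2) (∑ r ∈ range m, if p r then n r / 2 else 0))
    (hL₁ : Selects (Nat.count p m) n' B' a' L₁) (hL₂ : Selects (Nat.count p m) n' B' b' L₂)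
    (hL : ∀ x < Nat.count p m, L₁ x ≤ L₂ x)
    (hlo : lo = fun r => 2 * spread p L₁ r)
    (hhi : hi = fun r => if S r then min (n r) (2 * spread p L₂ r + 2) else 0) :
    (∀ r < m, lo r ≤ hi r) ∧ (∀ r < m, hi r ≤ n r) ∧ ∑ r ∈ range m, lo r = 2 * a' ∧
    offset lo hi m + 2 * a' = ∑ r ∈ range m, hi r ∧ b ≤ ∑ r ∈ range m, hi r ∧
    offset lo hi m ≤ 2 * (b' - a') + 2 * m ∧
    ∀ x, a ≤ x → x ≤ b → ∀ K : ℕ → ℕ, (∀ i < m, lo i ≤ K i) → (∀ i < m, K i ≤ hi i) →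
      ∑ i ∈ range m, K i = x →
      (∀ i < m, ∀ j < K i, lo i ≤ j → ∀ i' < m, ∀ j', K i' ≤ j' → j' < hi i' → B i j ≤ B i' j') →
      Selects m n B x K := by
  have hopt₁ := spread_opt hp hL₁ hn' hB'
  have hopt₂ := spread_opt hp hL₂ hn' hB'
  have hle₁ := spread_le hp hL₁ hn'
  have hle₂ := spread_le hp hL₂ hn'
  have hs₁ := sum_spread p L₁ m
  have hs₂ := sum_spread p L₂ m
  rw [hL₁.2.1] at hs₁
  rw [hL₂.2.1, hb'] at hs₂
  have hsl : ∀ r < m, spread p L₁ r ≤ spread p L₂ r := by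
    intro r hr
    unfold spread
    split_ifs with h
    · exact hL _ (count_lt_count hr h)
    · rfl
  have hhin : ∀ r < m, hi r ≤ n r := fun r hr => by
    rw [hhi]; simp only; split_ifs <;> omega
  have hlohi : ∀ r < m, lo r ≤ hi r := by
    intro r hr
    have h1 := hle₁ r hr
    have h2 := hsl r hr
    rw [hhi, hlo]; simp only
    split_ifs at h1 ⊢ <;> omega
  have hupp := sample_upper (hi := hi) hB hn (fun i _ => by rw [hhi]) hS hS' hle₂
    (by rw [hs₂, sum_half_eq hp]) hopt₂
  have hlosum : ∑ r ∈ range m, lo r = 2 * a' := by rw [hlo, ← mul_sum, hs₁]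
  refine ⟨hlohi, hhin, hlosum, ?_, ?_, ?_, ?_⟩
  · rw [← hlosum, offset, ← sum_add_distrib]
    refine sum_congr rfl fun r hr => ?_
    have := hlohi r (mem_range.1 hr)
    omega
  -- Either some row is cut, and the witnesses for its first excluded item provide `b` items in the
  -- windows, or the windows contain the whole matrix.
  · by_cases h : ∃ r < m, hi r < n r
    · obtain ⟨r, hr, h⟩ := h
      obtain ⟨c, hc, hc'⟩ := hupp r hr (hi r) le_rfl h
      exact hc.trans (sum_le_sum fun i hi => (hc' i (mem_range.1 hi)).1)
    · push Not at h
      exact hbn.trans (sum_le_sum fun i hi => h i (mem_range.1 hi))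
  · have : offset lo hi m + 2 * a' ≤ 2 * b' + 2 * m := by
      have h1 : ∑ r ∈ range m, (2 * spread p L₂ r + 2) = 2 * b' + 2 * m := by
        rw [sum_add_distrib, ← mul_sum, hs₂, hb']; simp [mul_comm]
      rw [← h1, ← hlosum, offset, ← sum_add_distrib]
      refine sum_le_sum fun r hr => ?_
      have := hlohi r (mem_range.1 hr)
      have h2 : hi r ≤ 2 * spread p L₂ r + 2 := by
        rw [hhi]; simp only; split_ifs <;> omega
      omega
    omega
  · intro x hax hxb K hloK hKhi hKx hmid
    refine selects_of_window (lo := lo) hKhi hhin hKx hmid ?_ fun i hi j hj hj' => ?_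
    · rw [hlo] at hloK hmid ⊢
      refine sample_lower (S := S) hB hloK hKhi hhin (fun i _ hi => by rw [hhi]; simp [hi]) hKx ?_
        hopt₁ hmid
      rw [hs₁]
      -- Subtraction is truncated: for `a < m` nothing is forced, which is the other alternative of
      -- `sample_lower`.
      by_cases h : m ≤ a
      · right; omega
      · left
        have h0 : a' = 0 := by omega
        rw [h0] at hs₁
        exact fun i hi => (sum_eq_zero_iff.1 hs₁) i (mem_range.2 hi)
    · obtain ⟨c, hc, hc'⟩ := hupp i hi j hj hj'
      exact ⟨c, hxb.trans hc, hc'⟩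

/-- The ranks for the sample are admissible. -/
theorem sample_rank_le {a b a' b' : ℕ} (hab : a ≤ b) (hbn : b ≤ ∑ i ∈ range m, n i)
    (hS : ∑ i ∈ range m, (if S i then 1 else 0) = min b m)
    (hp : ∀ r, p r ↔ S r ∧ 1 < n r) (ha' : a' = (a - m) / 2)
    (hb' : b' = min (b / 2) (∑ r ∈ range m, if p r then n r / 2 else 0)) : a' ≤ b' := by
  by_cases h : a ≤ m
  · omega
  -- Here `b ≥ a > m`, so every row is marked. Halving then loses at most one item per row, whence
  -- the sample has at least `(b - m) / 2` items.
  · have hall : ∀ i ∈ range m, (if S i then 1 else 0) = 1 := by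
      have hle : ∀ i ∈ range m, (if S i then 1 else 0) ≤ 1 := fun i _ => by split_ifs <;> simp
      refine (sum_eq_sum_iff_of_le hle).1 ?_
      rw [hS]; simp; omega
    have h2 : ∑ r ∈ range m, n r ≤ 2 * (∑ r ∈ range m, if p r then n r / 2 else 0) + m := by
      have h3 : ∑ r ∈ range m, (2 * (if p r then n r / 2 else 0) + 1) =
        2 * (∑ r ∈ range m, if p r then n r / 2 else 0) + m := by
        rw [sum_add_distrib, ← mul_sum]; simp
      rw [← h3]
      refine sum_le_sum fun r hr => ?_
      have h4 := hall r hr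
      have hSr : S r := by by_contra h; simp [h] at h4
      by_cases h1 : 1 < n r
      · simp [hp, hSr, h1]; omega
      · simp [hp, h1]; omega
    omega

theorem count_le_sum_marks (hp : ∀ r, p r ↔ S r ∧ 1 < n r) :
    Nat.count p m ≤ ∑ i ∈ range m, (if S i then 1 else 0) := by
  induction m with
  | zero => simp
  | succ m ih =>
    rw [Nat.count_succ, sum_range_succ]
    by_cases h : p m
    · simp only [h, ((hp m).1 h).1, if_true]; omega
    · simp only [h, if_false]; omega

end Combinatorics

end MatRAM

/-! ### The recursive two-rank selection -/

namespace MatRAM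

open Function

section Core

variable {α : Type u} [LinearOrder α] {w : ℕ} {A : ℕ → ℕ → α}

/-- Item `j` of row `r` of the matrix given by the table of rows at address `P`, by the list of
columns at address `g` and by the stride `s`. Ties are broken by the number of the row. -/
def rowItem (A : ℕ → ℕ → α) (col : Bool) (μ : ℕ → ℕ) (P g s r j : ℕ) : α ×ₗ ℕ :=
  toLex (A (μ (P + 2 * r)) (column col μ g ((j + 1) * s - 1)), μ (P + 2 * r))

/-- Table keys break ties by position, `rowItem` by row number. The two agree as soon as positions
in the table follow the order of the rows. -/
theorem rowItem_le_of_key_lt {col : Bool} {μ ν : ℕ → ℕ} {P g s r j r' j' T y y' : ℕ}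
    (h : key A ν T y < key A ν T y') (hr : ν (T + 2 * y) = μ (P + 2 * r))
    (hc : ν (T + 2 * y + 1) = column col μ g ((j + 1) * s - 1))
    (hr' : ν (T + 2 * y') = μ (P + 2 * r'))
    (hc' : ν (T + 2 * y' + 1) = column col μ g ((j' + 1) * s - 1))
    (hy : y < y' → μ (P + 2 * r) ≤ μ (P + 2 * r')) :
    rowItem A col μ P g s r j ≤ rowItem A col μ P g s r' j' := by
  rw [key, key, Prod.Lex.toLex_lt_toLex, item, item, hr, hc, hr', hc'] at h
  rw [rowItem, rowItem, Prod.Lex.toLex_le_toLex]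
  exact h.imp id fun h => ⟨h.1, hy h.2⟩

/-- Selections of ranks `a ≤ b` from a matrix. The arguments are the number of rows, `a`, `b`, the
stride, the table of rows, the list of columns, and the address of the result. -/
def core (col : Bool) : Cmd :=
  .ite (.lt 0 (.reg 2)) (.block [
    .run (firsts col) [.reg 0, .reg 3, .reg 4, .reg 5, .reg 6 + 2 * .reg 0] 7,
    .run mark [.reg 6 + 2 * .reg 0, .reg 0, .min (.reg 2) (.reg 0), .reg 6 + 4 * .reg 0] 7,
    .run keep [.reg 0, .reg 4, .reg 6 + 4 * .reg 0, .reg 6 + 5 * .reg 0] 8,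
    .set 9 ((.reg 1 - .reg 0) / 2),
    .call [.reg 8, .reg 9, .min (.reg 2 / 2) (.mem (.reg 6 + 7 * .reg 0)), 2 * .reg 3,
      .reg 6 + 5 * .reg 0, .reg 5, .reg 6 + 7 * .reg 0 + 1] 7,
    .run (candidates col) [.reg 0, .reg 3, .reg 4, .reg 5, .reg 6, .reg 6 + 4 * .reg 0,
      .reg 6 + 7 * .reg 0 + 1, .reg 6 + 9 * .reg 0 + 1] 10,
    .set 11 (.reg 6 + 9 * .reg 0 + 1),
    .run mark [.reg 11, .reg 10, .reg 1 - 2 * .reg 9, .reg 11 + 2 * .reg 10] 7,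
    .run mark [.reg 11, .reg 10, .reg 2 - 2 * .reg 9, .reg 11 + 3 * .reg 10] 7,
    .run counts [.reg 0, .reg 6, .reg 11 + 2 * .reg 10, .reg 11 + 3 * .reg 10] 7])
  (.for 7 (2 * .reg 0) (.store (.reg 6 + .reg 7) 0))

/-- The specification of `core`. -/
def CoreSpec (w : ℕ) (A : ℕ → ℕ → α) (col : Bool) (m a b s P g f : ℕ) (μ : ℕ → ℕ) : Prop :=
  ∃ ν v t, Returns w A (core col) [m, a, b, s, P, g, f] μ ν v t ∧
    (Selects m (fun r => μ (P + 2 * r + 1)) (rowItem A col μ P g s) a (fun r => ν (f + 2 * r)) ∧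
    Selects m (fun r => μ (P + 2 * r + 1)) (rowItem A col μ P g s) b
      (fun r => ν (f + 2 * r + 1)) ∧
    (∀ x < f, ν x = μ x) ∧
    t ≤ 1000000 * (b - a + 1) + 2000000 * (m + 2 * b) ∧
    t ≤ 1000000 * (b - a + 1) +
      2000000 * ∑ r ∈ Finset.range m, (1 + Nat.log 2 (μ (P + 2 * r + 1))))

theorem core_spec_zero (col : Bool) {m s P g f : ℕ} {μ : ℕ → ℕ}
    (hw : f + 2 * m + 10 < 2 ^ w) : CoreSpec w A col m 0 0 s P g f μ := by
  have m2 : 2 % 2 ^ w = 2 := Nat.mod_eq_of_lt (by omega)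
  refine exists_returns_of_eq (core.eq_1 col) (P := fun ν v t => _) ?_
  rw [wp_ite]
  simp only [eval_lt, eval_ofNat, eval_reg, Nat.zero_mod]
  refine ⟨fun h => absurd (by simp [frame]) h, fun _ => ?_⟩
  refine wp_for_store (2 * m) f (fun x => 0) (by omega) (by omega) (fun x ν => ?_) ?_ ?_
  · simp (disch := omega) only [frame, eval_mul, eval_ofNat, eval_reg, List.getD_cons_succ,
      List.getD_cons_zero, ne_eq, Nat.reduceEqDiff, not_false_eq_true, update_of_ne,
      Nat.mod_eq_of_lt]
  · intro x hx ν hν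
    simp (disch := omega) only [frame, eval_add, eval_ofNat, eval_reg, List.getD_cons_succ,
      List.getD_cons_zero, ne_eq, Nat.reduceEqDiff, not_false_eq_true, update_of_ne, update_self,
      Nat.mod_eq_of_lt, and_self, Nat.zero_mod]
  · intro ν hv hν
    have h1 : ∀ r < m, ν (f + 2 * r) = 0 := fun r hr => hv (2 * r) (by omega)
    have h2 : ∀ r < m, ν (f + 2 * r + 1) = 0 := fun r hr => hv (2 * r + 1) (by omega)
    have hm : m ≤ ∑ r ∈ Finset.range m, (1 + Nat.log 2 (μ (P + 2 * r + 1))) := by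
      rw [Finset.sum_add_distrib]; simp
    refine ⟨⟨fun r hr => by simp [h1 r hr], ?_, fun r hr j hj => by simp [h1 r hr] at hj⟩,
      ⟨fun r hr => by simp [h2 r hr], ?_, fun r hr j hj => by simp [h2 r hr] at hj⟩,
      fun x hx => hν x (Or.inl hx), ?_, ?_⟩
    · exact Finset.sum_eq_zero fun r hr => h1 r (Finset.mem_range.1 hr)
    · exact Finset.sum_eq_zero fun r hr => h2 r (Finset.mem_range.1 hr)
    · simp; omega
    · simp; omega

/-- The hypotheses on the input of `core`. -/
structure CoreInput (w : ℕ) (A : ℕ → ℕ → α) (col : Bool) (m a b s P g f Z : ℕ) (μ : ℕ → ℕ) :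
    Prop where
  hab : a ≤ b
  hb : b ≤ ∑ r ∈ Finset.range m, μ (P + 2 * r + 1)
  hn : 0 < b → ∀ r < m, 1 ≤ μ (P + 2 * r + 1)
  hrow : ∀ r r', r < r' → r' < m → μ (P + 2 * r) < μ (P + 2 * r')
  hB : ∀ r < m, ∀ j j', j ≤ j' → j' < μ (P + 2 * r + 1) →
    rowItem A col μ P g s r j ≤ rowItem A col μ P g s r j'
  hPf : P + 2 * m ≤ f
  hs : 1 ≤ s
  hg : col → g + Z ≤ f
  hZ : ∀ r < m, μ (P + 2 * r + 1) * s ≤ Z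
  hbs : s * b ≤ Z
  hw : f + 100 * ((m + b + 1) * (b + 1)) + 100 < 2 ^ w
  hwZ : 2 * Z + g + 4 < 2 ^ w
  hsum : ∑ r ∈ Finset.range m, μ (P + 2 * r + 1) < 2 ^ w

theorem Selects.congr_length {X : Type*} [LinearOrder X] {m : ℕ} {n n' : ℕ → ℕ} {B : ℕ → ℕ → X}
    {k : ℕ} {K : ℕ → ℕ} (h : Selects m n B k K) (hn : ∀ i < m, n' i = n i) :
    Selects m n' B k K := by
  refine ⟨fun i hi => (h.1 i hi).trans_eq (hn i hi).symm, h.2.1, fun i hi j hj i' hi' j' hj' => ?_⟩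
  rw [hn i' hi']
  exact h.2.2 i hi j hj i' hi' j' hj'

theorem count_congr {p q : ℕ → Prop} [DecidablePred p] [DecidablePred q] {m : ℕ}
    (h : ∀ r < m, p r ↔ q r) : ∀ r ≤ m, Nat.count p r = Nat.count q r := by
  intro r hr
  induction r with
  | zero => simp
  | succ r ih => rw [Nat.count_succ, Nat.count_succ, ih (by omega)]; simp only [h r hr]

/-- A kept row loses 1 from its logarithm by halving, and a dropped row loses its entire term, which
is at least 1. So this potential falls by at least the number of rows. -/
theorem sum_log_half_le {m : ℕ} {n : ℕ → ℕ} {p : ℕ → Prop} [DecidablePred p]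
    (hp : ∀ r < m, p r → 1 < n r) :
    ∑ r ∈ Finset.range m, (if p r then 1 + Nat.log 2 (n r / 2) else 0) + m ≤
      ∑ r ∈ Finset.range m, (1 + Nat.log 2 (n r)) := by
  have : ∑ r ∈ Finset.range m, ((if p r then 1 + Nat.log 2 (n r / 2) else 0) + 1) =
      ∑ r ∈ Finset.range m, (if p r then 1 + Nat.log 2 (n r / 2) else 0) + m := by
    rw [Finset.sum_add_distrib]; simp
  rw [← this]
  refine Finset.sum_le_sum fun r hr => ?_
  split_ifs with h
  · have h1 := Nat.log_div_base 2 (n r)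
    have h2 := Nat.log_pos one_lt_two (hp r (Finset.mem_range.1 hr) h)
    omega
  · omega

/-- One level costs `O(b - a + m)`. Its `m` part is paid by either potential: `d + 2 * b' ≤ 2 * b`,
since at most `b` rows are kept, and the logarithmic sum drops by `m`. The term in `b - a` pays for
itself because the gap is roughly halved. From `f` on, the working memory holds in turn: windows and
later results, table of first items, marks (`f + 4 * m`), kept rows (`f + 5 * m`), sample size (`f +
7 * m`), results of the recursive call, and the candidates (`f + 9 * m + 1`) with their two lists of
marks. -/
theorem core_spec_succ {col : Bool} {m a b s P g f Z : ℕ} {μ : ℕ → ℕ}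
    (h : CoreInput w A col m a b s P g f Z μ) (hb0 : 0 < b)
    (ih : ∀ {m a b' s P g f Z : ℕ} {μ : ℕ → ℕ}, b' < b → CoreInput w A col m a b' s P g f Z μ →
      CoreSpec w A col m a b' s P g f μ) : CoreSpec w A col m a b s P g f μ := by
  obtain ⟨hab, hb, hn, hrow, hB, hPf, hs, hg, hZ, hbs, hw, hwZ, hsum⟩ := h
  replace hn := hn hb0
  have hw' : f + 200 * (m + b + 1) + 100 < 2 ^ w := by
    have : (m + b + 1) * 2 ≤ (m + b + 1) * (b + 1) := Nat.mul_le_mul_left _ (by omega)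
    omega
  have hsZ : s ≤ Z := (Nat.le_mul_of_pos_right s hb0).trans hbs
  refine exists_returns_of_eq (core.eq_1 col) (P := fun ν v t => _) ?_
  have f0 : frame [m, a, b, s, P, g, f] = fun r => [m, a, b, s, P, g, f].getD r 0 := rfl
  rw [wp_ite]
  simp only [eval_lt, eval_ofNat, eval_reg, Nat.zero_mod, f0, List.getD_cons_succ,
    List.getD_cons_zero, hb0, if_true]
  refine ⟨fun _ => ?_, fun h => absurd h one_ne_zero⟩
  -- the rows with the smallest first items
  obtain ⟨ν₁, v₁, t₁, hr₁, hv₁, hν₁, ht₁⟩ := firsts_spec (w := w) (A := A) col (m := m) (s := s)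
    (P := P) (g := g) (T := f + 2 * m) (μ := μ) (by omega) (by omega)
    (fun h => by have := hg h; omega) hs (by omega)
  rw [wp_block_cons]
  refine wp_run _ ?_ ⟨ν₁, v₁, t₁, hr₁, ?_⟩
  · simp (disch := omega) only [List.map_cons, List.map_nil, eval_add, eval_mul, eval_ofNat,
      eval_reg, List.getD_cons_succ, List.getD_cons_zero, Nat.mod_eq_of_lt]
  obtain ⟨ν₂, v₂, t₂, hr₂, hm₂, hν₂, ht₂⟩ := mark_spec (w := w) (A := A) (T := f + 2 * m) (n := m)
    (K := min b m) (f := f + 4 * m) (μ := ν₁) (by omega) (by omega) (by omega)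
  rw [wp_block_cons]
  refine wp_run _ ?_ ⟨ν₂, v₂, t₂, hr₂, ?_⟩
  · simp (disch := omega) only [List.map_cons, List.map_nil, eval_add, eval_mul, eval_ofNat,
      eval_reg, List.getD_cons_succ, List.getD_cons_zero, Nat.mod_eq_of_lt, eval_min, ne_eq,
      Nat.reduceEqDiff, not_false_eq_true, update_of_ne]
  have hμ₂ : ∀ x < f, ν₂ x = μ x := fun x hx => by rw [hν₂ x (by omega), hν₁ x (by omega)]
  obtain ⟨ν₃, d, t₃, hr₃, hd, hv₃, hN₃, hν₃, ht₃⟩ := keep_spec (w := w) (A := A) (m := m) (P := P)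
    (F := f + 4 * m) (G := f + 5 * m) (μ := ν₂) (by omega) (by omega) (by omega)
    (by rwa [Finset.sum_congr rfl fun r hr => hμ₂ _ (by have := Finset.mem_range.1 hr; omega)])
  rw [wp_block_cons]
  refine wp_run _ ?_ ⟨ν₃, d, t₃, hr₃, ?_⟩
  · simp (disch := omega) only [List.map_cons, List.map_nil, eval_add, eval_mul, eval_ofNat,
      eval_reg, List.getD_cons_succ, List.getD_cons_zero, Nat.mod_eq_of_lt, ne_eq,
      Nat.reduceEqDiff, not_false_eq_true, update_of_ne]
  have hμ₃ : ∀ x < f, ν₃ x = μ x := fun x hx => by rw [hν₃ x (by omega), hμ₂ x hx]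
  rw [wp_block_cons, wp_set, wp_block_cons]
  have hn₂ : ∀ r < m, ν₂ (P + 2 * r + 1) = μ (P + 2 * r + 1) := fun r hr => hμ₂ _ (by omega)
  have hrow₂ : ∀ r < m, ν₂ (P + 2 * r) = μ (P + 2 * r) := fun r hr => hμ₂ _ (by omega)
  have hdm : d ≤ m := hd ▸ Nat.count_le _
  have hpos : ∀ r < m, ∀ j < μ (P + 2 * r + 1), 1 ≤ (j + 1) * s ∧ (j + 1) * s ≤ Z := fun r hr j hj =>
    ⟨Nat.mul_pos (by omega) hs, (Nat.mul_le_mul_right s (by omega)).trans (hZ r hr)⟩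
  -- the marked rows
  have hS : ∑ r ∈ Finset.range m, (if 0 < ν₂ (f + 4 * m + r) then 1 else 0) = min b m := by
    rw [← hm₂.2.1]
    refine Finset.sum_congr rfl fun r hr => ?_
    have := hm₂.1 r (Finset.mem_range.1 hr)
    simp only at this ⊢
    split_ifs <;> omega
  have hS' : ∀ i < m, ∀ i' < m, 0 < ν₂ (f + 4 * m + i) → ¬ 0 < ν₂ (f + 4 * m + i') →
      rowItem A col μ P g s i 0 ≤ rowItem A col μ P g s i' 0 := by
    intro i hi i' hi' h h'
    have h1 := hm₂.1 i hi
    have h2 := hm₂.2.2 i hi i' hi' (by simp only at h1 ⊢; omega) (by simp only; omega)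
    obtain ⟨e1, e2⟩ := hv₁ i hi
    obtain ⟨e3, e4⟩ := hv₁ i' hi'
    refine rowItem_le_of_key_lt h2 e1 (by simpa using e2) e3 (by simpa using e4) fun hlt => ?_
    exact (hrow i i' hlt hi').le
  -- the recursive call
  set N' := ∑ r ∈ Finset.range m, (if Kept ν₂ P (f + 4 * m) r then ν₂ (P + 2 * r + 1) / 2 else 0)
    with hN'
  set a' := (a - m) / 2 with ha'
  set b' := min (b / 2) N' with hb'
  have hsumd : ∀ F : ℕ → ℕ, ∑ x ∈ Finset.range d, F (ν₃ (f + 5 * m + 2 * x + 1)) =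
      ∑ r ∈ Finset.range m, if Kept ν₂ P (f + 4 * m) r then F (ν₂ (P + 2 * r + 1) / 2) else 0 := by
    intro F
    rw [hd, sum_count]
    refine Finset.sum_congr rfl fun r hr => ?_
    split_ifs with h
    · rw [(hv₃ r (Finset.mem_range.1 hr) h).2]
    · rfl
  have hab' : a' ≤ b' := sample_rank_le (n := fun r => ν₂ (P + 2 * r + 1)) (m := m)
    (S := fun r => 0 < ν₂ (f + 4 * m + r)) (p := Kept ν₂ P (f + 4 * m)) hab
    (by rwa [Finset.sum_congr rfl fun r hr => hn₂ r (Finset.mem_range.1 hr)]) hS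
    (fun r => Iff.rfl) ha' hb'
  have hB₃ : ∀ r < m, Kept ν₂ P (f + 4 * m) r → ∀ j, 2 * j + 1 < ν₂ (P + 2 * r + 1) →
      rowItem A col ν₃ (f + 5 * m) g (2 * s) (Nat.count (Kept ν₂ P (f + 4 * m)) r) j =
        rowItem A col μ P g s r (2 * j + 1) := by
    intro r hr hk j hj
    obtain ⟨e1, e2⟩ := hv₃ r hr hk
    rw [hn₂ r hr] at hj
    obtain ⟨h1, h2⟩ := hpos r hr _ hj
    -- The sample is never copied: taking every second item is doubling the stride.
    have e3 : (j + 1) * (2 * s) = (2 * j + 1 + 1) * s := by ring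
    rw [rowItem, rowItem, e1, hrow₂ r hr, e3]
    rw [column_congr fun h => hμ₃ _ (by have := hg h; omega)]
  have hin : CoreInput w A col d a' b' (2 * s) (f + 5 * m) g (f + 7 * m + 1) Z ν₃ := by
    have hex : ∀ x < d, ∃ r < m, Kept ν₂ P (f + 4 * m) r ∧
        Nat.count (Kept ν₂ P (f + 4 * m)) r = x := fun x hx => exists_count_eq _ (hd ▸ hx)
    refine ⟨hab', ?_, fun _ x hx => ?_, fun x x' hxx' hx' => ?_, fun x hx j j' hj hj' => ?_, by omega,
      by omega, fun h => (hg h).trans (by omega), fun x hx => ?_, ?_, ?_, hwZ, ?_⟩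
    · rw [hsumd (fun x => x)]; exact min_le_right _ _
    · obtain ⟨r, hr, hk, rfl⟩ := hex x hx
      rw [(hv₃ r hr hk).2]
      have := hk.2; omega
    · obtain ⟨r, hr, hk, rfl⟩ := hex x (by omega)
      obtain ⟨r', hr', hk', rfl⟩ := hex x' hx'
      rw [(hv₃ r hr hk).1, (hv₃ r' hr' hk').1, hrow₂ r hr, hrow₂ r' hr']
      refine hrow r r' ?_ hr'
      by_contra! h
      exact absurd (Nat.count_monotone _ h) hxx'.not_ge
    · obtain ⟨r, hr, hk, rfl⟩ := hex x hx
      rw [(hv₃ r hr hk).2] at hj'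
      rw [hB₃ r hr hk j (by omega), hB₃ r hr hk j' (by omega)]
      rw [hn₂ r hr] at hj'
      exact hB r hr _ _ (by omega) (by omega)
    · obtain ⟨r, hr, hk, rfl⟩ := hex x hx
      rw [(hv₃ r hr hk).2, hn₂ r hr, ← mul_assoc]
      exact (Nat.mul_le_mul_right s (Nat.div_mul_le_self _ 2)).trans (hZ r hr)
    · calc 2 * s * b' = s * (b' * 2) := by ring
        _ ≤ s * b := Nat.mul_le_mul_left s (by omega)
        _ ≤ Z := hbs
    -- The product falls by at least `m + b + 1` per level, which covers the `7 * m + 1` cells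
    -- occupied before the recursive call.
    · have h1 : (d + b' + 1) * (b' + 1) ≤ (m + b + 1) * b := Nat.mul_le_mul (by omega) (by omega)
      have h2 : (m + b + 1) * (b + 1) = (m + b + 1) * b + (m + b + 1) := by ring
      omega
    · rw [hsumd (fun x => x)]
      refine (Finset.sum_le_sum fun r hr => ?_).trans_lt hsum
      rw [hn₂ r (Finset.mem_range.1 hr)]
      split_ifs <;> omega
  obtain ⟨ν₄, v₄, t₄, hr₄, hs₁, hs₂, hν₄, ht₄, ht₄'⟩ := ih (by omega) hin
  refine wp_call _ ?_ ⟨ν₄, v₄, t₄, hr₄, ?_⟩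
  · simp (disch := omega) only [List.map_cons, List.map_nil, eval_add, eval_mul, eval_ofNat,
      eval_reg, List.getD_cons_succ, List.getD_cons_zero, Nat.mod_eq_of_lt, ne_eq, eval_min,
      eval_sub, eval_div, eval_mem, update_self,
      Nat.reduceEqDiff, not_false_eq_true, update_of_ne]
    rw [show f + 7 * m = f + 5 * m + 2 * m by omega, hN₃]
  have hν₄₂ : ∀ x < f + 5 * m, ν₄ x = ν₂ x := fun x hx => by rw [hν₄ x (by omega), hν₃ x hx]
  have hμ₄ : ∀ x < f, ν₄ x = μ x := fun x hx => by rw [hν₄₂ x (by omega), hμ₂ x hx]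
  have hn₄ : ∀ r < m, ν₄ (P + 2 * r + 1) = μ (P + 2 * r + 1) := fun r hr => hμ₄ _ (by omega)
  have hrow₄ : ∀ r < m, ν₄ (P + 2 * r) = μ (P + 2 * r) := fun r hr => hμ₄ _ (by omega)
  have hk₄ : ∀ r < m, Kept ν₂ P (f + 4 * m) r ↔ Kept ν₄ P (f + 4 * m) r := fun r hr => by
    rw [Kept, Kept, hν₄₂ _ (by omega), hν₄₂ _ (by omega)]
  have hc₄ := count_congr hk₄
  rw [hd] at hdm hs₁ hs₂
  rw [hc₄ m le_rfl] at hdm hs₁ hs₂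
  have hS₄ : ∀ r < m, ν₄ (f + 4 * m + r) = ν₂ (f + 4 * m + r) := fun r hr => hν₄₂ _ (by omega)
  -- Row numbers make items of different rows different, so the two selections from the sample are
  -- nested and the windows are well formed.
  have hL := Selects.mono (fun x hx x' hx' j j' h => by
    have h := (Prod.ext_iff.1 (toLex_inj.1 h)).2
    simp only at h
    by_contra hne
    rw [← hc₄ m le_rfl, ← hd] at hx hx'
    rcases lt_or_gt_of_ne hne with h' | h'
    · exact (hin.hrow _ _ h' hx').ne h
    · exact (hin.hrow _ _ h' hx).ne' h) hs₁ hs₂ hab'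
  set lo := candLo ν₄ P (f + 4 * m) (f + 7 * m + 1) with hlo
  set hi := candHi ν₄ P (f + 4 * m) (f + 7 * m + 1) with hhi
  obtain ⟨hlohi, hhin, hlosum, hosum, hbhi, hole, hfin⟩ := sample_bounds (a := a) (b := b)
    (n := fun r => ν₄ (P + 2 * r + 1))
    (S := fun r => 0 < ν₄ (f + 4 * m + r)) (p := Kept ν₄ P (f + 4 * m)) (lo := lo) (hi := hi)
    (B := rowItem A col μ P g s)
    (fun i hi j j' hj hj' => hB i hi j j' hj (by rwa [hn₄ i hi] at hj'))
    (fun i hi => by rw [hn₄ i hi]; exact hn i hi)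
    (by rwa [Finset.sum_congr rfl fun r hr => hn₄ r (Finset.mem_range.1 hr)])
    (by rw [← hS]; exact Finset.sum_congr rfl fun r hr => by rw [hS₄ r (Finset.mem_range.1 hr)])
    (fun i hi i' hi' h h' => hS' i hi i' hi' (by rwa [hS₄ i hi] at h) (by rwa [hS₄ i' hi'] at h'))
    (fun r => Iff.rfl)
    (fun r hr hk => by
      rw [← hc₄ r hr.le, (hv₃ r hr ((hk₄ r hr).2 hk)).2, hn₄ r hr, hn₂ r hr])
    (fun r hr hk j hj => by
      rw [← hc₄ r hr.le, hB₃ r hr ((hk₄ r hr).2 hk) j (by rwa [hn₂ r hr, ← hn₄ r hr])])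
    ha' (by
      rw [hb', hN']
      congr 1
      refine Finset.sum_congr rfl fun r hr => ?_
      have hr := Finset.mem_range.1 hr
      simp only [hk₄ r hr, hn₂ r hr, hn₄ r hr])
    hs₁ hs₂ hL
    (by
      funext r
      simp only [hlo, candLo, spread]
      split_ifs <;> rfl)
    (by
      funext r
      simp only [hhi, candHi, spread]
      split_ifs <;> rfl)
  set o := offset lo hi with ho
  have hob : o m ≤ b - a + 3 * m + 1 := by omega
  -- the candidates
  obtain ⟨ν₅, c, t₅, hr₅, hc, hv₅, hT₅, hν₅, ht₅⟩ := candidates_spec (w := w) (A := A) col (m := m)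
    (s := s) (P := P) (g := g) (f := f) (F := f + 4 * m) (G := f + 7 * m + 1) (T := f + 9 * m + 1)
    (Z := Z) (μ := ν₄) hlo hhi ho hPf (by omega) (by omega) (by omega) (by omega) (by omega)
    (fun r hr hk => by
      have h1 := hs₁.1 _ (count_lt_count hr hk)
      have h2 := hs₂.1 _ (count_lt_count hr hk)
      have h3 := (hv₃ r hr ((hk₄ r hr).2 hk)).2
      rw [hc₄ r hr.le, hn₂ r hr] at h3
      have h4 := hZ r hr
      have h5 := Nat.le_mul_of_pos_right (μ (P + 2 * r + 1)) hs
      simp only [h3] at h1 h2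
      constructor <;> omega)
    (fun r hr => (Nat.mul_le_mul_right s ((hhin r hr).trans_eq (hn₄ r hr))).trans (hZ r hr)) hs hg
    (by omega)
  rw [wp_block_cons]
  refine wp_run _ ?_ ⟨ν₅, c, t₅, hr₅, ?_⟩
  · simp (disch := omega) only [List.map_cons, List.map_nil, eval_add, eval_mul, eval_ofNat,
      eval_reg, List.getD_cons_succ, List.getD_cons_zero, Nat.mod_eq_of_lt, ne_eq, eval_min,
      eval_sub, eval_div, eval_mem, update_self,
      Nat.reduceEqDiff, not_false_eq_true, update_of_ne]
  rw [wp_block_cons, wp_set]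
  subst hc
  -- their marks
  obtain ⟨ν₆, v₆, t₆, hr₆, hm₆, hν₆, ht₆⟩ := mark_spec (w := w) (A := A) (T := f + 9 * m + 1)
    (n := o m) (K := a - 2 * a') (f := f + 9 * m + 1 + 2 * o m) (μ := ν₅) (by omega) (by omega)
    (by omega)
  rw [wp_block_cons]
  refine wp_run _ ?_ ⟨ν₆, v₆, t₆, hr₆, ?_⟩
  · simp (disch := omega) only [List.map_cons, List.map_nil, eval_add, eval_mul, eval_ofNat,
      eval_reg, List.getD_cons_succ, List.getD_cons_zero, Nat.mod_eq_of_lt, ne_eq, eval_min,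
      eval_sub, eval_div, eval_mem, update_self,
      Nat.reduceEqDiff, not_false_eq_true, update_of_ne]
    rw [ha']
  obtain ⟨ν₇, v₇, t₇, hr₇, hm₇, hν₇, ht₇⟩ := mark_spec (w := w) (A := A) (T := f + 9 * m + 1)
    (n := o m) (K := b - 2 * a') (f := f + 9 * m + 1 + 3 * o m) (μ := ν₆) (by omega) (by omega)
    (by omega)
  rw [wp_block_cons]
  refine wp_run _ ?_ ⟨ν₇, v₇, t₇, hr₇, ?_⟩
  · simp (disch := omega) only [List.map_cons, List.map_nil, eval_add, eval_mul, eval_ofNat,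
      eval_reg, List.getD_cons_succ, List.getD_cons_zero, Nat.mod_eq_of_lt, ne_eq, eval_min,
      eval_sub, eval_div, eval_mem, update_self,
      Nat.reduceEqDiff, not_false_eq_true, update_of_ne]
    rw [ha']
  have hhiw : ∀ r < m, hi r + 4 < 2 ^ w := fun r hr => by
    have h1 := (hhin r hr).trans_eq (hn₄ r hr)
    have h4 := hZ r hr
    have h5 := Nat.le_mul_of_pos_right (μ (P + 2 * r + 1)) hs
    omega
  have hF₇ : ∀ y < o m, ν₇ (f + 9 * m + 1 + 2 * o m + y) = ν₆ (f + 9 * m + 1 + 2 * o m + y) :=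
    fun y hy => hν₇ _ (by omega)
  obtain ⟨ν₈, v₈, t₈, hr₈, hv₈, hν₈, ht₈⟩ := counts_spec (w := w) (A := A) (m := m) (f := f)
    (F := f + 9 * m + 1 + 2 * o m) (G := f + 9 * m + 1 + 3 * o m) (μ := ν₇) ho
    (fun r hr => by
      rw [hν₇ _ (by omega), hν₆ _ (by omega), hν₇ _ (by omega), hν₆ _ (by omega)]
      exact hv₅ r hr)
    hlohi hhiw (by omega) (by omega) (by omega) (by omega)
    (fun y hy => by rw [hF₇ y hy]; exact hm₆.1 y hy) (fun y hy => hm₇.1 y hy)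
  rw [wp_block_cons]
  refine wp_run _ ?_ ⟨ν₈, v₈, t₈, hr₈, ?_⟩
  · simp (disch := omega) only [List.map_cons, List.map_nil, eval_add, eval_mul, eval_ofNat,
      eval_reg, List.getD_cons_succ, List.getD_cons_zero, Nat.mod_eq_of_lt, ne_eq, eval_min,
      eval_sub, eval_div, eval_mem, update_self,
      Nat.reduceEqDiff, not_false_eq_true, update_of_ne]
  rw [wp_block_nil]
  -- Needed for the time bound: the drop of the potentials by `m` also absorbs the constant costs of
  -- a level.
  have hm1 : 1 ≤ m := by
    by_contra! h
    obtain rfl : m = 0 := by omega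
    simp at hb; omega
  have hdb : d ≤ b := by
    have := count_le_sum_marks (n := fun r => ν₂ (P + 2 * r + 1)) (m := m)
      (S := fun r => 0 < ν₂ (f + 4 * m + r)) (p := Kept ν₂ P (f + 4 * m)) (fun r => Iff.rfl)
    omega
  have hlog : ∑ x ∈ Finset.range d, (1 + Nat.log 2 (ν₃ (f + 5 * m + 2 * x + 1))) + m ≤
      ∑ r ∈ Finset.range m, (1 + Nat.log 2 (μ (P + 2 * r + 1))) := by
    have e : ∑ r ∈ Finset.range m, (1 + Nat.log 2 (μ (P + 2 * r + 1))) =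
        ∑ r ∈ Finset.range m, (1 + Nat.log 2 (ν₂ (P + 2 * r + 1))) :=
      Finset.sum_congr rfl fun r hr => by rw [hn₂ r (Finset.mem_range.1 hr)]
    rw [hsumd (fun x => 1 + Nat.log 2 x), e]
    exact sum_log_half_le (p := Kept ν₂ P (f + 4 * m)) fun r hr h => h.2
  have hbb : b' ≤ b / 2 := min_le_left _ _
  have hbba : 2 * (b' - a') ≤ b - a + m + 1 := by omega
  have hB₄ : ∀ i < m, ∀ j j', j ≤ j' → j' < ν₄ (P + 2 * i + 1) →
      rowItem A col μ P g s i j ≤ rowItem A col μ P g s i j' :=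
    fun i hi j j' hj hj' => hB i hi j j' hj (by rwa [hn₄ i hi] at hj')
  have hκ : ∀ ν : ℕ → ℕ, (∀ x < f + 9 * m + 1 + 2 * o m, ν x = ν₅ x) → ∀ i < m, ∀ x < hi i - lo i,
      ∀ i' < m, ∀ x' < hi i' - lo i',
      key A ν (f + 9 * m + 1) (o i + x) < key A ν (f + 9 * m + 1) (o i' + x') →
      rowItem A col μ P g s i (lo i + x) ≤ rowItem A col μ P g s i' (lo i' + x') := by
    intro ν hν i hi' x hx i' hi'' x' hx' hlt
    have e : ∀ i < m, ∀ x < hi i - lo i, ν (f + 9 * m + 1 + 2 * (o i + x)) = μ (P + 2 * i) ∧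
        ν (f + 9 * m + 1 + 2 * (o i + x) + 1) = column col μ g ((lo i + x + 1) * s - 1) := by
      intro i hi' x hx
      have h1 := offset_add_lt hi' hx
      rw [← ho] at h1
      have h2 := (hhin i hi').trans_eq (hn₄ i hi')
      obtain ⟨h3, h4⟩ := hpos i hi' (lo i + x) (by omega)
      rw [hν _ (by omega), hν _ (by omega), (hT₅ i hi' x hx).1, (hT₅ i hi' x hx).2, hrow₄ i hi']
      exact ⟨rfl, column_congr fun h => hμ₄ _ (by have := hg h; omega)⟩
    refine rowItem_le_of_key_lt hlt (e i hi' x hx).1 (e i hi' x hx).2 (e i' hi'' x' hx').1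
      (e i' hi'' x' hx').2 fun hy => ?_
    by_contra! hr
    have hii : i' < i := by
      by_contra! h
      rcases h.lt_or_eq with h | h
      · exact absurd (hrow i i' h hi'') hr.not_gt
      · rw [h] at hr; exact lt_irrefl _ hr
    have h1 : o (i' + 1) ≤ o i := offset_mono _ _ hii
    have h2 : o (i' + 1) = o i' + (hi i' - lo i') := offset_succ ..
    omega
  obtain ⟨ha1, ha2, ha3, ha4⟩ := selection_of_marks hB₄ hhin hlohi
    (hm₆ : Marks _ (o m) _ _) (hκ ν₅ fun x _ => rfl)
    (K := fun r => ν₈ (f + 2 * r)) (fun r hr => by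
      rw [(hv₈ r hr).1]
      congr 1
      refine Finset.sum_congr rfl fun x hx => hF₇ _ (offset_add_lt hr (Finset.mem_range.1 hx)))
  obtain ⟨hb1, hb2, hb3, hb4⟩ := selection_of_marks hB₄ hhin hlohi
    (hm₇ : Marks _ (o m) _ _) (hκ ν₆ fun x hx => hν₆ x hx)
    (K := fun r => ν₈ (f + 2 * r + 1)) (fun r hr => (hv₈ r hr).2)
  refine ⟨(hfin a le_rfl hab _ ha1 ha2 (by rw [ha3, hlosum]; omega) ha4).congr_length
      fun r hr => (hn₄ r hr).symm,
    (hfin b hab le_rfl _ hb1 hb2 (by rw [hb3, hlosum]; omega) hb4).congr_length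
      fun r hr => (hn₄ r hr).symm, fun x hx => ?_, ?_, ?_⟩
  · rw [hν₈ x hx, hν₇ x (by omega), hν₆ x (by omega), hν₅ x hx, hμ₄ x hx]
  · simp only [List.map_cons, List.map_nil, List.sum_cons, List.sum_nil, cost_mem, cost_add, cost_sub, cost_mul,
      cost_div, cost_min, cost_lt, cost_reg, cost_ofNat]
    omega
  · simp only [List.map_cons, List.map_nil, List.sum_cons, List.sum_nil, cost_mem, cost_add, cost_sub, cost_mul,
      cost_div, cost_min, cost_lt, cost_reg, cost_ofNat]
    omega

theorem core_spec {col : Bool} {m a b s P g f Z : ℕ} {μ : ℕ → ℕ}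
    (h : CoreInput w A col m a b s P g f Z μ) : CoreSpec w A col m a b s P g f μ := by
  induction b using Nat.strong_induction_on generalizing m a s P g f Z μ with
  | _ b ih =>
    rcases b.eq_zero_or_pos with rfl | hb
    · obtain rfl : a = 0 := Nat.le_zero.1 h.hab
      have := h.hw
      exact core_spec_zero col (by omega)
    · exact core_spec_succ h hb fun hb' h' => ih _ hb' h'

end Core

end MatRAM

/-! ### The procedures Mat-Select₁ and Mat-Select₃ -/

namespace MatRAM

open Function

section MatSel

variable {α : Type u} [LinearOrder α] {w : ℕ} {A : ℕ → ℕ → α}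

/-- The length of the row with the number in register `4`. -/
def lengthExpr (col : Bool) : Expr := if col then .reg 1 else .mem (.reg 2 + .reg 4)

/-- Selection of the `k` smallest items of a matrix with `m` rows. The arguments are `m`, `k`, the
address of the list of columns or of the list of lengths, and the address of the result. -/
def matSel (col : Bool) : Cmd :=
  .block [
    .for 4 (.reg 0) (.block [
      .store (.reg 3 + .reg 0 + 2 * .reg 4) (.reg 4),
      .store (.reg 3 + .reg 0 + 2 * .reg 4 + 1) (lengthExpr col)]),
    .run (core col) [.reg 0, .reg 1, .reg 1, 1, .reg 3 + .reg 0, .reg 2, .reg 3 + 3 * .reg 0] 5,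
    .for 4 (.reg 0) (.store (.reg 3 + .reg 4) (.mem (.reg 3 + 3 * .reg 0 + 2 * .reg 4)))]

/-- The items of a matrix, in an order in which items of different rows are different. -/
def tagged (B : ℕ → ℕ → α) (i j : ℕ) : α ×ₗ ℕ := toLex (B i j, i)

/-- `core` is started with both ranks equal to `k` and stride 1, so the initial gap is 0 and only
the potentials remain in the two time bounds. The result is exact for the tie-broken order, which
the analysis of Mat-Select₄ uses. -/
theorem matSel_spec (col : Bool) {m k g f Z : ℕ} {n μ : ℕ → ℕ}
    (hlen : ∀ r < m, n r = if col then k else μ (g + r)) (hk : k ≤ ∑ r ∈ Finset.range m, n r)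
    (hn : 0 < k → ∀ r < m, 1 ≤ n r)
    (hB : ∀ i < m, ∀ j j', j ≤ j' → j' < n i → A i (column col μ g j) ≤ A i (column col μ g j'))
    (hg : col → g + Z ≤ f) (hgm : col = false → g + m ≤ f) (hZ : ∀ r < m, n r ≤ Z) (hkZ : k ≤ Z)
    (hw : f + 3 * m + 100 * ((m + k + 1) * (k + 1)) + 100 < 2 ^ w) (hwZ : 2 * Z + g + 4 < 2 ^ w)
    (hgw : col = false → g + m < 2 ^ w)
    (hsum : ∑ r ∈ Finset.range m, n r < 2 ^ w) :
    ∃ ν v t, Returns w A (matSel col) [m, k, g, f] μ ν v t ∧ ((∀ x < f, ν x = μ x) ∧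
      Selects m n (tagged fun i j => A i (column col μ g j)) k (fun i => ν (f + i)) ∧
      t ≤ 2000000 + 3000000 * (m + 2 * k) ∧
      t ≤ 2000000 + 3000000 * ∑ r ∈ Finset.range m, (1 + Nat.log 2 (n r))) := by
  have hw' : f + 3 * m + 100 * (m + k + 1) + 100 < 2 ^ w := by
    have : (m + k + 1) * 1 ≤ (m + k + 1) * (k + 1) := Nat.mul_le_mul_left _ (by omega)
    omega
  refine exists_returns_of_eq (matSel.eq_1 col) (P := fun ν v t => _) ?_
  have f0 : frame [m, k, g, f] = fun r => [m, k, g, f].getD r 0 := rfl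
  rw [wp_block_cons]
  refine wp_for m (fun x R ν t => R = update (frame [m, k, g, f]) 4 x ∧
    (∀ r < x, ν (f + m + 2 * r) = r ∧ ν (f + m + 2 * r + 1) = n r) ∧ (∀ a < f, ν a = μ a) ∧
    t ≤ 100 * x + 2) (by omega) (by omega) ?_ ?_ ?_ ?_
  · simp
  · rintro x _ ν t hx ⟨rfl, -⟩
    simp only [f0, eval_reg, ne_eq, Nat.reduceEqDiff, not_false_eq_true, update_of_ne, update_self,
      List.getD_cons_zero, and_self, OfNat.zero_ne_ofNat]
  · rintro x _ ν t hx ⟨rfl, hv, hν, ht⟩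
    have hl : ∀ ν' : ℕ → ℕ, (∀ a < f, ν' a = μ a) →
        (lengthExpr col).eval w A ⟨update (frame [m, k, g, f]) 4 x, ν'⟩ = n x := by
      intro ν' hν'
      rw [hlen x hx, lengthExpr]
      cases col with
      | true => rfl
      | false =>
        have h1 := hgm rfl
        have h2 := hgw rfl
        simp (disch := omega) only [f0, Bool.false_eq_true, if_false, eval_mem, eval_add, eval_reg, ne_eq,
          Nat.reduceEqDiff, not_false_eq_true, update_of_ne, update_self, List.getD_cons_succ,
          List.getD_cons_zero, Nat.mod_eq_of_lt]
        exact hν' _ (by omega)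
    have hc : (lengthExpr col).cost ≤ 4 := by
      rw [lengthExpr]; split_ifs <;> simp
    have hnx := hZ x hx
    rw [wp_block_cons, wp_store, wp_block_cons, wp_store, wp_block_nil]
    rw [hl _ (fun a ha => by
      simp (disch := omega) only [f0, eval_add, eval_mul, eval_ofNat, eval_reg, ne_eq, Nat.reduceEqDiff,
        not_false_eq_true, update_of_ne, update_self, List.getD_cons_succ, List.getD_cons_zero,
        OfNat.zero_ne_ofNat, Nat.mod_eq_of_lt, hν])]
    simp (disch := omega) only [f0, eval_add, eval_mul, eval_ofNat, eval_reg, ne_eq, Nat.reduceEqDiff,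
        not_false_eq_true, update_of_ne, update_self, List.getD_cons_succ, List.getD_cons_zero,
        OfNat.zero_ne_ofNat, Nat.mod_eq_of_lt, update_idem, true_and, cost_add, cost_mul,
        cost_ofNat, cost_reg]
    refine ⟨fun r hr => ?_, fun a ha => ?_, by omega⟩
    · rcases Nat.lt_succ_iff_lt_or_eq.1 hr with h | rfl
      · simp (disch := omega) only [update_of_ne]; exact hv r h
      · simp (disch := omega) only [update_of_ne, update_self, and_self]
    · simp (disch := omega) only [update_of_ne]; exact hν a ha
  rintro _ ν t ⟨rfl, hv, hν, ht⟩
  have hcol : ∀ j < Z, column col ν g j = column col μ g j := fun j hj =>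
    column_congr fun h => hν _ (by have := hg h; omega)
  have hrow : ∀ r < m, ∀ j < n r, rowItem A col ν (f + m) g 1 r j =
      tagged (fun i j => A i (column col μ g j)) r j := by
    intro r hr j hj
    have := hZ r hr
    rw [rowItem, tagged, (hv r hr).1, mul_one, Nat.add_sub_cancel, hcol j (by omega)]
  have hsumn : ∑ r ∈ Finset.range m, ν (f + m + 2 * r + 1) = ∑ r ∈ Finset.range m, n r :=
    Finset.sum_congr rfl fun r hr => (hv r (Finset.mem_range.1 hr)).2
  have hsorted : ∀ r < m, ∀ j j', j ≤ j' → j' < n r →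
      tagged (fun i j => A i (column col μ g j)) r j ≤
        tagged (fun i j => A i (column col μ g j)) r j' := by
    intro r hr j j' hj hj'
    rw [tagged, tagged, Prod.Lex.toLex_le_toLex']
    exact ⟨hB r hr j j' hj hj', fun _ => le_rfl⟩
  obtain ⟨ν', v', t', hr', hs, -, hν', ht₁, ht₂⟩ := core_spec (w := w) (A := A) (col := col) (m := m)
    (a := k) (b := k) (s := 1) (P := f + m) (g := g) (f := f + 3 * m) (Z := Z) (μ := ν) {
      hab := le_rfl
      hb := hsumn ▸ hk
      hn := fun h r hr => (hv r hr).2 ▸ hn h r hr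
      hrow := fun r r' h h' => by rw [(hv r (h.trans h')).1, (hv r' h').1]; exact h
      hB := fun r hr j j' hj hj' => by
        rw [(hv r hr).2] at hj'
        rw [hrow r hr j (by omega), hrow r hr j' hj']
        exact hsorted r hr j j' hj hj'
      hPf := by omega
      hs := le_rfl
      hg := fun h => (hg h).trans (by omega)
      hZ := fun r hr => by rw [(hv r hr).2, mul_one]; exact hZ r hr
      hbs := by rw [one_mul]; exact hkZ
      hw := hw
      hwZ := hwZ
      hsum := hsumn ▸ hsum }
  rw [wp_block_cons]
  refine wp_run _ ?_ ⟨ν', v', t', hr', ?_⟩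
  · simp (disch := omega) only [f0, List.map_cons, List.map_nil, eval_add, eval_mul, eval_ofNat,
      eval_reg, List.getD_cons_succ, List.getD_cons_zero, Nat.mod_eq_of_lt, ne_eq,
      Nat.reduceEqDiff, not_false_eq_true, update_of_ne]
  rw [wp_block_cons]
  refine wp_for_store m f (fun x => ν' (f + 3 * m + 2 * x)) (by omega) (by omega) (fun x ν => ?_)
    ?_ ?_
  · simp (disch := omega) only [f0, eval_reg, List.getD_cons_zero, ne_eq,
      Nat.reduceEqDiff, not_false_eq_true, update_of_ne]
  · intro x hx ν'' hν''
    simp (disch := omega) only [f0, eval_mem, eval_add, eval_mul, eval_ofNat,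
      eval_reg, List.getD_cons_succ, List.getD_cons_zero, Nat.mod_eq_of_lt, ne_eq,
      Nat.reduceEqDiff, not_false_eq_true, update_of_ne, update_self, true_and]
    exact hν'' _ (by omega)
  intro ν'' hv'' hν''
  rw [wp_block_nil]
  have hm : m ≤ ∑ r ∈ Finset.range m, (1 + Nat.log 2 (n r)) := by
    rw [Finset.sum_add_distrib]; simp
  have hlog : ∑ r ∈ Finset.range m, (1 + Nat.log 2 (ν (f + m + 2 * r + 1))) =
      ∑ r ∈ Finset.range m, (1 + Nat.log 2 (n r)) :=
    Finset.sum_congr rfl fun r hr => by rw [(hv r (Finset.mem_range.1 hr)).2]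
  rw [hlog] at ht₂
  refine ⟨fun x hx => ?_, ?_, ?_, ?_⟩
  · rw [hν'' x (Or.inl hx), hν' x (by omega), hν x hx]
  · have h1 : ∀ i < m, ν' (f + 3 * m + 2 * i) ≤ n i := fun i hi => (hs.1 i hi).trans_eq (hv i hi).2
    refine ⟨fun i hi => (hv'' i hi).trans_le (h1 i hi), ?_, fun i hi j hj i' hi' j' hj' hj'' => ?_⟩
    · rw [← hs.2.1]
      exact Finset.sum_congr rfl fun i hi => hv'' i (Finset.mem_range.1 hi)
    · simp only [hv'' i hi] at hj
      simp only [hv'' i' hi'] at hj'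
      rw [← hrow i hi j (hj.trans_le (h1 i hi)), ← hrow i' hi' j' hj'']
      exact hs.2.2 i hi j hj i' hi' j' hj' (hj''.trans_eq (hv i' hi').2.symm)
  · simp only [List.map_cons, List.map_nil, List.sum_cons, List.sum_nil, cost_mem, cost_add, cost_mul,
      cost_reg, cost_ofNat]
    omega
  · simp only [List.map_cons, List.map_nil, List.sum_cons, List.sum_nil, cost_mem, cost_add, cost_mul,
      cost_reg, cost_ofNat]
    omega

/-- Everything needed is at most quadratic in `X`, and `X ^ 10 ≥ 3 ^ 8 * X ^ 2` leaves room for all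
constants. -/
theorem word_bound {X Y Z g w c : ℕ} (hX : 3 ≤ X) (hY : Y ≤ X) (hZ : Z ≤ X) (hg : g ≤ X)
    (hc : 10 ≤ c) (hw : X ^ c ≤ 2 ^ w) {a b : ℕ} (ha : a ≤ X) (hb : b ≤ X) :
    Y + 3 * Z + 100 * (a * b) + 100 < 2 ^ w ∧ 2 * Z + g + 4 < 2 ^ w ∧ X < 2 ^ w := by
  have h0 : X ^ 10 ≤ 2 ^ w := (Nat.pow_le_pow_right (by omega) hc).trans hw
  have h1 : a * b ≤ X ^ 2 := by rw [sq]; exact Nat.mul_le_mul ha hb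
  have h2 : 3 ^ 8 * X ^ 2 ≤ X ^ 8 * X ^ 2 := Nat.mul_le_mul_right _ (Nat.pow_le_pow_left hX _)
  have h3 : 3 * X ≤ X ^ 2 := by rw [sq]; exact Nat.mul_le_mul_right _ hX
  rw [← pow_add] at h2
  norm_num at h2
  omega

/-- Mat-Select₁ selects the smallest items with respect to the order of `tagged`. -/
theorem matSel_true_spec {m k g f : ℕ} {μ : ℕ → ℕ} (hm : 0 < m)
    (hw : (m + k + g + f + 2) ^ 10 ≤ 2 ^ w) (hg : g + k ≤ f)
    (hA : RowSorted m (fun _ => k) (fun i j => A i (μ (g + j)))) :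
    ∃ ν t, Runs w A (matSel true) [m, k, g, f] μ ν t ∧ (∀ a < f, ν a = μ a) ∧
      Selects m (fun _ => k) (tagged fun i j => A i (μ (g + j))) k (fun i => ν (f + i)) ∧
      t ≤ 8000000 * (m + k) := by
  obtain ⟨h1, h2, h3⟩ := word_bound (X := m + k + g + f + 2) (Y := f) (Z := m) (g := g)
    (a := m + k + 1) (b := k + 1) (by omega) (by omega) (by omega) (by omega) le_rfl hw (by omega)
    (by omega)
  obtain ⟨-, h4, -⟩ := word_bound (X := m + k + g + f + 2) (Y := f) (Z := k) (g := g)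
    (a := m + k + 1) (b := k + 1) (by omega) (by omega) (by omega) (by omega) le_rfl hw (by omega)
    (by omega)
  have hmk : ∑ _r ∈ Finset.range m, k = m * k := by simp
  have h5 : m * k < 2 ^ w := by
    have : m * k ≤ (m + k + 1) * (k + 1) := Nat.mul_le_mul (by omega) (by omega)
    omega
  obtain ⟨ν, v, t, hr, hν, hs, ht, -⟩ := matSel_spec (w := w) (A := A) true (m := m) (k := k)
    (g := g) (f := f) (Z := k) (n := fun _ => k) (μ := μ) (fun r hr => rfl)
    (by rw [hmk]; exact Nat.le_mul_of_pos_left k hm) (fun h _ _ => h)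
    (fun i hi j j' hj hj' => hA i hi j j' hj (Nat.cast_lt.2 hj')) (fun _ => hg)
    (fun h => by simp at h) (fun _ _ => le_rfl) le_rfl h1 h4 (fun h => by simp at h) (by rwa [hmk])
  exact ⟨ν, t, hr.runs, hν, hs, by omega⟩

/-- Mat-Select₃ selects the smallest items with respect to the order of `tagged`. -/
theorem matSel_false_spec {m k g f : ℕ} {n μ : ℕ → ℕ} (hm : 0 < m)
    (hw : (m + k + ∑ i ∈ Finset.range m, n i + g + f + 2) ^ 10 ≤ 2 ^ w) (hg : g + m ≤ f)
    (hμ : ∀ i < m, μ (g + i) = n i) (hn : ∀ i < m, 1 ≤ n i) (hk : k ≤ ∑ i ∈ Finset.range m, n i)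
    (hA : RowSorted m (fun i => n i) A) :
    ∃ ν t, Runs w A (matSel false) [m, k, g, f] μ ν t ∧ (∀ a < f, ν a = μ a) ∧
      Selects m n (tagged A) k (fun i => ν (f + i)) ∧
      t ≤ 5000000 * ∑ i ∈ Finset.range m, (1 + Nat.log 2 (n i)) := by
  obtain ⟨h1, -, h3⟩ := word_bound (X := m + k + ∑ i ∈ Finset.range m, n i + g + f + 2) (Y := f)
    (Z := m) (g := g) (a := m + k + 1) (b := k + 1) (by omega) (by omega) (by omega) (by omega)
    le_rfl hw (by omega) (by omega)
  obtain ⟨-, h4, -⟩ := word_bound (X := m + k + ∑ i ∈ Finset.range m, n i + g + f + 2) (Y := f)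
    (Z := ∑ i ∈ Finset.range m, n i) (g := g) (a := m + k + 1) (b := k + 1) (by omega) (by omega)
    (by omega) (by omega) le_rfl hw (by omega) (by omega)
  obtain ⟨ν, v, t, hr, hν, hs, -, ht⟩ := matSel_spec (w := w) (A := A) false (m := m) (k := k)
    (g := g) (f := f) (Z := ∑ i ∈ Finset.range m, n i) (n := n) (μ := μ) (fun r hr => (hμ r hr).symm)
    hk (fun _ => hn) (fun i hi j j' hj hj' => hA i hi j j' hj (Nat.cast_lt.2 hj'))
    (fun h => by simp at h) (fun _ => hg)
    (fun r hr => Finset.single_le_sum (fun _ _ => Nat.zero_le _) (Finset.mem_range.2 hr)) hk h1 h4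
    (fun _ => by omega) (by omega)
  refine ⟨ν, t, hr.runs, hν, hs, ?_⟩
  have : 1 ≤ ∑ i ∈ Finset.range m, (1 + Nat.log 2 (n i)) := by
    rw [Finset.sum_add_distrib]; simp; omega
  omega

theorem Selects.of_tagged {m k : ℕ} {n K : ℕ → ℕ} {B : ℕ → ℕ → α}
    (h : Selects m n (tagged B) k K) : Selects m n B k K :=
  ⟨h.1, h.2.1, fun i hi j hj i' hi' j' hj' hj'' =>
    (Prod.Lex.toLex_le_toLex'.1 (h.2.2 i hi j hj i' hi' j' hj' hj'')).1⟩

theorem isMatSelect1_matSel : IsMatSelect1.{u} (matSel true) := by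
  refine ⟨10, 8000000, fun α _ A m k g f w μ hm hw hg _ hA => ?_⟩
  obtain ⟨ν, t, hr, hν, hs, ht⟩ := matSel_true_spec hm hw hg hA
  exact ⟨ν, t, hr, hν, selects_iff.1 hs.of_tagged, ht⟩

theorem isMatSelect3_matSel : IsMatSelect3.{u} (matSel false) := by
  refine ⟨10, 5000000, fun α _ A n m k g f w μ hm hw hg hμ hn hk hA => ?_⟩
  obtain ⟨ν, t, hr, hν, hs, ht⟩ := matSel_false_spec hm hw hg hμ hn hk hA
  refine ⟨ν, t, hr, hν, selects_iff.1 hs.of_tagged, ?_⟩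
  have h1 : (∑ i ∈ Finset.range m, (1 + Nat.log 2 (n i)) : ℕ) ≤
      (m : ℝ) + ∑ i ∈ Finset.range m, Real.logb 2 (n i) := by
    push_cast
    rw [Finset.sum_add_distrib]
    simp only [Finset.sum_const, Finset.card_range, nsmul_eq_mul, mul_one]
    gcongr with i hi
    exact_mod_cast Real.natLog_le_logb (n i) 2
  calc (t : ℝ) ≤ (5000000 * ∑ i ∈ Finset.range m, (1 + Nat.log 2 (n i)) : ℕ) := by exact_mod_cast ht
    _ = 5000000 * ((∑ i ∈ Finset.range m, (1 + Nat.log 2 (n i)) : ℕ) : ℝ) := by push_cast; rfl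
    _ ≤ _ := by push_cast at h1 ⊢; gcongr

end MatSel

end MatRAM

/-! ### Why a stage of Mat-Select₄ succeeds or is cheap -/

namespace MatRAM

open Function

section Stages

variable {β : Type u} [LinearOrder β] {m k l : ℕ} {A : ℕ → ℕ → β} {K L : ℕ → ℕ}

/-- The number of the column of the `j`-th block representative. -/
def repCol (k j : ℕ) : ℕ := min (2 ^ (j + 1) - 2) k

theorem repCol_zero (k : ℕ) : repCol k 0 = 0 := by simp [repCol]

theorem repCol_succ (k j : ℕ) : repCol k (j + 1) = min (2 * repCol k j + 2) k := by
  have := Nat.one_le_two_pow (n := j)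
  simp only [repCol, pow_succ]
  omega

theorem repCol_mono (k : ℕ) : Monotone (repCol k) :=
  monotone_nat_of_le_succ fun j => by
    rw [repCol_succ]
    have : repCol k j ≤ k := min_le_right _ _
    omega

theorem repCol_le (k j : ℕ) : repCol k j ≤ k := min_le_right _ _

/-- This bounds the running time of Mat-Select₃ within a stage: the logarithms of the cut lengths
sum to at most the number of selected representatives. -/
theorem log_repCol_le (k j : ℕ) : Nat.log 2 (repCol k j + 1) ≤ j := by
  refine Nat.lt_succ_iff.1 (Nat.log_lt_of_lt_pow (by omega) ?_)
  have := Nat.one_le_two_pow (n := j)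
  rw [Nat.succ_eq_add_one, repCol, pow_succ]
  omega

/-- The number of block representatives among the first `x` items of a row. -/
def reps (x : ℕ) : ℕ := Nat.log 2 (x + 1)

theorem reps_le (x : ℕ) : reps x ≤ x := by
  refine Nat.lt_succ_iff.1 (Nat.log_lt_of_lt_pow (by omega) ?_)
  exact Nat.lt_two_pow_self

/-- The bridge between items and representatives. Replacing late columns by column `k` is harmless,
as that column is never among the first `x ≤ k`. -/
theorem repCol_lt_iff {x j : ℕ} (hx : x ≤ k) : repCol k j < x ↔ j < reps x := by
  rw [reps, ← Nat.succ_le_iff, ← Nat.succ_le_iff, Nat.le_log_iff_pow_le one_lt_two (by omega),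
    repCol]
  have := Nat.one_le_two_pow (n := j)
  simp only [Nat.succ_eq_add_one, pow_succ]
  omega

theorem le_repCol_reps {x : ℕ} (hx : x ≤ k) : x ≤ repCol k (reps x) :=
  not_lt.1 fun h => lt_irrefl _ ((repCol_lt_iff hx).1 h)

/-- The first `K i` items of the rows `i < m` are the `k` smallest items of a matrix with infinite
rows. -/
def FullSelects (m : ℕ) (B : ℕ → ℕ → β) (k : ℕ) (K : ℕ → ℕ) : Prop :=
  ∑ i ∈ Finset.range m, K i = k ∧
    ∀ i < m, ∀ j < K i, ∀ i' < m, ∀ j', K i' ≤ j' → B i j ≤ B i' j'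

theorem FullSelects.le (h : FullSelects m A k K) {i : ℕ} (hi : i < m) : K i ≤ k :=
  h.1 ▸ Finset.single_le_sum (fun _ _ => Nat.zero_le _) (Finset.mem_range.2 hi)

/-- Greedy: extend a selection by the smallest of the first unselected items. -/
theorem exists_fullSelects (hm : 0 < m) (hA : ∀ i < m, Monotone (A i)) (k : ℕ) :
    ∃ K, FullSelects m A k K := by
  induction k with
  | zero => exact ⟨fun _ => 0, by simp, fun i _ j hj => by simp at hj⟩
  | succ k ih =>
    obtain ⟨K, h1, h2⟩ := ih
    obtain ⟨p, hp, hmin⟩ := Finset.exists_min_image (Finset.range m) (fun i => A i (K i))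
      ⟨0, Finset.mem_range.2 hm⟩
    have hpm := Finset.mem_range.1 hp
    refine ⟨fun i => K i + if i = p then 1 else 0, ?_, fun i hi j hj i' hi' j' hj' => ?_⟩
    · rw [Finset.sum_add_distrib, h1, Finset.sum_ite_eq' _ p, if_pos hp]
    · have hj'' : K i' ≤ j' := le_trans (Nat.le_add_right _ _) hj'
      by_cases hjK : j < K i
      · exact h2 i hi j hjK i' hi' j' hj''
      · obtain rfl : i = p := by by_contra h; simp [h] at hj; exact hjK hj
        obtain rfl : j = K i := by simp at hj; omega
        exact (hmin i' (Finset.mem_range.2 hi')).trans (hA i' hi' hj'')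

theorem tagged_monotone (hA : ∀ i < m, Monotone (A i)) : ∀ i < m, Monotone (tagged A i) :=
  fun i hi _ _ hj => Prod.Lex.toLex_le_toLex'.2 ⟨hA i hi hj, fun _ => le_rfl⟩

/-- The source of all contradictions in exchange arguments: items of different rows are never equal
in the tagged order. -/
theorem tagged_not_le {i i' j j' : ℕ} (h : tagged A i j ≤ tagged A i' j') (hi : i ≠ i') :
    ¬ tagged A i' j' ≤ tagged A i j := fun h' =>
  hi (congrArg (fun x => (ofLex x).2) (le_antisymm h h'))

theorem exists_lt_of_sum_le {x y : ℕ → ℕ} (h : ∑ i ∈ Finset.range m, x i ≤ ∑ i ∈ Finset.range m, y i)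
    {i : ℕ} (hi : i < m) (hlt : y i < x i) : ∃ i' < m, x i' < y i' := by
  by_contra! hle
  exact absurd h (not_le.2 (Finset.sum_lt_sum (fun i' hi' => hle i' (Finset.mem_range.1 hi'))
    ⟨i, Finset.mem_range.2 hi, hlt⟩))

/-- If sufficiently many representatives are selected, then all those among the `k` smallest items
are selected. -/
theorem reps_le_of_selects (hK : FullSelects m (tagged A) k K)
    (hL : Selects m (fun _ => l) (tagged fun i j => A i (repCol k j)) l L)
    (hl : ∑ i ∈ Finset.range m, reps (K i) ≤ l) {i : ℕ} (hi : i < m) : reps (K i) ≤ L i := by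
  by_contra! hlt
  obtain ⟨i', hi', hlt'⟩ := exists_lt_of_sum_le (hl.trans_eq hL.2.1.symm) hi hlt
  have hne : i' ≠ i := by rintro rfl; omega
  have hrl : reps (K i) ≤ l :=
    (Finset.single_le_sum (f := fun i => reps (K i)) (fun _ _ => Nat.zero_le _)
      (Finset.mem_range.2 hi)).trans hl
  have h1 := hL.2.2 i' hi' (L i' - 1) (by omega) i hi (L i) le_rfl (show L i < l by omega)
  refine tagged_not_le h1 hne (hK.2 i hi (repCol k (L i)) ((repCol_lt_iff (hK.le hi)).2 hlt) i' hi'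
    (repCol k (L i' - 1)) ?_)
  exact not_lt.1 fun h => by have := (repCol_lt_iff (hK.le hi')).1 h; omega

/-- Strictness is essential: a row of the true selection never fills its cut row, which is what
`eq_of_selects` needs to exclude any deviation. -/
theorem lt_length_of_selects (hK : FullSelects m (tagged A) k K)
    (hL : Selects m (fun _ => l) (tagged fun i j => A i (repCol k j)) l L)
    (hl : ∑ i ∈ Finset.range m, reps (K i) ≤ l) {i : ℕ} (hi : i < m) :
    K i < repCol k (L i) + 1 :=
  Nat.lt_succ_iff.2 ((le_repCol_reps (hK.le hi)).trans
    (repCol_mono k (reps_le_of_selects hK hL hl hi)))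

/-- The selection from the shortened rows is the selection from the whole matrix unless a row has
been shortened too much. -/
theorem eq_of_selects {K' n : ℕ → ℕ} (hK : FullSelects m (tagged A) k K)
    (hK' : Selects m n (tagged A) k K') (hne : ∃ i < m, K' i ≠ K i) :
    ∃ q < m, K' q < K q ∧ K' q = n q := by
  have hex : (∃ q < m, K' q < K q) ∧ ∃ p < m, K p < K' p := by
    obtain ⟨i, hi, hne⟩ := hne
    rcases lt_or_gt_of_ne hne with h | h
    · exact ⟨⟨i, hi, h⟩, exists_lt_of_sum_le (hK.1.trans hK'.2.1.symm).le hi h⟩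
    · exact ⟨exists_lt_of_sum_le (hK'.2.1.trans hK.1.symm).le hi h, ⟨i, hi, h⟩⟩
  obtain ⟨⟨q, hq, hlt⟩, p, hp, hlt'⟩ := hex
  refine ⟨q, hq, hlt, (hK'.1 q hq).antisymm (not_lt.1 fun h => ?_)⟩
  have hne : p ≠ q := by rintro rfl; omega
  exact tagged_not_le (hK'.2.2 p hp (K' p - 1) (by omega) q hq (K' q) le_rfl h) hne
    (hK.2 q hq (K' q) hlt p hp (K' p - 1) (by omega))

/-- If the result of a stage is not the selection with respect to the order of `tagged`, then it
contains all the selected representatives. -/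
theorem le_sum_reps_of_ne {K' : ℕ → ℕ} (hK : FullSelects m (tagged A) k K)
    (hL : Selects m (fun _ => l) (tagged fun i j => A i (repCol k j)) l L)
    (hK' : Selects m (fun i => repCol k (L i) + 1) (tagged A) k K') (hne : ∃ i < m, K' i ≠ K i) :
    l ≤ ∑ i ∈ Finset.range m, reps (K' i) := by
  obtain ⟨q, hq, hlt, hn⟩ := eq_of_selects hK hK' hne
  rw [← hL.2.1]
  refine Finset.sum_le_sum fun i hi => ?_
  have hi := Finset.mem_range.1 hi
  have hik : K' i ≤ k :=
    hK'.2.1 ▸ Finset.single_le_sum (fun _ _ => Nat.zero_le _) (Finset.mem_range.2 hi)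
  by_contra! h
  -- Otherwise the last selected representative of row `i` is missing from `K'`, whereas row `q` is
  -- taken beyond its unselected representative `L q`. The two selections order this pair in
  -- opposite ways.
  have h1 : K' i ≤ repCol k (L i - 1) :=
    not_lt.1 fun h' => by have := (repCol_lt_iff hik).1 h'; omega
  have h2 : repCol k (L i - 1) ≤ repCol k (L i) := repCol_mono k (Nat.sub_le _ _)
  have hiq : i ≠ q := by rintro rfl; omega
  -- As `L i > 0`, this yields `L q < l`, so representative `L q` is one of the `l` columns given to
  -- Mat-Select₁.
  have hsum : L i + L q ≤ l := by
    rw [← hL.2.1, ← Finset.sum_pair hiq]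
    exact Finset.sum_le_sum_of_subset (by
      intro x hx
      rcases Finset.mem_insert.1 hx with rfl | hx
      · exact Finset.mem_range.2 hi
      · exact Finset.mem_range.2 (Finset.mem_singleton.1 hx ▸ hq))
  have h3 := hL.2.2 i hi (L i - 1) (by omega) q hq (L q) le_rfl (show L q < l by omega)
  exact tagged_not_le h3 hiq (hK'.2.2 q hq (repCol k (L q)) (by omega) i hi (repCol k (L i - 1)) h1
    (show _ < repCol k (L i) + 1 by omega))

theorem FullSelects.of_tagged (h : FullSelects m (tagged A) k K) : FullSelects m A k K :=
  ⟨h.1, fun i hi j hj i' hi' j' hj' => (Prod.Lex.toLex_le_toLex'.1 (h.2 i hi j hj i' hi' j' hj')).1⟩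

/-- The test at the end of a stage is sufficient. -/
theorem fullSelects_of_max {n : ℕ → ℕ} (hA : ∀ i < m, Monotone (A i)) (hK : Selects m n (tagged A) k K)
    {M : β} (hM : ∀ i < m, 0 < K i → A i (K i - 1) ≤ M) (hK' : ∀ i < m, M ≤ A i (K i)) :
    FullSelects m A k K :=
  ⟨hK.2.1, fun i hi j hj i' hi' j' hj' => ((hA i hi (by omega)).trans (hM i hi (by omega))).trans
    ((hK' i' hi').trans (hA i' hi' hj'))⟩

end Stages

theorem monotone_of_rowSorted {α : Type u} [LinearOrder α] {m : ℕ} {n : ℕ → ℕ∞}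
    {A : ℕ → ℕ → WithTop α} (hn : ∀ i < m, ∀ j : ℕ, (j : ℕ∞) < n i ↔ A i j ≠ ⊤)
    (hA : RowSorted m n A) : ∀ i < m, Monotone (A i) := by
  intro i hi j j' hj
  by_cases h : (j' : ℕ∞) < n i
  · exact hA i hi j j' hj h
  · rw [hn i hi, not_not] at h
    exact h ▸ le_top

/-- If a selected position lay beyond its row, it would hold `⊤`, hence so would every unselected
position. All rows would then be contained in the selection, with one place wasted, leaving fewer
than `k` items in total. -/
theorem FullSelects.isSelection {α : Type u} [LinearOrder α] {m k : ℕ} {n : ℕ → ℕ∞}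
    {A : ℕ → ℕ → WithTop α} {K : ℕ → ℕ} (hn : ∀ i < m, ∀ j : ℕ, (j : ℕ∞) < n i ↔ A i j ≠ ⊤)
    (hk : (k : ℕ∞) ≤ ∑ i ∈ Finset.range m, n i) (h : FullSelects m A k K) :
    IsSelection m n A k K := by
  refine ⟨fun i hi => ?_, h.1, fun i hi j hj i' hi' j' hj' _ => h.2 i hi j hj i' hi' j' hj'⟩
  by_contra! hlt
  have h0 : 0 < K i := by
    rcases (K i).eq_zero_or_pos with h0 | h0
    · simp [h0] at hlt
    · exact h0
  have hni : n i ≤ (K i - 1 : ℕ) := by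
    obtain ⟨x, hx⟩ := ENat.ne_top_iff_exists.1 hlt.ne_top
    rw [← hx] at hlt ⊢
    have := Nat.cast_lt.1 hlt
    exact Nat.cast_le.2 (by omega)
  have htop : A i (K i - 1) = ⊤ := by
    by_contra h'
    exact absurd ((hn i hi _).2 h') hni.not_gt
  have hle : ∀ i' ∈ Finset.range m, n i' ≤ (K i' - if i' = i then 1 else 0 : ℕ) := by
    intro i' hi'
    have hi' := Finset.mem_range.1 hi'
    split_ifs with he
    · rw [he]; exact hni
    · rw [Nat.sub_zero, ← not_lt, hn i' hi', not_not, eq_top_iff, ← htop]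
      exact h.2 i hi _ (by omega) i' hi' _ le_rfl
  have := hk.trans (Finset.sum_le_sum hle)
  rw [← Nat.cast_sum, Nat.cast_le, ← h.1] at this
  refine absurd this (not_le.2 (Finset.sum_lt_sum (fun _ _ => Nat.sub_le _ _)
    ⟨i, Finset.mem_range.2 hi, ?_⟩))
  simp; omega

end MatRAM

/-! ### The steps of a stage as programs -/

namespace MatRAM

open Function

section Stage

variable {β : Type u} [LinearOrder β] {w : ℕ} {A : ℕ → ℕ → β} {p : Cmd} {R μ : ℕ → ℕ} {t : ℕ}
  {Q : (ℕ → ℕ) → (ℕ → ℕ) → ℕ → Prop} {m k f l base : ℕ}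

theorem wp_representatives (h0 : R 0 = m) (h1 : R 1 = k) (h2 : R 2 = f) (h3 : R 3 = l)
    (hw : f + m + l + 2 * k + 10 < 2 ^ w)
    (hQ : ∀ R' ν t', (∀ r, r ≠ 5 → R' r = R r) → (∀ j ≤ l, ν (f + m + j) = repCol k j) →
      (∀ a, a < f + m ∨ f + m + l < a → ν a = μ a) → t' ≤ t + 40 * l + 20 → Q R' ν t') :
    Wp w A p MatSelect4.representatives R μ t Q := by
  unfold MatSelect4.representatives
  rw [wp_block_cons, wp_store, wp_block_cons]
  refine wp_for l (fun x R' ν t' => (∀ r, r ≠ 5 → R' r = R r) ∧ R' 5 = x ∧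
    (∀ j ≤ x, ν (f + m + j) = repCol k j) ∧ (∀ a, a < f + m ∨ f + m + l < a → ν a = μ a) ∧
    t' ≤ t + 40 * x + 10) (by omega) (by omega) ?_ ?_ ?_ ?_
  · refine ⟨fun r hr => update_of_ne hr .., update_self .., fun j hj => ?_, fun a ha => ?_, ?_⟩
    · obtain rfl := Nat.le_zero.1 hj
      simp (disch := omega) only [eval_add, eval_reg, h0, h2, Nat.mod_eq_of_lt, eval_ofNat, add_zero,
        update_self, repCol_zero]
    · simp (disch := omega) only [eval_add, eval_reg, h0, h2, Nat.mod_eq_of_lt, update_of_ne]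
    · simp only [cost_add, cost_reg, cost_ofNat]; omega
  · rintro x R' ν t' hx ⟨hR, h5, -⟩
    exact ⟨h5, by rw [eval_reg, hR 3 (by decide), h3]⟩
  · rintro x R' ν t' hx ⟨hR, h5, hv, hν, ht⟩
    have hvx := hv x le_rfl
    have hle := repCol_le k x
    have e0 := (hR 0 (by decide)).trans h0
    have e1 := (hR 1 (by decide)).trans h1
    have e2 := (hR 2 (by decide)).trans h2
    rw [wp_store]
    simp (disch := omega) only [eval_add, eval_mul, eval_mem, eval_min, eval_reg, eval_ofNat, e0, e1, e2,
      h5, Nat.mod_eq_of_lt, hvx, cost_add, cost_mul, cost_mem, cost_min, cost_reg, cost_ofNat]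
    refine ⟨trivial, fun r hr => ?_, update_self .., fun j hj => ?_, fun a ha => ?_, by omega⟩
    · rw [update_of_ne hr, hR r hr]
    · rcases Nat.le_succ_iff.1 hj with h | rfl
      · rw [update_of_ne (by omega), hv j h]
      · rw [Nat.succ_eq_add_one, ← add_assoc, update_self, repCol_succ]
    · rw [update_of_ne (by omega), hν a ha]
  · rintro R' ν t' ⟨hR, h5, hv, hν, ht⟩
    rw [wp_block_nil]
    exact hQ R' ν _ hR hv hν (by simp only [cost_reg]; omega)

/-- Powers of two are looked up rather than computed. This is why the table of representatives has
`l + 1` entries although Mat-Select₁ uses only `l`: entry `L i ≤ l` is the first unselected one. -/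
theorem wp_lengths {L : ℕ → ℕ} (h0 : R 0 = m) (h2 : R 2 = f) (h7 : R 7 = base)
    (hb : f + m + l < base) (hw : base + m * (k + 1) + m + 10 < 2 ^ w)
    (hL : ∀ i < m, μ (base + i) = L i ∧ L i ≤ l)
    (hμ : ∀ j ≤ l, μ (f + m + j) = repCol k j)
    (hQ : ∀ R' ν t', (∀ r, r ≠ 5 → r ≠ 6 → R' r = R r) →
      R' 6 = ∑ i ∈ Finset.range m, (repCol k (L i) + 1) →
      (∀ i < m, ν (f + i) = repCol k (L i) + 1) →
      (∀ a, a < f ∨ f + m ≤ a → ν a = μ a) → t' ≤ t + 40 * m + 20 → Q R' ν t') :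
    Wp w A p MatSelect4.lengths R μ t Q := by
  unfold MatSelect4.lengths
  rw [wp_block_cons, wp_set, wp_block_cons]
  refine wp_for m (fun x R' ν t' => (∀ r, r ≠ 5 → r ≠ 6 → R' r = R r) ∧ R' 5 = x ∧
    R' 6 = ∑ i ∈ Finset.range x, (repCol k (L i) + 1) ∧
    (∀ i < x, ν (f + i) = repCol k (L i) + 1) ∧ (∀ a, a < f ∨ f + m ≤ a → ν a = μ a) ∧
    t' ≤ t + 40 * x + 10) (by omega) (by omega) ?_ ?_ ?_ ?_
  · refine ⟨fun r hr hr' => ?_, update_self .., ?_, fun i hi => absurd hi (Nat.not_lt_zero _),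
      fun a _ => rfl, ?_⟩
    · rw [update_of_ne hr, update_of_ne hr']
    · rw [update_of_ne (by decide), update_self, eval_ofNat]; simp
    · simp only [cost_ofNat]; omega
  · rintro x R' ν t' hx ⟨hR, h5, -⟩
    exact ⟨h5, by rw [eval_reg, hR 0 (by decide) (by decide), h0]⟩
  · rintro x R' ν t' hx ⟨hR, h5, h6, hv, hν, ht⟩
    have hle := repCol_le k (L x)
    have e0 := (hR 0 (by decide) (by decide)).trans h0
    have e2 := (hR 2 (by decide) (by decide)).trans h2
    have e7 := (hR 7 (by decide) (by decide)).trans h7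
    obtain ⟨hLx, hLl⟩ := hL x hx
    have hx1 : ν (base + x) = L x := by rw [hν _ (by omega), hLx]
    have hx2 : ν (f + m + L x) = repCol k (L x) := by rw [hν _ (by omega), hμ _ hLl]
    have hk : k + 1 ≤ m * (k + 1) := Nat.le_mul_of_pos_left _ (by omega)
    have hs : ∑ i ∈ Finset.range (x + 1), (repCol k (L i) + 1) ≤ m * (k + 1) := by
      calc _ ≤ ∑ i ∈ Finset.range (x + 1), (k + 1) :=
            Finset.sum_le_sum fun i _ => Nat.add_le_add_right (repCol_le _ _) _
        _ = (x + 1) * (k + 1) := by simp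
        _ ≤ m * (k + 1) := Nat.mul_le_mul_right _ hx
    rw [Finset.sum_range_succ] at hs
    rw [wp_block_cons, wp_store, wp_block_cons, wp_set, wp_block_nil]
    simp (disch := omega) only [eval_add, eval_mem, eval_reg, eval_ofNat, e0, e2, e7, h5, h6,
      Nat.mod_eq_of_lt, hx1, hx2, update_self, cost_add, cost_mem, cost_reg, cost_ofNat, ne_eq,
      Nat.reduceEqDiff, not_false_eq_true, update_of_ne]
    refine ⟨trivial, fun r hr hr' => ?_, trivial, ?_, fun i hi => ?_, fun a ha => ?_, by omega⟩
    · rw [update_of_ne hr, update_of_ne hr', hR r hr hr']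
    · rw [Finset.sum_range_succ]
    · rcases Nat.lt_succ_iff_lt_or_eq.1 hi with h | rfl
      · rw [update_of_ne (by omega), hv i h]
      · rw [update_self]
    · rw [update_of_ne (by omega), hν a ha]
  · rintro R' ν t' ⟨hR, h5, h6, hv, hν, ht⟩
    rw [wp_block_nil]
    exact hQ R' ν _ hR h6 hv hν (by simp only [cost_reg]; omega)

theorem wp_findMax {K : ℕ → ℕ} (h0 : R 0 = m) (h7 : R 7 = base) (hw : base + m + 10 < 2 ^ w)
    (hK : ∀ i < m, μ (base + i) = K i) (hpos : ∃ i < m, 0 < K i)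
    (hQ : ∀ R' t' p, (∀ r, r ≠ 5 → r ≠ 8 → R' r = R r) → R' 8 = p → p < m → 0 < K p →
      (∀ i < m, 0 < K i → A i (K i - 1) ≤ A p (K p - 1)) → t' ≤ t + 40 * m + 20 → Q R' μ t') :
    Wp w A p MatSelect4.findMax R μ t Q := by
  unfold MatSelect4.findMax
  rw [wp_block_cons, wp_set, wp_block_cons]
  refine wp_for m (fun x R' ν t' => ν = μ ∧ (∀ r, r ≠ 5 → r ≠ 8 → R' r = R r) ∧ R' 5 = x ∧
    ((R' 8 = m ∧ ∀ i < x, K i = 0) ∨ (R' 8 < m ∧ 0 < K (R' 8) ∧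
      ∀ i < x, 0 < K i → A i (K i - 1) ≤ A (R' 8) (K (R' 8) - 1))) ∧
    t' ≤ t + 40 * x + 10) (by omega) (by omega) ?_ ?_ ?_ ?_
  · refine ⟨rfl, fun r hr hr' => ?_, update_self .., Or.inl ⟨?_, fun i hi => absurd hi (Nat.not_lt_zero _)⟩,
      ?_⟩
    · rw [update_of_ne hr, update_of_ne hr']
    · rw [update_of_ne (by decide), update_self, eval_reg, h0]
    · simp only [cost_reg]; omega
  · rintro x R' ν t' hx ⟨-, hR, h5, -⟩
    exact ⟨h5, by rw [eval_reg, hR 0 (by decide) (by decide), h0]⟩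
  · rintro x R' ν t' hx ⟨rfl, hR, h5, h8, ht⟩
    have e0 := (hR 0 (by decide) (by decide)).trans h0
    have e7 := (hR 7 (by decide) (by decide)).trans h7
    have hKx := hK x hx
    have m1 : 1 % 2 ^ w = 1 := Nat.mod_eq_of_lt (by omega)
    rw [wp_ite, eval_lt]
    simp (disch := omega) only [eval_add, eval_mem, eval_reg, eval_ofNat, e0, e7, h5, Nat.mod_eq_of_lt,
      hKx, cost_add, cost_mem, cost_reg, cost_ofNat, cost_lt, Nat.zero_mod, wp_skip]
    have hR' : ∀ v, (∀ r, r ≠ 5 → r ≠ 8 → update (update R' 8 v) 5 (x + 1) r = R r) := fun v r hr hr' => by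
      rw [update_of_ne hr, update_of_ne hr', hR r hr hr']
    refine ⟨fun hpos => ?_, fun hz => ?_⟩
    · have hpos : 0 < K x := by by_contra h; simp [h] at hpos
      rw [wp_ite, eval_lt]
      simp only [eval_reg, e0, cost_lt, cost_reg]
      refine ⟨fun hlt => ?_, fun hlt => ?_⟩
      · obtain ⟨hm8, hp8, hle⟩ := h8.resolve_left fun h => by simp [h.1] at hlt
        have hK8 := hK (R' 8) hm8
        rw [wp_ite, eval_less]
        simp (disch := omega) only [eval_add, eval_mem, eval_reg, eval_ofNat, eval_sub, e7, h5,
          Nat.mod_eq_of_lt, hKx, hK8, wp_skip, wp_set, cost_less, cost_add, cost_mem, cost_reg,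
          cost_ofNat, cost_sub, m1]
        refine ⟨fun h => ?_, fun h => ?_⟩
        · have h : A (R' 8) (K (R' 8) - 1) < A x (K x - 1) := by by_contra h'; simp [h'] at h
          refine ⟨by rw [update_of_ne (by decide), h5], trivial, hR' x, update_self .., Or.inr ?_, by omega⟩
          simp only [ne_eq, Nat.reduceEqDiff, not_false_eq_true, update_of_ne, update_self]
          refine ⟨hx, hpos, fun i hi hi' => ?_⟩
          rcases Nat.lt_succ_iff_lt_or_eq.1 hi with h' | rfl
          · exact (hle i h' hi').trans h.le
          · exact le_rfl
        · have h : A x (K x - 1) ≤ A (R' 8) (K (R' 8) - 1) := by by_contra h'; simp [not_le.1 h'] at h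
          refine ⟨trivial, trivial, fun r hr hr' => by rw [update_of_ne hr, hR r hr hr'], update_self .., Or.inr ?_,
            by omega⟩
          simp only [ne_eq, Nat.reduceEqDiff, not_false_eq_true, update_of_ne]
          refine ⟨hm8, hp8, fun i hi hi' => ?_⟩
          rcases Nat.lt_succ_iff_lt_or_eq.1 hi with h' | rfl
          · exact hle i h' hi'
          · exact h
      · obtain ⟨hm8, hz8⟩ := h8.resolve_right fun h => by simp [h.1] at hlt
        rw [wp_set, eval_reg, h5, cost_reg]
        refine ⟨by rw [update_of_ne (by decide), h5], rfl, hR' x, update_self .., Or.inr ?_, by omega⟩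
        simp only [ne_eq, Nat.reduceEqDiff, not_false_eq_true, update_of_ne, update_self]
        refine ⟨hx, hpos, fun i hi hi' => ?_⟩
        rcases Nat.lt_succ_iff_lt_or_eq.1 hi with h' | rfl
        · rw [hz8 i h'] at hi'; exact absurd hi' (lt_irrefl _)
        · exact le_rfl
    · have hz : K x = 0 := by by_contra h; simp [Nat.pos_of_ne_zero h] at hz
      refine ⟨trivial, trivial, fun r hr hr' => by rw [update_of_ne hr, hR r hr hr'], update_self .., ?_, by omega⟩
      simp only [ne_eq, Nat.reduceEqDiff, not_false_eq_true, update_of_ne]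
      refine h8.imp (fun h => ⟨h.1, fun i hi => ?_⟩) fun h => ⟨h.1, h.2.1, fun i hi hi' => ?_⟩
      · rcases Nat.lt_succ_iff_lt_or_eq.1 hi with h' | rfl
        · exact h.2 i h'
        · exact hz
      · rcases Nat.lt_succ_iff_lt_or_eq.1 hi with h' | rfl
        · exact h.2.2 i h' hi'
        · omega
  · rintro R' ν t' ⟨rfl, hR, h5, h8, ht⟩
    rw [wp_block_nil]
    obtain ⟨i, hi, hKi⟩ := hpos
    obtain ⟨hm8, hp8, hle⟩ := h8.resolve_left fun h => by have := h.2 i hi; omega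
    exact hQ R' _ _ hR rfl hm8 hp8 hle (by simp only [cost_reg]; omega)

theorem wp_verify {K : ℕ → ℕ} {q : ℕ} (h0 : R 0 = m) (h7 : R 7 = base) (h8 : R 8 = q)
    (hw : base + m + 10 < 2 ^ w) (hq : q < m) (hK : ∀ i < m, μ (base + i) = K i)
    (hQ : ∀ R' t', (∀ r, r ≠ 5 → r ≠ 4 → R' r = R r) →
      (R' 4 = 1 ∧ (∀ i < m, A q (K q - 1) ≤ A i (K i)) ∨
        R' 4 = 0 ∧ ∃ i < m, A i (K i) < A q (K q - 1)) →
      t' ≤ t + 40 * m + 20 → Q R' μ t') :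
    Wp w A p MatSelect4.verify R μ t Q := by
  unfold MatSelect4.verify
  have m1 : 1 % 2 ^ w = 1 := Nat.mod_eq_of_lt (by omega)
  rw [wp_block_cons, wp_set, wp_block_cons]
  refine wp_for m (fun x R' ν t' => ν = μ ∧ (∀ r, r ≠ 5 → r ≠ 4 → R' r = R r) ∧ R' 5 = x ∧
    (R' 4 = 1 ∧ (∀ i < x, A q (K q - 1) ≤ A i (K i)) ∨
      R' 4 = 0 ∧ ∃ i < x, A i (K i) < A q (K q - 1)) ∧
    t' ≤ t + 40 * x + 10) (by omega) (by omega) ?_ ?_ ?_ ?_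
  · refine ⟨rfl, fun r hr hr' => ?_, update_self .., Or.inl ⟨?_, fun i hi => absurd hi (Nat.not_lt_zero _)⟩,
      ?_⟩
    · rw [update_of_ne hr, update_of_ne hr']
    · rw [update_of_ne (by decide), update_self, eval_ofNat, m1]
    · simp only [cost_ofNat]; omega
  · rintro x R' ν t' hx ⟨-, hR, h5, -⟩
    exact ⟨h5, by rw [eval_reg, hR 0 (by decide) (by decide), h0]⟩
  · rintro x R' ν t' hx ⟨rfl, hR, h5, h4, ht⟩
    have e7 := (hR 7 (by decide) (by decide)).trans h7
    have e8 := (hR 8 (by decide) (by decide)).trans h8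
    have hKx := hK x hx
    have hKq := hK q hq
    rw [wp_ite, eval_less]
    simp (disch := omega) only [eval_add, eval_mem, eval_reg, eval_ofNat, eval_sub, e7, e8, h5,
      Nat.mod_eq_of_lt, hKx, hKq, wp_skip, wp_set, cost_less, cost_add, cost_mem, cost_reg,
      cost_ofNat, cost_sub, m1, Nat.zero_mod]
    refine ⟨fun h => ?_, fun h => ?_⟩
    · have h : A x (K x) < A q (K q - 1) := by by_contra h'; simp [h'] at h
      refine ⟨by rw [update_of_ne (by decide), h5], trivial, fun r hr hr' => ?_, update_self ..,
        Or.inr ⟨?_, x, Nat.lt_succ_self x, h⟩, by omega⟩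
      · rw [update_of_ne hr, update_of_ne hr', hR r hr hr']
      · rw [update_of_ne (by decide), update_self]
    · have h : A q (K q - 1) ≤ A x (K x) := by by_contra h'; simp [not_le.1 h'] at h
      refine ⟨trivial, trivial, fun r hr hr' => by rw [update_of_ne hr, hR r hr hr'], update_self .., ?_, by omega⟩
      rw [update_of_ne (by decide)]
      refine h4.imp (fun h' => ⟨h'.1, fun i hi => ?_⟩) fun ⟨h', i, hi, hlt⟩ => ⟨h', i, by omega, hlt⟩
      rcases Nat.lt_succ_iff_lt_or_eq.1 hi with h'' | rfl
      · exact h'.2 i h''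
      · exact h
  · rintro R' ν t' ⟨rfl, hR, h5, h4, ht⟩
    rw [wp_block_nil]
    exact hQ R' _ hR h4 (by simp only [cost_reg]; omega)

end Stage

end MatRAM

/-! ### Correctness and running time of Mat-Select₄ -/

namespace MatRAM

open Function

section MatSelect4

variable {β : Type u} [LinearOrder β] {w : ℕ} {A : ℕ → ℕ → β} {p : Cmd} {R μ : ℕ → ℕ} {t : ℕ}
  {Q : (ℕ → ℕ) → (ℕ → ℕ) → ℕ → Prop} {m k f l : ℕ}

open MatSelect4 in
/-- One stage of Mat-Select₄. -/
def stage (S₁ S₃ : Cmd) : Cmd :=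
  .block [
    representatives,
    .set 7 (MatSelect4.f + MatSelect4.m + MatSelect4.l + 1),
    .run S₁ [MatSelect4.m, MatSelect4.l, MatSelect4.f + MatSelect4.m, base] 9,
    lengths,
    .ite (.lt sum MatSelect4.k) .skip (.block [
      .run S₃ [MatSelect4.m, MatSelect4.k, MatSelect4.f, base] 9,
      findMax,
      verify]),
    .ite (.lt done 1) (.set 3 (MatSelect4.l + MatSelect4.l)) .skip]

/-- With `X = m + k + f + 2 ≥ 5`, all sizes in a stage are at most `X ^ 3`. The subroutines need
tenth powers, hence the exponent 30. -/
theorem stage_word_bound (hm : 0 < m) (hk : 2 * m ≤ k) (hl : l ≤ m + 2 * k)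
    (hw : (m + k + f + 2) ^ 30 ≤ 2 ^ w) :
    f + m + l + 2 * k + 10 < 2 ^ w ∧ f + m + l + 1 + m * (k + 1) + m + 10 < 2 ^ w ∧
      (m + l + (f + m) + (f + m + l + 1) + 2) ^ 10 ≤ 2 ^ w ∧
      ∀ s ≤ m * (k + 1), (m + k + s + f + (f + m + l + 1) + 2) ^ 10 ≤ 2 ^ w := by
  obtain ⟨X, hX⟩ : ∃ X, X = m + k + f + 2 := ⟨_, rfl⟩
  rw [← hX] at hw
  have h5 : 5 ≤ X := by omega
  have h1 : 5 * X ≤ X ^ 2 := by rw [sq]; exact Nat.mul_le_mul_right _ h5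
  have h2 : 5 * X ^ 2 ≤ X ^ 3 := by rw [pow_succ X 2, mul_comm]; exact Nat.mul_le_mul_left _ h5
  have h3 : m * (k + 1) ≤ X ^ 2 := by rw [sq]; exact Nat.mul_le_mul (by omega) (by omega)
  have h4 : X ^ 3 < 2 ^ w :=
    (pow_lt_pow_right₀ (show 1 < X by omega) (show 3 < 30 by norm_num)).trans_le hw
  have key : ∀ y, y ≤ X ^ 3 → y ^ 10 ≤ 2 ^ w := fun y hy =>
    calc y ^ 10 ≤ (X ^ 3) ^ 10 := Nat.pow_le_pow_left hy 10
      _ = X ^ 30 := (pow_mul X 3 10).symm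
      _ ≤ 2 ^ w := hw
  generalize X ^ 3 = Y at *
  generalize X ^ 2 = Z at *
  exact ⟨by omega, by omega, key _ (by omega), fun s hs => key _ (by omega)⟩

/-- A failing stage certifies that `l` is below the number of representatives in `K₀`. A successful
one returns `K₀` or a selection containing at least `l` representatives. As `m ≤ l`, every `O(m +
l)` cost is `O(l)`. -/
theorem wp_stage (hm : 0 < m) (hk : 2 * m ≤ k) (hml : m ≤ l) (hl : l ≤ m + 2 * k)
    (hw : (m + k + f + 2) ^ 30 ≤ 2 ^ w) (hA : ∀ i < m, Monotone (A i)) {K₀ : ℕ → ℕ}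
    (hK₀ : FullSelects m (tagged A) k K₀)
    (h0 : R 0 = m) (h1 : R 1 = k) (h2 : R 2 = f) (h3 : R 3 = l) (h4 : R 4 = 0)
    (hQ : ∀ R' ν t', R' 0 = m → R' 1 = k → R' 2 = f → (∀ a < f, ν a = μ a) →
      (R' 4 = 0 ∧ R' 3 = l + l ∧ l < ∑ i ∈ Finset.range m, reps (K₀ i) ∨
        R' 4 = 1 ∧ R' 7 = f + m + l + 1 ∧ ∃ K, (∀ i < m, ν (f + m + l + 1 + i) = K i) ∧
          FullSelects m A k K ∧
          ((∀ i < m, K i = K₀ i) ∨ l ≤ ∑ i ∈ Finset.range m, reps (K i))) →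
      t' ≤ t + 27000000 * l → Q R' ν t') :
    Wp w A p (stage (matSel true) (matSel false)) R μ t Q := by
  obtain ⟨hw1, hw2, hw3, hw4⟩ := stage_word_bound hm hk hl hw
  have m1 : 1 % 2 ^ w = 1 := Nat.mod_eq_of_lt (by omega)
  unfold stage
  rw [wp_block_cons]
  refine wp_representatives h0 h1 h2 h3 hw1 fun R₁ ν₁ t₁ hR₁ hv₁ hν₁ ht₁ => ?_
  have a0 := (hR₁ 0 (by decide)).trans h0
  have a1 := (hR₁ 1 (by decide)).trans h1
  have a2 := (hR₁ 2 (by decide)).trans h2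
  have a3 := (hR₁ 3 (by decide)).trans h3
  have a4 := (hR₁ 4 (by decide)).trans h4
  rw [wp_block_cons, wp_set, wp_block_cons]
  simp (disch := omega) only [eval_add, eval_reg, eval_ofNat, a0, a2, a3, Nat.mod_eq_of_lt, cost_add,
    cost_reg, cost_ofNat]
  have hreps : ∀ i < m, ∀ j < l, A i (ν₁ (f + m + j)) = A i (repCol k j) := fun i _ j hj => by
    rw [hv₁ j hj.le]
  obtain ⟨ν₂, t₂, hr₂, hν₂, hs₂, ht₂⟩ := matSel_true_spec (w := w) (A := A) (m := m) (k := l)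
    (g := f + m) (f := f + m + l + 1) (μ := ν₁) hm hw3 (by omega) (fun i hi j j' hj hj' => by
      have hj' : j' < l := Nat.cast_lt.1 hj'
      simp only
      rw [hreps i hi j (by omega), hreps i hi j' hj']
      exact hA i hi (repCol_mono k hj))
  obtain ⟨v₂, hr₂⟩ := hr₂.returns
  refine wp_run [m, l, f + m, f + m + l + 1] ?_ ⟨ν₂, v₂, t₂, hr₂, ?_⟩
  · simp (disch := omega) only [List.map_cons, List.map_nil, eval_add, eval_reg, a0, a2, a3,
      Nat.mod_eq_of_lt, ne_eq, Nat.reduceEqDiff, not_false_eq_true, update_of_ne, update_self,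
      OfNat.zero_ne_ofNat]
  set L : ℕ → ℕ := fun i => ν₂ (f + m + l + 1 + i) with hLdef
  have hL : Selects m (fun _ => l) (tagged fun i j => A i (repCol k j)) l L := by
    refine ⟨hs₂.1, hs₂.2.1, fun i hi j hj i' hi' j' hj' hj'' => ?_⟩
    have := hs₂.2.2 i hi j hj i' hi' j' hj' hj''
    simp only [tagged] at this ⊢
    rwa [hreps i hi j (hj.trans_le (hs₂.1 i hi)), hreps i' hi' j' hj''] at this
  rw [wp_block_cons]
  refine wp_lengths (m := m) (k := k) (f := f) (l := l) (base := f + m + l + 1) (L := L) ?_ ?_ ?_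
    (by omega) hw2 (fun i hi => ⟨rfl, hL.1 i hi⟩) (fun j hj => by rw [hν₂ _ (by omega), hv₁ j hj])
    fun R₃ ν₃ t₃ hR₃ h6 hv₃ hν₃ ht₃ => ?_
  · simp only [ne_eq, OfNat.zero_ne_ofNat, not_false_eq_true, update_of_ne, a0]
  · simp only [ne_eq, Nat.reduceEqDiff, not_false_eq_true, update_of_ne, a2]
  · simp only [ne_eq, Nat.reduceEqDiff, not_false_eq_true, update_of_ne, update_self]
  have b0 : R₃ 0 = m := by
    rw [hR₃ 0 (by decide) (by decide), update_of_ne (by decide), update_of_ne (by decide), a0]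
  have b1 : R₃ 1 = k := by
    rw [hR₃ 1 (by decide) (by decide), update_of_ne (by decide), update_of_ne (by decide), a1]
  have b2 : R₃ 2 = f := by
    rw [hR₃ 2 (by decide) (by decide), update_of_ne (by decide), update_of_ne (by decide), a2]
  have b3 : R₃ 3 = l := by
    rw [hR₃ 3 (by decide) (by decide), update_of_ne (by decide), update_of_ne (by decide), a3]
  have b4 : R₃ 4 = 0 := by
    rw [hR₃ 4 (by decide) (by decide), update_of_ne (by decide), update_of_ne (by decide), a4]
  have b7 : R₃ 7 = f + m + l + 1 := by
    rw [hR₃ 7 (by decide) (by decide), update_of_ne (by decide), update_self]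
  have hμ₃ : ∀ a < f, ν₃ a = μ a := fun a ha => by
    rw [hν₃ a (by omega), hν₂ a (by omega), hν₁ a (by omega)]
  have ht₃' : t₃ ≤ t + 40 * l + 20 + 8000000 * (m + l) + 40 * m + 60 := by
    simp only [List.map_cons, List.map_nil, List.sum_cons, List.sum_nil, cost_add, cost_reg] at ht₃
    omega
  have hsum : ∑ i ∈ Finset.range m, (repCol k (L i) + 1) ≤ m * (k + 1) := by
    calc _ ≤ ∑ i ∈ Finset.range m, (k + 1) :=
          Finset.sum_le_sum fun i _ => Nat.add_le_add_right (repCol_le _ _) _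
      _ = m * (k + 1) := by simp
  -- a stage with many representatives succeeds
  have hlen : ∑ i ∈ Finset.range m, reps (K₀ i) ≤ l → ∀ i < m, K₀ i < repCol k (L i) + 1 :=
    fun h i hi => lt_length_of_selects hK₀ hL h hi
  -- Common end of the two ways to fail: cut rows with too few items, or a failed test.
  have hfail : ∀ R' ν t', R' 0 = m → R' 1 = k → R' 2 = f → R' 3 = l → R' 4 = 0 →
      (∀ a < f, ν a = μ a) → l < ∑ i ∈ Finset.range m, reps (K₀ i) →
      t' + 10 ≤ t + 27000000 * l →
      Wp w A p (.block [.ite (.lt MatSelect4.done 1) (.set 3 (MatSelect4.l + MatSelect4.l)) .skip])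
        R' ν t' Q := by
    intro R' ν t' c0 c1 c2 c3 c4 hν hlt ht
    rw [wp_block_cons, wp_ite, eval_lt]
    simp (disch := omega) only [eval_reg, eval_ofNat, c3, c4, m1, wp_set, wp_block_nil, eval_add,
      Nat.mod_eq_of_lt, cost_lt, cost_add, cost_reg, cost_ofNat]
    refine ⟨fun _ => hQ _ _ _ ?_ ?_ ?_ hν (Or.inl ⟨?_, update_self .., hlt⟩) (by omega),
      fun h => by simp at h⟩
    · rw [update_of_ne (by decide), c0]
    · rw [update_of_ne (by decide), c1]
    · rw [update_of_ne (by decide), c2]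
    · rw [update_of_ne (by decide), c4]
  rw [wp_block_cons, wp_ite, eval_lt]
  simp only [eval_reg, h6, b1, cost_lt, cost_reg]
  refine ⟨fun h => ?_, fun h => ?_⟩
  · rw [wp_skip]
    refine hfail _ _ _ b0 b1 b2 b3 b4 hμ₃ ?_ (by omega)
    by_contra! hle
    have h : ∑ i ∈ Finset.range m, (repCol k (L i) + 1) < k := by by_contra h'; simp [h'] at h
    refine absurd h (not_lt.2 ?_)
    refine hK₀.1.ge.trans ?_
    exact Finset.sum_le_sum fun i hi => (hlen hle i (Finset.mem_range.1 hi)).le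
  · have hkn : k ≤ ∑ i ∈ Finset.range m, (repCol k (L i) + 1) := by
      by_contra h'; simp [not_le.1 h'] at h
    obtain ⟨ν₄, t₄, hr₄, hν₄, hs₄, ht₄⟩ := matSel_false_spec (w := w) (A := A) (m := m) (k := k)
      (g := f) (f := f + m + l + 1) (n := fun i => repCol k (L i) + 1) (μ := ν₃) hm (hw4 _ hsum)
      (by omega) hv₃ (fun i _ => by omega) hkn (fun i hi j j' hj _ => hA i hi hj)
    have hlog : ∑ i ∈ Finset.range m, (1 + Nat.log 2 (repCol k (L i) + 1)) ≤ m + l := by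
      calc _ ≤ ∑ i ∈ Finset.range m, (1 + L i) :=
            Finset.sum_le_sum fun i _ => Nat.add_le_add_left (log_repCol_le _ _) _
        _ = m + l := by rw [Finset.sum_add_distrib, hL.2.1]; simp
    obtain ⟨v₄, hr₄⟩ := hr₄.returns
    rw [wp_block_cons]
    refine wp_run [m, k, f, f + m + l + 1] ?_ ⟨ν₄, v₄, t₄, hr₄, ?_⟩
    · simp only [List.map_cons, List.map_nil, eval_reg, b0, b1, b2, b7]
    set K : ℕ → ℕ := fun i => ν₄ (f + m + l + 1 + i) with hKdef
    rw [wp_block_cons]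
    refine wp_findMax (m := m) (base := f + m + l + 1) (K := K) ?_ ?_ (by omega)
      (fun i _ => rfl) ?_ fun R₅ t₅ q hR₅ h8 hq hKq hmax ht₅ => ?_
    · rw [update_of_ne (by decide), b0]
    · rw [update_of_ne (by decide), b7]
    · by_contra! h
      have := hs₄.2.1
      rw [Finset.sum_eq_zero fun i hi => Nat.le_zero.1 (h i (Finset.mem_range.1 hi))] at this
      omega
    have c : ∀ r, r ≠ 5 → r ≠ 8 → r ≠ 9 → R₅ r = R₃ r := fun r hr hr' hr'' => by
      rw [hR₅ r hr hr', update_of_ne hr'']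
    rw [wp_block_cons]
    refine wp_verify (m := m) (base := f + m + l + 1) (K := K) (q := q) ?_ ?_ h8 (by omega) hq
      (fun i _ => rfl) fun R₆ t₆ hR₆ h4 ht₆ => ?_
    · rw [c 0 (by decide) (by decide) (by decide), b0]
    · rw [c 7 (by decide) (by decide) (by decide), b7]
    have d : ∀ r, r ≠ 4 → r ≠ 5 → r ≠ 8 → r ≠ 9 → R₆ r = R₃ r := fun r hr hr' hr'' h9 => by
      rw [hR₆ r hr' hr, c r hr' hr'' h9]
    rw [wp_block_nil]
    have d0 := (d 0 (by decide) (by decide) (by decide) (by decide)).trans b0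
    have d1 := (d 1 (by decide) (by decide) (by decide) (by decide)).trans b1
    have d2 := (d 2 (by decide) (by decide) (by decide) (by decide)).trans b2
    have d3 := (d 3 (by decide) (by decide) (by decide) (by decide)).trans b3
    have d7 := (d 7 (by decide) (by decide) (by decide) (by decide)).trans b7
    have hμ₄ : ∀ a < f, ν₄ a = μ a := fun a ha => by rw [hν₄ a (by omega), hμ₃ a ha]
    have ht₆' : t₆ + 20 ≤ t + 27000000 * l := by
      simp only [List.map_cons, List.map_nil, List.sum_cons, List.sum_nil, cost_reg] at ht₅
      omega
    rcases h4 with ⟨h4, hver⟩ | ⟨h4, i, hi, hver⟩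
    · rw [wp_block_cons, wp_ite, eval_lt]
      simp only [eval_reg, eval_ofNat, h4, m1, lt_irrefl, if_false, wp_skip, wp_block_nil, cost_lt,
        cost_reg, cost_ofNat]
      refine ⟨fun h => absurd rfl h, fun _ => hQ _ _ _ d0 d1 d2 hμ₄ (Or.inr ⟨h4, d7, K, fun i _ => rfl,
        fullSelects_of_max hA hs₄ hmax hver, ?_⟩) (by omega)⟩
      by_contra! hne
      exact absurd (le_sum_reps_of_ne hK₀ hL hs₄ hne.1) (not_le.2 hne.2)
    · refine hfail _ _ _ d0 d1 d2 d3 h4 hμ₄ ?_ (by omega)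
      by_contra! hle
      -- With enough representatives a deviation from `K₀` would fill a cut row, which `hlen`
      -- forbids; and `K₀`, being a selection of the full matrix, passes the test.
      have heq : ∀ i < m, K i = K₀ i := by
        by_contra! hne
        obtain ⟨r, hr, h, h'⟩ := eq_of_selects hK₀ hs₄ hne
        have := hlen hle r hr
        rw [h'] at h
        omega
      refine absurd hver (not_lt.2 ?_)
      rw [heq i hi]
      exact hK₀.of_tagged.2 q hq (K q - 1) (by rw [← heq q hq]; omega) i hi _ le_rfl

/-- The stages form a geometric series dominated by the last `l`. That `l` is `m`, or less than
twice the number of representatives in `K₀` because the preceding stage failed, or bounded by the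
representatives in the result. -/
theorem matSelect4_spec (hm : 0 < m) (hk : 2 * m ≤ k) (hw : (m + k + f + 2) ^ 30 ≤ 2 ^ w)
    (hA : ∀ i < m, Monotone (A i)) (μ : ℕ → ℕ) :
    ∃ ν v t, Returns w A (matSelect4 (matSel true) (matSel false)) [m, k, f] μ ν v t ∧
      ((∀ a < f, ν a = μ a) ∧ FullSelects m A k (fun i => ν (f + i)) ∧
      t ≤ 200000000 * (m + ∑ i ∈ Finset.range m, reps (ν (f + i)))) := by
  obtain ⟨K₀, hK₀⟩ := exists_fullSelects hm (tagged_monotone hA) k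
  obtain ⟨hw1, -, -⟩ := stage_word_bound hm hk le_rfl hw
  have hρ : ∑ i ∈ Finset.range m, reps (K₀ i) ≤ k := by
    conv_rhs => rw [← hK₀.1]
    exact Finset.sum_le_sum fun i _ => reps_le _
  have m1 : 1 % 2 ^ w = 1 := Nat.mod_eq_of_lt (by omega)
  have f0 : frame [m, k, f] = fun r => [m, k, f].getD r 0 := rfl
  refine exists_returns_of_eq (c := .block [.set 3 (.reg 0), .set 4 0,
    .while (.lt (.reg 4) 1) (stage (matSel true) (matSel false)), MatSelect4.copyResult]) rfl
    (P := fun ν v t => _) ?_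
  rw [wp_block_cons, wp_set, wp_block_cons, wp_set, wp_block_cons]
  -- The elapsed time is proportional to `R 3 - m`: a failing stage costs `O(l)` and raises `R 3` by
  -- exactly `l`.
  refine wp_while (fun R ν t => R 0 = m ∧ R 1 = k ∧ R 2 = f ∧ (∀ a < f, ν a = μ a) ∧
    ((R 4 = 0 ∧ m ≤ R 3 ∧ (R 3 = m ∨ R 3 < 2 * ∑ i ∈ Finset.range m, reps (K₀ i)) ∧
      t ≤ 10 + 27000010 * (R 3 - m)) ∨
    (R 4 = 1 ∧ ∃ K l, R 7 = f + m + l + 1 ∧ l ≤ m + 2 * k ∧ (∀ i < m, ν (f + m + l + 1 + i) = K i) ∧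
      FullSelects m A k K ∧ l ≤ m + 2 * ∑ i ∈ Finset.range m, reps (K i) ∧
      t ≤ 10 + 27000010 * (2 * l))))
    -- The guess stays bounded because `K₀` contains at most `k` representatives; the extra 1 makes
    -- the variant drop when the flag is set.
    (fun R _ => if R 4 = 0 then m + 2 * k + 1 - R 3 + 1 else 0) ?_ ?_ ?_
  · refine ⟨?_, ?_, ?_, fun _ _ => rfl, Or.inl ⟨?_, ?_, Or.inl ?_, ?_⟩⟩ <;>
    simp [f0]
  · rintro R ν t ⟨h0, h1, h2, hν, h⟩ he
    rcases h with ⟨h4, hml, hl, ht⟩ | ⟨h4, -⟩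
    · have hlk : R 3 ≤ m + 2 * k := by omega
      refine wp_stage hm hk hml hlk hw hA hK₀ h0 h1 h2 rfl h4 fun R' ν' t' h0' h1' h2' hν' h' ht' => ?_
      simp only [cost_lt, cost_reg, cost_ofNat] at ht'
      rw [if_pos h4]
      rcases h' with ⟨h4', h3', hlt⟩ | ⟨h4', h7', K, hK, hs, hle⟩
      · rw [if_pos h4', h3']
        exact ⟨⟨h0', h1', h2', fun a ha => (hν' a ha).trans (hν a ha),
          Or.inl ⟨h4', by omega, Or.inr (by omega), by omega⟩⟩, by omega⟩
      · rw [if_neg (by omega)]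
        refine ⟨⟨h0', h1', h2', fun a ha => (hν' a ha).trans (hν a ha),
          Or.inr ⟨h4', K, R 3, h7', hlk, hK, hs, ?_, by omega⟩⟩, by omega⟩
        rcases hle with heq | hle
        · rw [Finset.sum_congr rfl fun i hi => by rw [heq i (Finset.mem_range.1 hi)]]
          omega
        · omega
    · simp [h4, m1] at he
  · rintro R ν t ⟨h0, h1, h2, hν, h⟩ he
    rcases h with ⟨h4, -⟩ | ⟨-, K, l, h7, hlk, hK, hs, hl, ht⟩
    · simp [h4, m1] at he
    · rw [wp_block_cons]
      unfold MatSelect4.copyResult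
      refine wp_for_store m f K (by omega) (by omega) (fun x ν => ?_) ?_ ?_
      · rw [eval_reg, update_of_ne (by decide), h0]
      · intro x hx ν' hν'
        simp (disch := omega) only [eval_mem, eval_add, eval_reg, update_self, ne_eq, Nat.reduceEqDiff,
          not_false_eq_true, update_of_ne, h2, h7, Nat.mod_eq_of_lt, true_and]
        rw [hν' _ (by omega), hK x hx]
      · intro ν' hv' hν'
        rw [wp_block_nil]
        refine ⟨fun a ha => (hν' a (Or.inl ha)).trans (hν a ha), ⟨?_, ?_⟩, ?_⟩
        · rw [← hs.1]
          exact Finset.sum_congr rfl fun i hi => hv' i (Finset.mem_range.1 hi)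
        · intro i hi j hj i' hi' j' hj'
          simp only [hv' i hi] at hj
          simp only [hv' i' hi'] at hj'
          exact hs.2 i hi j hj i' hi' j' hj'
        · rw [Finset.sum_congr rfl fun i hi => by rw [hv' i (Finset.mem_range.1 hi)]]
          simp only [cost_mem, cost_add, cost_reg, cost_lt, cost_ofNat]
          omega

end MatSelect4

end MatRAM

/-! ### The main theorem -/

theorem mainTheorem2 :
    ∃ matSelect1 matSelect3 : MatRAM.Cmd,
      MatRAM.IsMatSelect1.{u} matSelect1 ∧ MatRAM.IsMatSelect3.{u} matSelect3 ∧
      ∃ c C : ℕ, ∀ (α : Type u) [LinearOrder α] (m k f w : ℕ) (n : ℕ → ℕ∞)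
        (A : ℕ → ℕ → WithTop α) (μ : ℕ → ℕ),
        0 < m → 2 * m ≤ k → (m + k + f + 2) ^ c ≤ 2 ^ w →
        (∀ i < m, ∀ j : ℕ, (j : ℕ∞) < n i ↔ A i j ≠ ⊤) →
        (k : ℕ∞) ≤ ∑ i ∈ Finset.range m, n i →
        MatRAM.RowSorted m n A →
        ∃ (ν : ℕ → ℕ) (t : ℕ),
          MatRAM.Runs w A (MatRAM.matSelect4 matSelect1 matSelect3) [m, k, f] μ ν t ∧
          (∀ a < f, ν a = μ a) ∧
          MatRAM.IsSelection m n A k (fun i => ν (f + i)) ∧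
          (t : ℝ) ≤ C * (m + ∑ i ∈ Finset.range m, Real.logb 2 ((ν (f + i) : ℝ) + 1)) := by
  refine ⟨MatRAM.matSel true, MatRAM.matSel false, MatRAM.isMatSelect1_matSel,
    MatRAM.isMatSelect3_matSel, 30, 200000000, fun α _ m k f w n A μ hm hk hw hn hkn hA => ?_⟩
  obtain ⟨ν, v, t, hr, hν, hs, ht⟩ :=
    MatRAM.matSelect4_spec hm hk hw (MatRAM.monotone_of_rowSorted hn hA) μ
  refine ⟨ν, t, hr.runs, hν, hs.isSelection hn hkn, ?_⟩
  -- `reps x` is the integer part of the binary logarithm of `x + 1`.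
  have hlog : ((∑ i ∈ Finset.range m, MatRAM.reps (ν (f + i)) : ℕ) : ℝ) ≤
      ∑ i ∈ Finset.range m, Real.logb 2 ((ν (f + i) : ℝ) + 1) := by
    push_cast
    refine Finset.sum_le_sum fun i _ => ?_
    exact_mod_cast Real.natLog_le_logb (ν (f + i) + 1) 2
  calc (t : ℝ) ≤ (200000000 * (m + ∑ i ∈ Finset.range m, MatRAM.reps (ν (f + i))) : ℕ) := by
        exact_mod_cast ht
    _ = 200000000 * ((m : ℝ) + (∑ i ∈ Finset.range m, MatRAM.reps (ν (f + i)) : ℕ)) := by push_cast; rfl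
    _ ≤ _ := by push_cast at hlog ⊢; gcongr
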